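/- **Setting.** A diagram $K$ of an oriented virtual knot is given by a signed oriented Gauss code with $n\ge 0$ classical crossings, cut at a base point (the code with $n=0$ is the crossingless unknot); $n_+$ and $n_-$ are the numbers of positive and negative crossings. A *state* $s$ chooses at each classical crossing the $A$- or the $B$-smoothing; the oriented smoothing is the $A$-smoothing at a positive and the $B$-smoothing at a negative crossing. An *enhanced state* is a state with a label $1$ or $X$ on each of its cycles. Let $\widehat{\mathcal C}(K)$ be the rational vector space on the enhanced states. At each crossing fix a *source-sink orientation* (both ends of one strand point away from the crossing, both ends of the other strand point towards it) and a *local order* (labels 1 and 2 on the two outgoing ends). Both smoothings of a crossing are compatible with its source-sink orientation, so the two smoothed arcs at a crossing get a local orientation. Each cycle of a state gets a global orientation (from a marked point on the first arc of the code that lies on it, directed as the knot), and the cycles of a state get a global order (that of their first arcs). The differential is $\partial=\sum_\tau\partial_\tau$, where $\partial_\tau$ acts on the states with an $A$-smoothing at the crossing $\tau$ and changes that smoothing to $B$. It leaves the labels of the cycles away from $\tau$ unchanged. On the cycles through $\tau$ it is multiplication in $\mathbb Q[X]/(X^2-1)$ if two cycles merge, the comultiplication $\Delta(1)=1\otimes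 X+X\otimes 1$, $\Delta(X)=X\otimes X+1\otimes 1$ if a cycle splits, and $0$ if one cycle is replaced by one cycle. Each cycle through $\tau$, before and after the move, is acted on by the bar operation $\overline 1=1$, $\overline X=-X$ if the local orientation at $\tau$ (at its end labelled 1 or 2; at the end labelled 1 for a merged cycle) disagrees with the global orientation of the cycle. Finally $\partial_\tau$ is multiplied, before and after, by the sign of the permutation between the global order of the cycles and the local order (the cycle through label 1, then the cycle through label 2 if it is a different one, then the others in global order). An enhanced state with $i$ $B$-smoothings, $p$ labels $1$ and $m$ labels $X$ has quantum degree $q=i+p-m+n_+-2n_-$. Let $F_j\subseteq\widehat{\mathcal C}(K)$ be spanned by the enhanced states with $q\ge j$. The Khovanov–Lee homology is $\widehat{Kh}(K)=\ker\partial/\operatorname{im}\partial$, and $S_j\subseteq\widehat{Kh}(K)$ consists of the classes with a representative in $F_j$. The integers $j$ with $S_j\neq S_{j+1}$ are the *filtration levels* of $\widehat{Kh}(K)$; $s_{\max}(K)$ and $s_{\min}(K)$ are the highest and the lowest of them, and $\overline s(K)=\tfrac12\bigl(s_{\max}(K)+s_{\min}(K)\bigr)$. **Proposition.** Let $K$ be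 a virtual knot, given by any diagram as above, and let $\overline K$ be the mirror image of $K$, given by the diagram in which the signs of all crossings are changed (by switching all crossings; the same holds if the over- and under-passages are kept and only the signs are changed). The source-sink orientations and local orders may be chosen arbitrarily, for $K$ and for $\overline K$ independently. Then the highest and the lowest filtration level exist for $K$, and 1. $s_{\max}(K)=s_{\min}(K)+2$; 2. $\overline s(K)=s_{\min}(K)+1$; 3. $s_{\max}(\overline K)=-s_{\min}(K)$; 4. $s_{\min}(\overline K)=-s_{\max}(K)$; 5. $\overline s(\overline K)=-\overline s(K)$. -/

import Mathlib

open scoped Classical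

noncomputable section

/-- A diagram of an oriented virtual knot, given as a signed oriented Gauss code with `n` classical
crossings (virtual crossings are not recorded).  Starting at a base point and following the
orientation, one meets `2 * n` passages; `word p = (c, true)` means that the `p`-th passage is the
over-passage through the crossing `c`, and `word p = (c, false)` that it is the under-passage.
`sign c` is the sign of the crossing `c`.  The code with `n = 0` is the crossingless unknot. -/
structure GaussCode where
  n : ℕ
  word : Fin (2 * n) ≃ Fin n × Bool
  sign : Fin n → ℤˣ

/-- Source-sink orientations and local orders at `n` crossings.  At the crossing `c` the two ends
of the strand `source c` (`true` over, `false` under) point away from the crossing and the two ends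
of the other strand point towards it.  The labels 1 and 2 of the local order sit on the two
outgoing ends: label 1 on the end after the crossing (for the orientation of the knot) if
`labelAfter c = true`, and on the end before the crossing otherwise. -/
structure SourceSink (n : ℕ) where
  source : Fin n → Bool
  labelAfter : Fin n → Bool

namespace GaussCode

variable (D : GaussCode)

/-- The mirror image obtained by switching every crossing: the over- and under-passages are
exchanged and every sign changes. -/
def switch : GaussCode where
  n := D.n
  word := D.word.trans (Equiv.prodCongr (Equiv.refl _) Equiv.boolNot)
  sign := fun c => -D.sign c

/-- The mirror image obtained by reflecting the plane of the diagram: every sign changes, the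
over- and under-passages stay. -/
def reflect : GaussCode where
  n := D.n
  word := D.word
  sign := fun c => -D.sign c

/-- `M` is a mirror image of `D`: every crossing has changed its sign. -/
def IsMirror (D M : GaussCode) : Prop := M = D.switch ∨ M = D.reflect

/-- The number `n₊` of positive crossings. -/
def nPos : ℕ := (Finset.univ.filter fun c => D.sign c = 1).card

/-- The number `n₋` of negative crossings. -/
def nNeg : ℕ := (Finset.univ.filter fun c => D.sign c = -1).card

/-! ### States and their cycles -/

/-- The arcs of the diagram: arc `i` runs from passage `i - 1` to passage `i`; the first and the
last arc meet at the base point (they are two halves of one semi-arc of the diagram). -/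
abbrev Arc : Type := Fin (2 * D.n + 1)

/-- An arc with a direction: `true` is the direction of the knot. -/
abbrev Dart : Type := D.Arc × Bool

/-- A choice of smoothing at each crossing: `false` is the `A`-smoothing, `true` the
`B`-smoothing. -/
abbrev State : Type := Fin D.n → Bool

/-- The other passage through the crossing met at the passage `p`. -/
def other (p : Fin (2 * D.n)) : Fin (2 * D.n) :=
  D.word.symm ((D.word p).1, !(D.word p).2)

/-- The smoothing of `c` in the state `s` respects the orientation of the knot: this is the
`A`-smoothing at a positive and the `B`-smoothing at a negative crossing. -/
def Oriented (s : D.State) (c : Fin D.n) : Prop := s c = false ↔ D.sign c = 1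

variable {D}

/-- The arc following a given directed arc when one travels along the smoothed diagram. -/
def next (s : D.State) : D.Dart → D.Dart
  | (a, true) =>
    if h : (a : ℕ) < 2 * D.n then
      let p : Fin (2 * D.n) := ⟨a, h⟩
      if D.Oriented s (D.word p).1 then ((D.other p).succ, true) else ((D.other p).castSucc, false)
    else (0, true)
  | (a, false) =>
    if h : a = 0 then (Fin.last _, false)
    else
      let p : Fin (2 * D.n) := a.pred h
      if D.Oriented s (D.word p).1 then ((D.other p).castSucc, false) else ((D.other p).succ, true)

/-- Reversal of the direction of travel. -/
def rev (x : D.Dart) : D.Dart := (x.1, !x.2)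

/-- The oriented cycles of a state. -/
def OrientedCycle (s : D.State) : Type := Quot fun x y : D.Dart => y = next s x

/-- The oriented cycle through a directed arc. -/
def ocyc (s : D.State) (x : D.Dart) : OrientedCycle s := Quot.mk _ x

/-- The (unoriented) cycles of a state. -/
def Cycle (s : D.State) : Type := Quot fun x y : D.Dart => y = next s x ∨ y = rev x

/-- The cycle through a directed arc. -/
def cyc (s : D.State) (x : D.Dart) : Cycle s := Quot.mk _ x

instance (s : D.State) : Finite (Cycle s) := Quot.finite _

instance (s : D.State) : Fintype (Cycle s) := Fintype.ofFinite _

theorem arcs_nonempty (s : D.State) (z : Cycle s) :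
    (Finset.univ.filter fun a : D.Arc => cyc s (a, true) = z).Nonempty := by
  induction z using Quot.ind with
  | mk x =>
    obtain ⟨a, b⟩ := x
    refine ⟨a, by
      rw [Finset.mem_filter]
      refine ⟨Finset.mem_univ _, ?_⟩
      cases b
      · exact Quot.sound (Or.inr rfl)
      · rfl⟩

/-- The first arc lying on a cycle.  The global order of the cycles of a state is the order of
their first arcs, and the marked point of a cycle lies on its first arc. -/
def root (s : D.State) (z : Cycle s) : D.Arc :=
  (Finset.univ.filter fun a : D.Arc => cyc s (a, true) = z).min' (arcs_nonempty s z)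

/-- The direction `x` agrees with the global orientation of the cycle through `x`, which is the
one that runs through the first arc of the cycle in the direction of the knot. -/
def Agrees (s : D.State) (x : D.Dart) : Prop := ocyc s x = ocyc s (root s (cyc s x), true)

/-! ### The local structure at a crossing -/

/-- The outgoing end of the crossing `c` that carries the label 1, directed by the local
(source-sink) orientation. -/
def site₁ (σ : SourceSink D.n) (c : Fin D.n) : D.Dart :=
  let p := D.word.symm (c, σ.source c)
  if σ.labelAfter c then (p.succ, true) else (p.castSucc, false)

/-- The outgoing end of the crossing `c` that carries the label 2, directed by the local
(source-sink) orientation. -/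
def site₂ (σ : SourceSink D.n) (c : Fin D.n) : D.Dart :=
  let p := D.word.symm (c, σ.source c)
  if σ.labelAfter c then (p.castSucc, false) else (p.succ, true)

/-- The position of a cycle in the local order at `c`: first the cycle through the label 1, then
the one through the label 2, then the others in the global order. -/
def localKey (σ : SourceSink D.n) (s : D.State) (c : Fin D.n) (z : Cycle s) : ℕ :=
  if z = cyc s (site₁ σ c) then 0
  else if z = cyc s (site₂ σ c) then 1
  else 2 + (root s z : ℕ)

/-- The sign of the permutation between the global order of the cycles of `s` and the local order
at `c`, computed as the parity of the number of inversions. -/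
def orderSign (σ : SourceSink D.n) (s : D.State) (c : Fin D.n) : ℚ :=
  (-1) ^ (Finset.univ.filter fun z : Cycle s × Cycle s =>
    root s z.1 < root s z.2 ∧ localKey σ s c z.2 < localKey σ s c z.1).card

/-! ### The Khovanov-Lee complex -/

/-- An enhanced state: a state with a label on each cycle; `false` is the label `1`, `true` is the
label `X`. -/
abbrev EnhancedState (D : GaussCode) : Type := Σ s : D.State, Cycle s → Bool

instance : Finite (EnhancedState D) := inferInstance

/-- The coefficient of the basis element `c` in the product `a * b` in `ℚ[X]/(X² - 1)`. -/
def mulCoeff : Bool → Bool → Bool → ℚ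
  | false, false, false => 1
  | false, true, true => 1
  | true, false, true => 1
  | true, true, false => 1
  | _, _, _ => 0

/-- The coefficient of `b ⊗ c` in `Δ(a)`, where `Δ(1) = 1 ⊗ X + X ⊗ 1` and
`Δ(X) = X ⊗ X + 1 ⊗ 1`. -/
def comulCoeff : Bool → Bool → Bool → ℚ
  | false, false, true => 1
  | false, true, false => 1
  | true, true, true => 1
  | true, false, false => 1
  | _, _, _ => 0

/-- The eigenvalue of the bar operation (`1 ↦ 1`, `X ↦ -X`) on the label of the cycle through
`x` if the local orientation `x` disagrees with the global orientation of that cycle, and `1` if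
the two agree. -/
def barSign (t : EnhancedState D) (x : D.Dart) : ℚ :=
  if t.2 (cyc t.1 x) = true ∧ ¬ Agrees t.1 x then -1 else 1

/-- The local part of the partial differential at `c`, as the coefficient of `t'` in the image
of `t`: multiplication if two cycles merge, comultiplication if a cycle splits, and zero for a
single cycle smoothing; with the bar operation before and after. -/
def localCoeff (σ : SourceSink D.n) (c : Fin D.n) (t t' : EnhancedState D) : ℚ :=
  let x := site₁ σ c
  let y := site₂ σ c
  if cyc t.1 x ≠ cyc t.1 y then
    barSign t x * barSign t y * barSign t' x *
      mulCoeff (t.2 (cyc t.1 x)) (t.2 (cyc t.1 y)) (t'.2 (cyc t'.1 x))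
  else if cyc t'.1 x ≠ cyc t'.1 y then
    barSign t x * barSign t' x * barSign t' y *
      comulCoeff (t.2 (cyc t.1 x)) (t'.2 (cyc t'.1 x)) (t'.2 (cyc t'.1 y))
  else 0

/-- `t'` arises from `t` by changing the smoothing at `c` from `A` to `B` and relabelling only
the cycles through `c`. -/
def Adjacent (σ : SourceSink D.n) (c : Fin D.n) (t t' : EnhancedState D) : Prop :=
  t.1 c = false ∧ t'.1 = Function.update t.1 c true ∧
    ∀ x : D.Dart, cyc t.1 x ≠ cyc t.1 (site₁ σ c) → cyc t.1 x ≠ cyc t.1 (site₂ σ c) →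
      t'.2 (cyc t'.1 x) = t.2 (cyc t.1 x)

/-- The coefficient of `t'` in the partial differential of `t` at the crossing `c`. -/
def partialCoeff (σ : SourceSink D.n) (c : Fin D.n) (t t' : EnhancedState D) : ℚ :=
  if Adjacent σ c t t' then orderSign σ t.1 c * orderSign σ t'.1 c * localCoeff σ c t t' else 0

/-- The chain group (the direct sum over all homological degrees): the rational vector space on
the enhanced states. -/
abbrev Chain (D : GaussCode) : Type := EnhancedState D →₀ ℚ

/-- The differential of the Khovanov-Lee complex. -/
def differential (D : GaussCode) (σ : SourceSink D.n) : Chain D →ₗ[ℚ] Chain D :=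
  Finsupp.linearCombination ℚ fun t : EnhancedState D =>
    Finsupp.equivFunOnFinite.symm fun t' : EnhancedState D => ∑ c, partialCoeff σ c t t'

/-- The quantum degree `q = i + λ + n₊ - 2 n₋` of an enhanced state, where `i` is the number of
`B`-smoothings and `λ` is the number of labels `1` minus the number of labels `X`. -/
def qDegree (t : EnhancedState D) : ℤ :=
  ((Finset.univ.filter fun c => t.1 c = true).card : ℤ)
    + ((Finset.univ.filter fun z => t.2 z = false).card : ℤ)
    - ((Finset.univ.filter fun z => t.2 z = true).card : ℤ)
    + (D.nPos : ℤ) - 2 * (D.nNeg : ℤ)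

/-- The quantum filtration of the complex: `filtration j` is spanned by the enhanced states of
quantum degree at least `j`. -/
def filtration (D : GaussCode) (j : ℤ) : Submodule ℚ (Chain D) :=
  Finsupp.supported ℚ ℚ {t : EnhancedState D | j ≤ qDegree t}

/-- Khovanov-Lee homology: cycles modulo boundaries. -/
abbrev Homology (D : GaussCode) (σ : SourceSink D.n) : Type :=
  LinearMap.ker (D.differential σ) ⧸
    (LinearMap.range (D.differential σ)).submoduleOf (LinearMap.ker (D.differential σ))

/-- The induced filtration on homology: the classes with a representative in `filtration j`. -/
def homologyFiltration (D : GaussCode) (σ : SourceSink D.n) (j : ℤ) : Submodule ℚ (D.Homology σ) :=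
  ((filtration D j).submoduleOf (LinearMap.ker (D.differential σ))).map (Submodule.mkQ _)

/-- The filtration levels of Khovanov-Lee homology: the degrees of its nonzero classes. -/
def levels (D : GaussCode) (σ : SourceSink D.n) : Set ℤ :=
  {j | ∃ x ∈ D.homologyFiltration σ j, x ∉ D.homologyFiltration σ (j + 1)}

/-- The highest filtration level. -/
def sMax (D : GaussCode) (σ : SourceSink D.n) : ℤ := sSup (D.levels σ)

/-- The lowest filtration level. -/
def sMin (D : GaussCode) (σ : SourceSink D.n) : ℤ := sInf (D.levels σ)

/-- The Rasmussen invariant. -/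
def rasmussen (D : GaussCode) (σ : SourceSink D.n) : ℚ := 1 / 2 * ((D.sMax σ : ℚ) + (D.sMin σ : ℚ))

end GaussCode

end

/-! Chains are treated as rational functions on enhanced states. For every dart `u`, the operator
`mulX u` multiplies by `X` on the cycle through `u`, with a sign if `u` runs against the global
orientation of that cycle. These operators commute, square to the identity, and commute with the
differential (`dmap_mulX`), so the complex splits into joint eigenspaces indexed by arc signs `g`.
An eigenfunction vanishes on states whose cycles `g` does not orient consistently (`Compat`), and on
a compatible state it is determined by its value at the labelling by `1`. Each eigenspace is
therefore a cube with a line at every compatible vertex, and the partial differentials become the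
scalars `crossCoeff`.

Along the knot, `g` either changes sign at both passages through a crossing or at neither (`Mono` or
not). The scalar at a crossing is nonzero exactly in the `Mono` case, and the faces of the cube
anticommute (`crossCoeff_anticomm`, from the sign count `Square.prodSign_eq`). This gives
`dmap_dmap`, and a contraction along any `Mono` crossing makes the eigenspace acyclic
(`IsEigen.exists_dmap_eq`). Without a `Mono` crossing `g` is constant, and only the oriented state
is compatible. The homology thus has the two canonical generators as a basis.

The differential raises the quantum degree by 0 or 4. The sum and the difference of the canonical
generators lie in the two residue classes modulo 4 that differ by 2, and multiplication by `X` at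
the base point exchanges them while lowering the filtration by at most 2. Their levels therefore
differ by exactly 2, and these are all the levels (`exists_levels_eq`).

For the mirror image, complementary smoothings with opposite crossing signs give the same curves.
Exchanging the labels as well negates the quantum degree (`qDegree_star`) and transposes the
differential up to signs. The bar operations leave a sign on each edge. It is a product of vertex
signs, given by `stateSign`, the sign of the permutation that assigns to each strand of the smoothed
diagram the arc by which it is left. Linear duality over ℚ then turns the lowest level of `K` into
minus the highest level of the mirror image (`mirror_exists_iff`). -/

namespace GaussCode

variable {D : GaussCode}

/-! ### Darts and travelling along a state -/

theorem word_other (p : Fin (2 * D.n)) :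
    D.word (D.other p) = ((D.word p).1, !(D.word p).2) := by
  simp [other]

theorem other_other (p : Fin (2 * D.n)) : D.other (D.other p) = p := by
  unfold other
  simp

theorem other_ne (p : Fin (2 * D.n)) : D.other p ≠ p := by
  intro h
  have := word_other p
  rw [h] at this
  have := congrArg Prod.snd this
  simp at this

theorem next_castSucc_true (s : D.State) (p : Fin (2 * D.n)) :
    next s (p.castSucc, true) = if D.Oriented s (D.word p).1 then ((D.other p).succ, true)
      else ((D.other p).castSucc, false) := by
  simp [next]

theorem next_succ_false (s : D.State) (p : Fin (2 * D.n)) :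
    next s (p.succ, false) = if D.Oriented s (D.word p).1 then ((D.other p).castSucc, false)
      else ((D.other p).succ, true) := by
  simp [next, Fin.succ_ne_zero]

theorem next_last_true (s : D.State) : next s (Fin.last (2 * D.n), true) = ((0 : D.Arc), true) := by
  simp [next]

theorem next_zero_false (s : D.State) : next s ((0 : D.Arc), false) = (Fin.last _, false) := by
  simp [next]

theorem dart_cases (x : D.Dart) :
    (∃ p, x = (Fin.castSucc p, true)) ∨ (∃ p, x = (Fin.succ p, false)) ∨
      x = (Fin.last (2 * D.n), true) ∨ x = ((0 : D.Arc), false) := by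
  obtain ⟨a, b⟩ := x
  cases b
  · rcases Fin.eq_zero_or_eq_succ a with rfl | ⟨p, rfl⟩
    · simp
    · simp
  · rcases Fin.eq_castSucc_or_eq_last a with ⟨p, rfl⟩ | rfl
    · exact Or.inl ⟨p, rfl⟩
    · simp

@[simp] theorem rev_rev (x : D.Dart) : rev (rev x) = x := by simp [rev]

theorem rev_ne (x : D.Dart) : rev x ≠ x := by
  intro h
  have := congrArg Prod.snd h
  simp [rev] at this

theorem rev_injective : Function.Injective (rev : D.Dart → D.Dart) :=
  Function.LeftInverse.injective rev_rev

/-- A smoothing joins the ends at a crossing in pairs, so walking backwards undoes a step: `rev`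
conjugates `next s` to its inverse. Injectivity of `next s` and the reversal of oriented cycles rest
on this. -/
theorem next_rev_next (s : D.State) (x : D.Dart) : next s (rev (next s x)) = rev x := by
  rcases dart_cases x with ⟨p, rfl⟩ | ⟨p, rfl⟩ | rfl | rfl
  · rw [next_castSucc_true]
    split_ifs with h
    · simp only [rev, Bool.not_true]
      rw [next_succ_false, word_other, if_pos h, other_other]
    · simp only [rev, Bool.not_true, Bool.not_false]
      rw [next_castSucc_true, word_other, if_neg h, other_other]
  · rw [next_succ_false]
    split_ifs with h
    · simp only [rev, Bool.not_false]
      rw [next_castSucc_true, word_other, if_pos h, other_other]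
    · simp only [rev, Bool.not_true, Bool.not_false]
      rw [next_succ_false, word_other, if_neg h, other_other]
  · rw [next_last_true]; exact next_zero_false s
  · rw [next_zero_false]; exact next_last_true s

theorem next_injective (s : D.State) : Function.Injective (next s) := by
  intro x y h
  have h1 := next_rev_next s x
  rw [h, next_rev_next] at h1
  exact (rev_injective h1).symm

theorem next_ne_rev (s : D.State) (x : D.Dart) : next s x ≠ rev x := by
  have key : ∀ p : Fin (2 * D.n), D.other p ≠ p := other_ne
  rcases dart_cases x with ⟨p, rfl⟩ | ⟨p, rfl⟩ | rfl | rfl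
  · rw [next_castSucc_true]
    split_ifs with h
    · simp [rev]
    · simpa [rev] using key p
  · rw [next_succ_false]
    split_ifs with h
    · simp [rev]
    · simpa [rev] using key p
  · rw [next_last_true]; simp [rev]
  · rw [next_zero_false]; simp [rev]

theorem next_eq_iff_rev {s : D.State} {x y : D.Dart} : next s x = y ↔ next s (rev y) = rev x := by
  constructor
  · rintro rfl; exact next_rev_next s x
  · intro h
    have := next_rev_next s (rev y)
    rw [h] at this
    simpa using this

/-! ### Oriented and unoriented cycles -/

theorem ocyc_next (s : D.State) (x : D.Dart) : ocyc s (next s x) = ocyc s x :=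
  (Quot.sound (r := fun x y : D.Dart => y = next s x) rfl).symm

theorem cyc_next (s : D.State) (x : D.Dart) : cyc s (next s x) = cyc s x :=
  (Quot.sound (r := fun x y : D.Dart => y = next s x ∨ y = rev x) (Or.inl rfl)).symm

theorem cyc_rev (s : D.State) (x : D.Dart) : cyc s (rev x) = cyc s x :=
  (Quot.sound (r := fun x y : D.Dart => y = next s x ∨ y = rev x) (Or.inr rfl)).symm

theorem eq_of_ocyc_eq {α : Sort*} {s : D.State} (f : D.Dart → α) (hf : ∀ x, f (next s x) = f x)
    {x y : D.Dart} (h : ocyc s x = ocyc s y) : f x = f y :=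
  congrArg (Quot.lift f (fun a b (hab : b = next s a) => by rw [hab, hf])) h

theorem eq_of_cyc_eq {α : Sort*} {s : D.State} (f : D.Dart → α) (hf : ∀ x, f (next s x) = f x)
    (hr : ∀ x, f (rev x) = f x) {x y : D.Dart} (h : cyc s x = cyc s y) : f x = f y :=
  congrArg (Quot.lift f (fun a b (hab : b = next s a ∨ b = rev a) => by
    rcases hab with rfl | rfl
    · rw [hf]
    · rw [hr])) h

theorem cyc_eq_of_ocyc_eq {s : D.State} {x y : D.Dart} (h : ocyc s x = ocyc s y) :
    cyc s x = cyc s y :=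
  eq_of_ocyc_eq (cyc s) (cyc_next s) h

theorem ocyc_rev_next (s : D.State) (x : D.Dart) : ocyc s (rev (next s x)) = ocyc s (rev x) := by
  rw [← ocyc_next s (rev (next s x)), next_rev_next]

theorem ocyc_rev_congr {s : D.State} {x y : D.Dart} (h : ocyc s x = ocyc s y) :
    ocyc s (rev x) = ocyc s (rev y) :=
  eq_of_ocyc_eq (fun x => ocyc s (rev x)) (ocyc_rev_next s) h

theorem ocyc_rev_comm {s : D.State} {x y : D.Dart} (h : ocyc s x = ocyc s (rev y)) :
    ocyc s (rev x) = ocyc s y := by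
  simpa using ocyc_rev_congr h

theorem cyc_eq_iff {s : D.State} {x y : D.Dart} :
    cyc s x = cyc s y ↔ ocyc s x = ocyc s y ∨ ocyc s x = ocyc s (rev y) := by
  constructor
  · intro h
    have := eq_of_cyc_eq (s := s) (fun u => ocyc s u = ocyc s y ∨ ocyc s u = ocyc s (rev y))
      (fun u => by simp only [ocyc_next]) (fun u => by
        apply propext
        constructor
        · rintro (h | h)
          · exact Or.inr (by simpa using ocyc_rev_congr h)
          · exact Or.inl (by simpa using ocyc_rev_congr h)
        · rintro (h | h)
          · exact Or.inr (ocyc_rev_congr h)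
          · exact Or.inl (by simpa using ocyc_rev_congr h)) h
    exact this.mpr (Or.inl rfl)
  · rintro (h | h)
    · exact cyc_eq_of_ocyc_eq h
    · rw [cyc_eq_of_ocyc_eq h, cyc_rev]

/-- Since `next s` is a permutation of a finite set, forward steps suffice: a predecessor is reached
by going once around. -/
theorem exists_iterate_of_ocyc_eq {s : D.State} {x y : D.Dart} (h : ocyc s x = ocyc s y) :
    ∃ k, (next s)^[k] x = y := by
  have key : ∀ u, (∃ k, (next s)^[k] x = next s u) ↔ ∃ k, (next s)^[k] x = u := by
    intro u
    constructor
    · rintro ⟨k, hk⟩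
      rcases k with _ | k
      · obtain ⟨m, hm, hmu⟩ := (Function.Injective.mem_periodicPts (next_injective s) u)
        obtain ⟨m, rfl⟩ := Nat.exists_eq_succ_of_ne_zero hm.ne'
        refine ⟨m, ?_⟩
        simp only [Function.iterate_zero, id_eq] at hk
        rw [hk, ← Function.iterate_succ_apply]
        exact hmu
      · rw [Function.iterate_succ_apply'] at hk
        exact ⟨k, next_injective s hk⟩
    · rintro ⟨k, hk⟩
      exact ⟨k + 1, by rw [Function.iterate_succ_apply', hk]⟩
  have := eq_of_ocyc_eq (s := s) (fun u => ∃ k, (next s)^[k] x = u) (fun u => propext (key u)) h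
  exact this.mp ⟨0, rfl⟩

theorem rev_iterate (s : D.State) (x : D.Dart) (k : ℕ) :
    (next s)^[k] (rev ((next s)^[k] x)) = rev x := by
  induction k generalizing x with
  | zero => rfl
  | succ k ih =>
    rw [Function.iterate_succ_apply' (next s) k x, Function.iterate_succ_apply, next_rev_next, ih]

/-- Look at the middle of a walk from `x` to `rev x`. If the length is even, a dart there equals its
own reverse; if it is odd, a dart is followed by its own reverse. Both are impossible, so every
cycle has two distinct orientations. -/
theorem ocyc_ne_rev (s : D.State) (x : D.Dart) : ocyc s x ≠ ocyc s (rev x) := by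
  intro h
  obtain ⟨k, hk⟩ := exists_iterate_of_ocyc_eq h
  rcases Nat.even_or_odd' k with ⟨m, rfl | rfl⟩
  · have h1 := rev_iterate s x m
    rw [two_mul, Function.iterate_add_apply, ← h1] at hk
    have := Function.Injective.iterate (next_injective s) m hk
    exact rev_ne _ this.symm
  · have h1 := rev_iterate s x m
    rw [two_mul, add_assoc, Function.iterate_add_apply, ← h1] at hk
    have := Function.Injective.iterate (next_injective s) m hk
    rw [add_comm, Function.iterate_add_apply] at this
    exact next_ne_rev s _ this

/-! ### Signs of darts -/

/-- The sign which a sign of the arcs (directed as the knot) induces on the darts. -/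
def dartSign (g : D.Arc → ℤˣ) (x : D.Dart) : ℤˣ := if x.2 then g x.1 else -g x.1

/-- The arc signs `g` are constant along the oriented cycles of `s`. -/
def Compat (g : D.Arc → ℤˣ) (s : D.State) : Prop :=
  ∀ x, dartSign g (next s x) = dartSign g x

@[simp] theorem dartSign_rev (g : D.Arc → ℤˣ) (x : D.Dart) :
    dartSign g (rev x) = -dartSign g x := by
  obtain ⟨a, b⟩ := x
  cases b <;> simp [dartSign, rev]

@[simp] theorem dartSign_true (g : D.Arc → ℤˣ) (a : D.Arc) : dartSign g (a, true) = g a := rfl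

theorem eq_of_arc_eq_of_dartSign_eq {g : D.Arc → ℤˣ} {x y : D.Dart} (h1 : x.1 = y.1)
    (h2 : dartSign g x = dartSign g y) : x = y := by
  obtain ⟨a, b⟩ := x
  obtain ⟨a', b'⟩ := y
  obtain rfl : a = a' := h1
  rcases Int.units_eq_one_or (g a) with h | h <;> cases b <;> cases b' <;>
    simp_all [dartSign]

/-- `1` if the dart agrees with the global orientation of its cycle, `-1` otherwise. -/
noncomputable def agr (s : D.State) (x : D.Dart) : ℤˣ := if Agrees s x then 1 else -1

theorem cyc_root (s : D.State) (z : Cycle s) : cyc s (root s z, true) = z := by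
  have := Finset.min'_mem _ (arcs_nonempty s z)
  exact (Finset.mem_filter.mp this).2

theorem root_le {s : D.State} {z : Cycle s} {a : D.Arc} (h : cyc s (a, true) = z) :
    root s z ≤ a := by
  apply Finset.min'_le
  rw [Finset.mem_filter]
  exact ⟨Finset.mem_univ _, h⟩

theorem root_injective (s : D.State) : Function.Injective (root s) := by
  intro z w h
  rw [← cyc_root s z, h, cyc_root]

theorem agr_eq_of_ocyc_eq {s : D.State} {x y : D.Dart} (h : ocyc s x = ocyc s y) :
    agr s x = agr s y := by
  unfold agr Agrees
  rw [h, cyc_eq_of_ocyc_eq h]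

theorem agrees_rev (s : D.State) (x : D.Dart) : Agrees s (rev x) ↔ ¬ Agrees s x := by
  unfold Agrees
  rw [cyc_rev]
  set r : D.Dart := (root s (cyc s x), true)
  have hr : cyc s x = cyc s r := (cyc_root s _).symm
  constructor
  · intro h1 h2
    exact ocyc_ne_rev s x (h2.trans h1.symm)
  · intro h
    exact ocyc_rev_comm ((cyc_eq_iff.mp hr).resolve_left h)

@[simp] theorem agr_rev (s : D.State) (x : D.Dart) : agr s (rev x) = -agr s x := by
  unfold agr
  by_cases h : Agrees s x
  · rw [if_pos h, if_neg (fun h' => (agrees_rev s x).mp h' h)]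
  · rw [if_neg h, if_pos ((agrees_rev s x).mpr h), neg_neg]

@[simp] theorem agr_next (s : D.State) (x : D.Dart) : agr s (next s x) = agr s x :=
  agr_eq_of_ocyc_eq (ocyc_next s x)

@[simp] theorem agr_root (s : D.State) (z : Cycle s) : agr s (root s z, true) = 1 := by
  unfold agr Agrees
  rw [cyc_root, if_pos rfl]

/-- The arc signs that describe the global orientation of the cycles. -/
noncomputable def rootSign (s : D.State) (a : D.Arc) : ℤˣ := agr s (a, true)

theorem dartSign_rootSign (s : D.State) (x : D.Dart) : dartSign (rootSign s) x = agr s x := by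
  obtain ⟨a, b⟩ := x
  cases b
  · have : ((a, false) : D.Dart) = rev (a, true) := rfl
    rw [this, agr_rev, dartSign_rev]; rfl
  · rfl

theorem compat_rootSign (s : D.State) : Compat (rootSign s) s := by
  intro x
  rw [dartSign_rootSign, dartSign_rootSign, agr_next]

theorem Compat.eq_of_ocyc_eq {g : D.Arc → ℤˣ} {s : D.State} (hg : Compat g s) {x y : D.Dart}
    (h : ocyc s x = ocyc s y) : dartSign g x = dartSign g y :=
  GaussCode.eq_of_ocyc_eq (dartSign g) hg h

/-- A compatible orientation differs from the global one by a single sign on each cycle. -/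
theorem Compat.mul_agr_eq {g : D.Arc → ℤˣ} {s : D.State} (hg : Compat g s) {x y : D.Dart}
    (h : cyc s x = cyc s y) : dartSign g x * agr s x = dartSign g y * agr s y :=
  eq_of_cyc_eq (fun x => dartSign g x * agr s x) (fun x => by rw [hg, agr_next])
    (fun x => by simp) h

theorem Compat.dartSign_eq {g : D.Arc → ℤˣ} {s : D.State} (hg : Compat g s) (x : D.Dart) :
    dartSign g x = agr s x * g (root s (cyc s x)) := by
  have := hg.mul_agr_eq (x := x) (y := (root s (cyc s x), true)) (cyc_root s _).symm
  rw [agr_root, mul_one, dartSign_true] at this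
  rw [← this, mul_comm (dartSign g x), ← mul_assoc, Int.units_mul_self, one_mul]

/-! ### Changing one smoothing -/

/-- The states `s` and `s'` differ at one crossing only, where `i, j` are joined to `x, y` in `s`
and to `y, x` in `s'`. -/
structure Switch (s s' : D.State) (x y i j : D.Dart) : Prop where
  next_i : next s i = x
  next_j : next s j = y
  next_i' : next s' i = y
  next_j' : next s' j = x
  off : ∀ u, u ≠ i → u ≠ j → u ≠ rev x → u ≠ rev y → next s' u = next s u
  x_ne_y : x ≠ y
  i_ne_j : i ≠ j
  i_ne_rev_x : i ≠ rev x
  i_ne_rev_y : i ≠ rev y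
  j_ne_rev_x : j ≠ rev x
  j_ne_rev_y : j ≠ rev y

namespace Switch

variable {s s' : D.State} {x y i j : D.Dart}

theorem symm (h : Switch s s' x y i j) : Switch s' s x y j i where
  next_i := h.next_j'
  next_j := h.next_i'
  next_i' := h.next_j
  next_j' := h.next_i
  off u h1 h2 h3 h4 := (h.off u h2 h1 h3 h4).symm
  x_ne_y := h.x_ne_y
  i_ne_j := h.i_ne_j.symm
  i_ne_rev_x := h.j_ne_rev_x
  i_ne_rev_y := h.j_ne_rev_y
  j_ne_rev_x := h.i_ne_rev_x
  j_ne_rev_y := h.i_ne_rev_y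

theorem swap (h : Switch s s' x y i j) : Switch s s' y x j i where
  next_i := h.next_j
  next_j := h.next_i
  next_i' := h.next_j'
  next_j' := h.next_i'
  off u h1 h2 h3 h4 := h.off u h2 h1 h4 h3
  x_ne_y := h.x_ne_y.symm
  i_ne_j := h.i_ne_j.symm
  i_ne_rev_x := h.j_ne_rev_y
  i_ne_rev_y := h.j_ne_rev_x
  j_ne_rev_x := h.i_ne_rev_y
  j_ne_rev_y := h.i_ne_rev_x

theorem next_rev_x (h : Switch s s' x y i j) : next s (rev x) = rev i :=
  next_eq_iff_rev.mp h.next_i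

theorem next_rev_y (h : Switch s s' x y i j) : next s (rev y) = rev j := h.swap.next_rev_x

theorem next_rev_x' (h : Switch s s' x y i j) : next s' (rev x) = rev j := h.symm.next_rev_x

theorem next_rev_y' (h : Switch s s' x y i j) : next s' (rev y) = rev i := h.swap.symm.next_rev_x

/-- The same crossing seen with the opposite source-sink orientation: the incoming ends, reversed,
become the outgoing ones. -/
theorem reverse (h : Switch s s' x y i j) : Switch s s' (rev i) (rev j) (rev x) (rev y) where
  next_i := h.next_rev_x
  next_j := h.next_rev_y
  next_i' := h.next_rev_x'
  next_j' := h.next_rev_y'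
  off u h1 h2 h3 h4 := h.off u (by simpa using h3) (by simpa using h4) h1 h2
  x_ne_y := fun h' => h.i_ne_j (rev_injective h')
  i_ne_j := fun h' => h.x_ne_y (rev_injective h')
  i_ne_rev_x := by simpa using h.i_ne_rev_x.symm
  i_ne_rev_y := by simpa using h.j_ne_rev_x.symm
  j_ne_rev_x := by simpa using h.i_ne_rev_y.symm
  j_ne_rev_y := by simpa using h.j_ne_rev_y.symm

end Switch

/-! ### Merging and splitting of cycles -/

theorem ocyc_of_next {s : D.State} {x y : D.Dart} (h : next s x = y) : ocyc s x = ocyc s y := by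
  rw [← h, ocyc_next]

/-- The dart `u` lies on a cycle through `x` or `y` in both states, and can be moved along the
cycles to one of `x`, `y` (in each state), with the same change of direction. -/
def Touch (s s' : D.State) (x y u : D.Dart) : Prop :=
  ∃ v v', (v = x ∨ v = y) ∧ (v' = x ∨ v' = y) ∧
    ((ocyc s u = ocyc s v ∧ ocyc s' u = ocyc s' v') ∨
      (ocyc s (rev u) = ocyc s v ∧ ocyc s' (rev u) = ocyc s' v'))

theorem touch_left (s s' : D.State) (x y : D.Dart) : Touch s s' x y x :=
  ⟨x, x, Or.inl rfl, Or.inl rfl, Or.inl ⟨rfl, rfl⟩⟩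

theorem touch_right (s s' : D.State) (x y : D.Dart) : Touch s s' x y y :=
  ⟨y, y, Or.inr rfl, Or.inr rfl, Or.inl ⟨rfl, rfl⟩⟩

theorem touch_rev {s s' : D.State} {x y u : D.Dart} :
    Touch s s' x y (rev u) ↔ Touch s s' x y u := by
  unfold Touch
  simp only [rev_rev]
  constructor <;> rintro ⟨v, v', h1, h2, h3⟩ <;> exact ⟨v, v', h1, h2, h3.symm⟩

theorem Touch.cyc_left {s s' : D.State} {x y u : D.Dart} (h : Touch s s' x y u) :
    cyc s u = cyc s x ∨ cyc s u = cyc s y := by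
  obtain ⟨v, v', h1, h2, h3⟩ := h
  have : cyc s u = cyc s v := by
    rcases h3 with h3 | h3
    · exact cyc_eq_of_ocyc_eq h3.1
    · rw [← cyc_rev]; exact cyc_eq_of_ocyc_eq h3.1
  rcases h1 with rfl | rfl
  · exact Or.inl this
  · exact Or.inr this

theorem Touch.symm {s s' : D.State} {x y u : D.Dart} (h : Touch s s' x y u) :
    Touch s' s x y u := by
  obtain ⟨v, v', h1, h2, h3⟩ := h
  exact ⟨v', v, h2, h1, h3.imp And.symm And.symm⟩

namespace Switch

variable {s s' : D.State} {x y i j : D.Dart}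

/-- The set of touching darts is stable under `next s` and `rev`: the four modified darts belong to
it, and elsewhere `next s` and `next s'` agree. As `Touch` is symmetric in the two states, the same
darts lie on cycles through the crossing before and after the move. -/
theorem touch_iff (h : Switch s s' x y i j) {u : D.Dart} :
    Touch s s' x y u ↔ cyc s u = cyc s x ∨ cyc s u = cyc s y := by
  refine ⟨Touch.cyc_left, fun hu => ?_⟩
  have ti : Touch s s' x y i :=
    ⟨x, y, Or.inl rfl, Or.inr rfl, Or.inl ⟨ocyc_of_next h.next_i, ocyc_of_next h.next_i'⟩⟩
  have tj : Touch s s' x y j :=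
    ⟨y, x, Or.inr rfl, Or.inl rfl, Or.inl ⟨ocyc_of_next h.next_j, ocyc_of_next h.next_j'⟩⟩
  have tx := touch_left s s' x y
  have ty := touch_right s s' x y
  have key : ∀ w, Touch s s' x y (next s w) = Touch s s' x y w := by
    intro w
    by_cases hi : w = i
    · subst hi; rw [h.next_i]; exact propext (iff_of_true tx ti)
    by_cases hj : w = j
    · subst hj; rw [h.next_j]; exact propext (iff_of_true ty tj)
    by_cases hx : w = rev x
    · subst hx; rw [h.next_rev_x]
      exact propext (iff_of_true (touch_rev.mpr ti) (touch_rev.mpr tx))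
    by_cases hy : w = rev y
    · subst hy; rw [h.next_rev_y]
      exact propext (iff_of_true (touch_rev.mpr tj) (touch_rev.mpr ty))
    have h1 : ocyc s' (next s w) = ocyc s' w := by rw [← h.off w hi hj hx hy, ocyc_next]
    have h2 : ocyc s' (rev (next s w)) = ocyc s' (rev w) := ocyc_rev_congr h1
    unfold Touch
    rw [h1, h2, ocyc_next, ocyc_rev_next]
  have hrev : ∀ w, Touch s s' x y (rev w) = Touch s s' x y w := fun w => propext touch_rev
  rcases hu with hu | hu
  · exact (eq_of_cyc_eq _ key hrev hu).mpr tx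
  · exact (eq_of_cyc_eq _ key hrev hu).mpr ty

theorem touch_iff' (h : Switch s s' x y i j) {u : D.Dart} :
    Touch s s' x y u ↔ cyc s' u = cyc s' x ∨ cyc s' u = cyc s' y := by
  rw [← h.symm.touch_iff]
  exact ⟨Touch.symm, Touch.symm⟩

theorem ocyc_of_not_touch (h : Switch s s' x y i j) {u v : D.Dart} (hu : ¬ Touch s s' x y u)
    (hv : ocyc s v = ocyc s u) : ocyc s' v = ocyc s' u := by
  have hu' : ∀ w, Touch s s' x y w → cyc s w ≠ cyc s u := by
    intro w hw h1
    apply hu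
    rw [h.touch_iff] at hw ⊢
    rwa [← h1]
  have key : ∀ w, (ocyc s (next s w) = ocyc s u → ocyc s' (next s w) = ocyc s' u) =
      (ocyc s w = ocyc s u → ocyc s' w = ocyc s' u) := by
    intro w
    rw [ocyc_next]
    by_cases hw : Touch s s' x y w
    · have : ocyc s w ≠ ocyc s u := fun h' => hu' w hw (cyc_eq_of_ocyc_eq h')
      simp [this]
    · have h1 : w ≠ i := by
        rintro rfl
        exact hw (h.touch_iff.mpr (Or.inl (cyc_eq_of_ocyc_eq (ocyc_of_next h.next_i))))
      have h2 : w ≠ j := by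
        rintro rfl
        exact hw (h.touch_iff.mpr (Or.inr (cyc_eq_of_ocyc_eq (ocyc_of_next h.next_j))))
      have h3 : w ≠ rev x := by
        rintro rfl
        exact hw (h.touch_iff.mpr (Or.inl (cyc_rev s x)))
      have h4 : w ≠ rev y := by
        rintro rfl
        exact hw (h.touch_iff.mpr (Or.inr (cyc_rev s y)))
      rw [← h.off w h1 h2 h3 h4, ocyc_next]
  have := eq_of_ocyc_eq (fun w => ocyc s w = ocyc s u → ocyc s' w = ocyc s' u) key hv
  exact this.mpr (fun _ => rfl) hv

theorem ocyc_iff_of_not_touch (h : Switch s s' x y i j) {u v : D.Dart}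
    (hu : ¬ Touch s s' x y u) : ocyc s' v = ocyc s' u ↔ ocyc s v = ocyc s u :=
  ⟨h.symm.ocyc_of_not_touch (fun h' => hu h'.symm), h.ocyc_of_not_touch hu⟩

theorem cyc_iff_of_not_touch (h : Switch s s' x y i j) {u v : D.Dart}
    (hu : ¬ Touch s s' x y u) : cyc s' v = cyc s' u ↔ cyc s v = cyc s u := by
  have hu' : ¬ Touch s s' x y (rev u) := fun h' => hu (touch_rev.mp h')
  rw [cyc_eq_iff, cyc_eq_iff, h.ocyc_iff_of_not_touch hu, h.ocyc_iff_of_not_touch hu']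

/-- The pairing between functions on the darts of two states. -/
theorem sum_mul_sub (h : Switch s s' x y i j) (f F : D.Dart → ℚ) :
    ∑ u, f u * (F (next s u) - F (next s' u)) =
      (f i - f j) * (F x - F y) + (f (rev x) - f (rev y)) * (F (rev i) - F (rev j)) := by
  have hsub : ∑ u ∈ ({i, j, rev x, rev y} : Finset D.Dart),
      f u * (F (next s u) - F (next s' u)) = ∑ u, f u * (F (next s u) - F (next s' u)) := by
    apply Finset.sum_subset (Finset.subset_univ _)
    intro u _ hu
    simp only [Finset.mem_insert, Finset.mem_singleton, not_or] at hu
    rw [h.off u hu.1 hu.2.1 hu.2.2.1 hu.2.2.2, sub_self, mul_zero]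
  rw [← hsub, Finset.sum_insert, Finset.sum_insert, Finset.sum_insert, Finset.sum_singleton,
    h.next_i, h.next_j, h.next_i', h.next_j', h.next_rev_x, h.next_rev_y, h.next_rev_x',
    h.next_rev_y']
  · ring
  · simpa using fun h' => h.x_ne_y (rev_injective h')
  · simp [h.j_ne_rev_x, h.j_ne_rev_y]
  · simp [h.i_ne_j, h.i_ne_rev_x, h.i_ne_rev_y]

/-- Pair the indicator `f` of the oriented cycle of `x` in `s` with the indicator `F` of the one in
`s'`. By invariance both parts of the sum in `sum_mul_sub` equal `∑ f * F`, so the sum is 0. The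
local formula gives `F x - F y`, hence `y` lies on the same oriented cycle of `s'` as `x`. -/
theorem ocyc_eq_of_cyc_ne (h : Switch s s' x y i j) (hs : cyc s x ≠ cyc s y) :
    ocyc s' x = ocyc s' y := by
  set f : D.Dart → ℚ := fun u => if ocyc s u = ocyc s x then 1 else 0 with hf
  set F : D.Dart → ℚ := fun u => if ocyc s' u = ocyc s' x then 1 else 0 with hF
  have h1 := h.sum_mul_sub f F
  have h2 : ∑ u, f u * (F (next s u) - F (next s' u)) = 0 := by
    have hb : Function.Bijective (next s) := Finite.injective_iff_bijective.mp (next_injective s)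
    have h3 : ∑ u, f u * F (next s u) = ∑ u, f u * F u := by
      rw [← hb.sum_comp (fun u => f u * F u)]
      refine Finset.sum_congr rfl fun u _ => ?_
      simp only [hf, ocyc_next]
    simp only [mul_sub, Finset.sum_sub_distrib, h3]
    rw [sub_eq_zero]
    refine Finset.sum_congr rfl fun u _ => ?_
    simp only [hF, ocyc_next]
  have fi : f i = 1 := by simp [hf, ocyc_of_next h.next_i]
  have fj : f j = 0 := by
    simp only [hf, ocyc_of_next h.next_j]
    exact if_neg fun h' => hs (cyc_eq_of_ocyc_eq h'.symm)
  have frx : f (rev x) = 0 := if_neg fun h' => ocyc_ne_rev s x h'.symm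
  have fry : f (rev y) = 0 := if_neg fun h' => hs (by
    rw [← cyc_eq_of_ocyc_eq h', cyc_rev])
  rw [h2, fi, fj, frx, fry] at h1
  by_contra hne
  have Fx : F x = 1 := if_pos rfl
  have Fy : F y = 0 := if_neg (fun h' => hne h'.symm)
  rw [Fx, Fy] at h1
  norm_num at h1

theorem compat (h : Switch s s' x y i j) {g : D.Arc → ℤˣ} (hg : Compat g s)
    (hxy : dartSign g x = dartSign g y) : Compat g s' := by
  have hi : dartSign g i = dartSign g x := by rw [← h.next_i, hg]
  have hj : dartSign g j = dartSign g y := by rw [← h.next_j, hg]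
  intro u
  by_cases h1 : u = i
  · rw [h1, h.next_i', hi, hxy]
  by_cases h2 : u = j
  · rw [h2, h.next_j', hj, hxy]
  by_cases h3 : u = rev x
  · rw [h3, h.next_rev_x', dartSign_rev, dartSign_rev, hj, hxy]
  by_cases h4 : u = rev y
  · rw [h4, h.next_rev_y', dartSign_rev, dartSign_rev, hi, hxy]
  rw [h.off u h1 h2 h3 h4, hg]

/-- Walk from `x` in `s` up to the first visit to `i` or `j`. The dart `y` has not occurred, since
it comes right after `j`. Stopping at `i` would close the walk in `s` without meeting `y`; so the
walk stops at `j`, where it closes in `s'` without meeting `y`. -/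
theorem cyc_ne_of_ocyc_eq (h : Switch s s' x y i j) (hs : ocyc s x = ocyc s y) :
    cyc s' x ≠ cyc s' y := by
  have hg := compat_rootSign s
  set g := rootSign s
  have hxy : dartSign g x = dartSign g y := hg.eq_of_ocyc_eq hs
  have hg' := h.compat hg hxy
  intro hc
  rcases cyc_eq_iff.mp hc with hc | hc
  swap
  · have h1 := hg'.eq_of_ocyc_eq hc
    rw [dartSign_rev, hxy] at h1
    rcases Int.units_eq_one_or (dartSign g y) with h2 | h2 <;> rw [h2] at h1 <;>
      exact absurd h1 (by decide)
  have hex : ∃ k, (next s)^[k] x = i ∨ (next s)^[k] x = j := by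
    obtain ⟨k, hk⟩ := exists_iterate_of_ocyc_eq (hs.trans (ocyc_of_next h.next_j).symm)
    exact ⟨k, Or.inr hk⟩
  set m := Nat.find hex with hm
  have hlt : ∀ t < m, (next s)^[t] x ≠ i ∧ (next s)^[t] x ≠ j := by
    intro t ht
    have := Nat.find_min hex ht
    push Not at this
    exact this
  have hsgn : ∀ t, dartSign g ((next s)^[t] x) = dartSign g x := by
    intro t
    induction t with
    | zero => rfl
    | succ t ih => rw [Function.iterate_succ_apply', hg, ih]
  -- The sign `g` is constant on the walk and opposite at `rev x` and `rev y`, so the walk avoids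
  -- these two modified darts as well.
  have hstep : ∀ t < m, next s' ((next s)^[t] x) = (next s)^[t + 1] x := by
    intro t ht
    have hneg : ∀ e : ℤˣ, e ≠ -e := by decide
    rw [Function.iterate_succ_apply', h.off _ (hlt t ht).1 (hlt t ht).2]
    · intro h'
      have := hsgn t
      rw [h', dartSign_rev] at this
      exact hneg _ this.symm
    · intro h'
      have := hsgn t
      rw [h', dartSign_rev, hxy] at this
      exact hneg _ this.symm
  have hy : ∀ t ≤ m, (next s)^[t] x ≠ y := by
    intro t ht h'
    rcases t with _ | t
    · exact h.x_ne_y h'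
    · rw [Function.iterate_succ_apply', ← h.next_j] at h'
      exact (hlt t ht).2 (next_injective s h')
  have fin : ∀ w : D.State, (∀ t < m, next w ((next s)^[t] x) = (next s)^[t + 1] x) →
      next w ((next s)^[m] x) = x → ocyc w x = ocyc w y → False := by
    intro w h1 h2 h3
    obtain ⟨k, hk⟩ := exists_iterate_of_ocyc_eq h3
    have : ∀ k, ∃ t ≤ m, (next w)^[k] x = (next s)^[t] x := by
      intro k
      induction k with
      | zero => exact ⟨0, Nat.zero_le _, rfl⟩
      | succ k ih =>
        obtain ⟨t, ht, htk⟩ := ih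
        rw [Function.iterate_succ_apply', htk]
        rcases ht.lt_or_eq with ht | rfl
        · exact ⟨t + 1, ht, h1 t ht⟩
        · exact ⟨0, Nat.zero_le _, h2⟩
    obtain ⟨t, ht, htk⟩ := this k
    exact hy t ht (htk.symm.trans hk)
  rcases Nat.find_spec hex with hi | hj
  · exact fin s (fun t _ => (Function.iterate_succ_apply' _ _ _).symm)
      (by rw [hm, hi, h.next_i]) hs
  · exact fin s' hstep (by rw [hm, hj, h.next_j']) hc

theorem not_cyc_ne (h : Switch s s' x y i j) (hs : cyc s x ≠ cyc s y) : cyc s' x = cyc s' y :=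
  cyc_eq_of_ocyc_eq (h.ocyc_eq_of_cyc_ne hs)

/-- Equal signs at `x` and `y` exclude that the cycle runs through them in opposite directions. A
single cycle smoothing thus never occurs at such a crossing. -/
theorem cyc_ne_of_dartSign (h : Switch s s' x y i j) {g : D.Arc → ℤˣ} (hg : Compat g s)
    (hxy : dartSign g x = dartSign g y) (hs : cyc s x = cyc s y) : cyc s' x ≠ cyc s' y := by
  refine h.cyc_ne_of_ocyc_eq ((cyc_eq_iff.mp hs).resolve_right fun h' => ?_)
  have h1 := hg.eq_of_ocyc_eq h'
  rw [dartSign_rev, hxy] at h1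
  exact absurd h1 ((by decide : ∀ e : ℤˣ, e ≠ -e) _)

theorem agr_eq_of_not_touch (h : Switch s s' x y i j) {u : D.Dart} (hu : ¬ Touch s s' x y u) :
    root s' (cyc s' u) = root s (cyc s u) ∧ agr s' u = agr s u := by
  have hr : root s' (cyc s' u) = root s (cyc s u) := by
    apply le_antisymm
    · apply root_le
      rw [h.cyc_iff_of_not_touch hu]
      exact cyc_root s _
    · apply root_le
      rw [← h.cyc_iff_of_not_touch hu]
      exact cyc_root s' _
  refine ⟨hr, ?_⟩
  unfold agr Agrees
  rw [hr]
  have : ocyc s' u = ocyc s' (root s (cyc s u), true) ↔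
      ocyc s u = ocyc s (root s (cyc s u), true) := by
    rw [eq_comm, h.ocyc_iff_of_not_touch hu, eq_comm]
  simp only [this]

end Switch

/-! ### Roots of cycles -/

/-- The first arc on the cycle through a dart. -/
noncomputable def rt (s : D.State) (u : D.Dart) : D.Arc := root s (cyc s u)

theorem rt_eq_iff {s : D.State} {u v : D.Dart} : rt s u = rt s v ↔ cyc s u = cyc s v :=
  (root_injective s).eq_iff

theorem cyc_rt (s : D.State) (u : D.Dart) : cyc s (rt s u, true) = cyc s u := cyc_root s _

@[simp] theorem rt_rt (s : D.State) (u : D.Dart) : rt s (rt s u, true) = rt s u :=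
  rt_eq_iff.mpr (cyc_rt s u)

theorem rt_le {s : D.State} {u : D.Dart} {a : D.Arc} (h : cyc s (a, true) = cyc s u) :
    rt s u ≤ a := root_le h

/-- The first arcs of the cycles of a state. -/
noncomputable def Roots (s : D.State) : Finset D.Arc := Finset.univ.filter fun a => rt s (a, true) = a

theorem mem_Roots {s : D.State} {a : D.Arc} : a ∈ Roots s ↔ rt s (a, true) = a := by
  simp [Roots]

theorem rt_mem_Roots (s : D.State) (u : D.Dart) : rt s u ∈ Roots s := mem_Roots.mpr (rt_rt s u)

theorem root_mem_Roots (s : D.State) (z : Cycle s) : root s z ∈ Roots s := by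
  rw [mem_Roots, rt, cyc_root]

theorem sum_cycle_eq_sum_Roots {M : Type*} [AddCommMonoid M] (s : D.State) (f : Cycle s → M) :
    ∑ z, f z = ∑ a ∈ Roots s, f (cyc s (a, true)) := by
  refine Finset.sum_bij (fun z _ => root s z) (fun z _ => root_mem_Roots s z)
    (fun z _ w _ h => root_injective s h) (fun a ha => ⟨cyc s (a, true), Finset.mem_univ _,
      mem_Roots.mp ha⟩) (fun z _ => by rw [cyc_root])

namespace Switch

variable {s s' : D.State} {x y i j : D.Dart}

theorem rt_of_touch (h : Switch s s' x y i j) (hs : cyc s x ≠ cyc s y) {u : D.Dart}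
    (hu : Touch s s' x y u) : rt s' u = min (rt s x) (rt s y) := by
  have hm := h.not_cyc_ne hs
  have hux : ∀ u, Touch s s' x y u → cyc s' u = cyc s' x := by
    intro u hu
    rcases h.touch_iff'.mp hu with h' | h'
    · exact h'
    · rw [h', hm]
  apply le_antisymm
  · apply rt_le
    rw [hux u hu]
    apply hux
    rw [h.touch_iff]
    rcases min_choice (rt s x) (rt s y) with h' | h' <;> rw [h', cyc_rt]
    · exact Or.inl rfl
    · exact Or.inr rfl
  · have h1 : Touch s s' x y (rt s' u, true) := by
      rw [h.touch_iff', cyc_rt, ← h.touch_iff']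
      exact hu
    rcases h.touch_iff.mp h1 with h' | h'
    · exact (min_le_left _ _).trans (rt_le h')
    · exact (min_le_right _ _).trans (rt_le h')

theorem rt_of_not_touch (h : Switch s s' x y i j) {u : D.Dart}
    (hu : ¬ Touch s s' x y u) : rt s' u = rt s u := (h.agr_eq_of_not_touch hu).1

theorem rt_eq (h : Switch s s' x y i j) (hs : cyc s x ≠ cyc s y) (u : D.Dart) :
    rt s' u = if rt s u = rt s x ∨ rt s u = rt s y then min (rt s x) (rt s y) else rt s u := by
  split_ifs with hu
  · rw [rt_eq_iff, rt_eq_iff, ← h.touch_iff] at hu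
    exact h.rt_of_touch hs hu
  · rw [rt_eq_iff, rt_eq_iff, ← h.touch_iff] at hu
    exact h.rt_of_not_touch hu

/-- The merged cycle keeps the smaller of the two first arcs. For the sign computations a state is
therefore a subset of the ordered set of arcs, and a merge removes one element from it. -/
theorem Roots_eq (h : Switch s s' x y i j) (hs : cyc s x ≠ cyc s y) :
    Roots s' = (Roots s).erase (max (rt s x) (rt s y)) := by
  have hne : rt s x ≠ rt s y := fun h' => hs (rt_eq_iff.mp h')
  ext a
  rw [Finset.mem_erase, mem_Roots, mem_Roots, h.rt_eq hs]
  have hx := rt_rt s x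
  have hy := rt_rt s y
  rcases lt_or_gt_of_ne hne with hlt | hlt
  · rw [min_eq_left hlt.le, max_eq_right hlt.le]
    split_ifs with hu
    · constructor
      · rintro rfl; exact ⟨hlt.ne, hx⟩
      · rintro ⟨h1, h2⟩
        rw [h2] at hu
        exact (hu.resolve_right h1).symm
    · refine ⟨fun h' => ⟨?_, h'⟩, fun h' => h'.2⟩
      rintro rfl
      exact hu (Or.inr h')
  · rw [min_eq_right hlt.le, max_eq_left hlt.le]
    split_ifs with hu
    · constructor
      · rintro rfl; exact ⟨hlt.ne, hy⟩
      · rintro ⟨h1, h2⟩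
        rw [h2] at hu
        exact (hu.resolve_left h1).symm
    · refine ⟨fun h' => ⟨?_, h'⟩, fun h' => h'.2⟩
      rintro rfl
      exact hu (Or.inl h')

end Switch

/-! ### Order signs -/

/-- `localKey` for two arbitrary darts in place of the ends labelled 1 and 2. -/
noncomputable def dartKey (x y : D.Dart) (s : D.State) (z : Cycle s) : ℕ :=
  if z = cyc s x then 0 else if z = cyc s y then 1 else 2 + (root s z : ℕ)

/-- `orderSign` for two arbitrary darts in place of the ends labelled 1 and 2. -/
noncomputable def dartOrderSign (x y : D.Dart) (s : D.State) : ℚ :=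
  (-1) ^ (Finset.univ.filter fun z : Cycle s × Cycle s =>
    root s z.1 < root s z.2 ∧ dartKey x y s z.2 < dartKey x y s z.1).card

/-- The number of cycles whose first arc precedes the arc `a`. -/
noncomputable def rootsBelow (s : D.State) (a : D.Arc) : ℕ := ((Roots s).filter fun r => r < a).card

theorem card_root_lt (s : D.State) (a : D.Arc) :
    (Finset.univ.filter fun z : Cycle s => root s z < a).card = rootsBelow s a := by
  unfold rootsBelow
  refine Finset.card_bij (fun z _ => root s z) ?_ (fun z _ w _ h => root_injective s h) ?_
  · intro z hz
    simp only [Finset.mem_filter, Finset.mem_univ, true_and] at hz ⊢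
    exact ⟨root_mem_Roots s z, hz⟩
  · intro a ha
    simp only [Finset.mem_filter] at ha
    exact ⟨cyc s (a, true), by simpa [rt, mem_Roots.mp ha.1] using
      (show rt s (a, true) < _ by rw [mem_Roots.mp ha.1]; exact ha.2), mem_Roots.mp ha.1⟩

theorem dartKey_lt_iff (x y : D.Dart) (s : D.State) (z w : Cycle s) (h : root s z < root s w) :
    dartKey x y s w < dartKey x y s z ↔
      w = cyc s x ∨ (w = cyc s y ∧ z ≠ cyc s x) := by
  have hzw : z ≠ w := fun h' => by rw [h'] at h; exact lt_irrefl _ h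
  unfold dartKey
  have h' : (root s z : ℕ) < root s w := h
  by_cases h1 : w = cyc s x
  · have h2 : z ≠ cyc s x := fun h3 => hzw (h3.trans h1.symm)
    simp only [if_neg h2, h1, true_or, iff_true]
    split_ifs <;> omega
  · by_cases h2 : w = cyc s y
    · have h3 : z ≠ cyc s y := fun h3 => hzw (h3.trans h2.symm)
      rw [if_neg h1, if_pos h2, if_neg h3]
      by_cases h4 : z = cyc s x
      · simp only [if_pos h4]
        simp [h1, h4]
      · simp only [if_neg h4]
        simp only [h4, h2, ne_eq, not_false_eq_true, and_self, or_true, iff_true]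
        omega
    · rw [if_neg h1, if_neg h2]
      simp only [h1, h2, false_and, or_self, iff_false, not_lt]
      split_ifs <;> omega

/-- The only inversions come from moving one cycle to the front, past the cycles with earlier first
arcs. -/
theorem dartOrderSign_of_eq {x y : D.Dart} {s : D.State} (h : cyc s x = cyc s y) :
    dartOrderSign x y s = (-1) ^ rootsBelow s (rt s x) := by
  unfold dartOrderSign
  congr 1
  rw [← card_root_lt]
  have : (Finset.univ.filter fun z : Cycle s × Cycle s =>
      root s z.1 < root s z.2 ∧ dartKey x y s z.2 < dartKey x y s z.1) =
      (Finset.univ.filter fun z : Cycle s => root s z < rt s x) ×ˢ {cyc s x} := by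
    ext ⟨z, w⟩
    simp only [Finset.mem_filter, Finset.mem_univ, true_and, Finset.mem_product,
      Finset.mem_singleton]
    constructor
    · rintro ⟨h1, h2⟩
      rw [dartKey_lt_iff x y s z w h1, ← h] at h2
      have hw : w = cyc s x := h2.elim id And.left
      subst hw
      exact ⟨h1, rfl⟩
    · rintro ⟨h1, rfl⟩
      exact ⟨h1, (dartKey_lt_iff x y s z _ h1).mpr (Or.inl rfl)⟩
  rw [this, Finset.card_product, Finset.card_singleton, mul_one]

/-- Two cycles move to the front. The extra sign corrects for the cycle of `x`, which the cycle of
`y` does not have to pass even if it precedes it in the global order. -/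
theorem dartOrderSign_of_ne {x y : D.Dart} {s : D.State} (h : cyc s x ≠ cyc s y) :
    dartOrderSign x y s = (if rt s x < rt s y then -1 else 1) *
      ((-1) ^ rootsBelow s (rt s x) * (-1) ^ rootsBelow s (rt s y)) := by
  unfold dartOrderSign
  have : (Finset.univ.filter fun z : Cycle s × Cycle s =>
      root s z.1 < root s z.2 ∧ dartKey x y s z.2 < dartKey x y s z.1) =
      (Finset.univ.filter fun z : Cycle s => root s z < rt s x) ×ˢ {cyc s x} ∪
      ((Finset.univ.filter fun z : Cycle s => root s z < rt s y).erase (cyc s x)) ×ˢ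
        {cyc s y} := by
    ext ⟨z, w⟩
    simp only [Finset.mem_filter, Finset.mem_univ, true_and, Finset.mem_product,
      Finset.mem_singleton, Finset.mem_union, Finset.mem_erase]
    constructor
    · rintro ⟨h1, h2⟩
      rw [dartKey_lt_iff x y s z w h1] at h2
      rcases h2 with rfl | ⟨rfl, h2⟩
      · exact Or.inl ⟨h1, rfl⟩
      · exact Or.inr ⟨⟨h2, h1⟩, rfl⟩
    · rintro (⟨h1, rfl⟩ | ⟨⟨h2, h1⟩, rfl⟩)
      · exact ⟨h1, (dartKey_lt_iff x y s z _ h1).mpr (Or.inl rfl)⟩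
      · exact ⟨h1, (dartKey_lt_iff x y s z _ h1).mpr (Or.inr ⟨rfl, h2⟩)⟩
  rw [this, Finset.card_union_of_disjoint, Finset.card_product, Finset.card_product,
    Finset.card_singleton, Finset.card_singleton, mul_one, mul_one, card_root_lt, pow_add]
  · have hmem : cyc s x ∈ (Finset.univ.filter fun z : Cycle s => root s z < rt s y) ↔
        rt s x < rt s y := by
      rw [Finset.mem_filter]
      exact and_iff_right (Finset.mem_univ _)
    by_cases hlt : rt s x < rt s y
    · have h1 := Finset.card_erase_add_one (hmem.mpr hlt)
      rw [card_root_lt] at h1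
      rw [if_pos hlt, ← h1, pow_succ]
      ring
    · rw [if_neg hlt, Finset.erase_eq_of_notMem (fun h' => hlt (hmem.mp h')), card_root_lt]
      ring
  · rw [Finset.disjoint_left]
    rintro ⟨z, w⟩ h1 h2
    simp only [Finset.mem_product, Finset.mem_singleton] at h1 h2
    exact h (h1.2.symm.trans h2.2)

theorem dartOrderSign_congr {x y x' y' : D.Dart} {s : D.State} (hx : cyc s x = cyc s x')
    (hy : cyc s y = cyc s y') : dartOrderSign x y s = dartOrderSign x' y' s := by
  unfold dartOrderSign dartKey
  rw [hx, hy]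

theorem dartOrderSign_swap_of_eq {x y : D.Dart} {s : D.State} (h : cyc s x = cyc s y) :
    dartOrderSign y x s = dartOrderSign x y s :=
  dartOrderSign_congr h.symm h

theorem dartOrderSign_swap_of_ne {x y : D.Dart} {s : D.State} (h : cyc s x ≠ cyc s y) :
    dartOrderSign y x s = -dartOrderSign x y s := by
  rw [dartOrderSign_of_ne h, dartOrderSign_of_ne h.symm]
  have hne : rt s x ≠ rt s y := fun h' => h (rt_eq_iff.mp h')
  rcases lt_or_gt_of_ne hne with hlt | hlt
  · rw [if_pos hlt, if_neg hlt.not_gt]; ring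
  · rw [if_pos hlt, if_neg hlt.not_gt]; ring

theorem neg_one_pow_mul_self (k : ℕ) : ((-1 : ℚ) ^ k) * (-1) ^ k = 1 := by
  rw [← pow_add, ← two_mul, pow_mul]; norm_num

theorem dartOrderSign_mul_self (x y : D.Dart) (s : D.State) :
    dartOrderSign x y s * dartOrderSign x y s = 1 :=
  neg_one_pow_mul_self _

theorem dartOrderSign_ne_zero (x y : D.Dart) (s : D.State) : dartOrderSign x y s ≠ 0 := by
  unfold dartOrderSign
  positivity

/-- The sign of an edge of the cube of states. -/
noncomputable def edgeSign (x y : D.Dart) (s s' : D.State) : ℚ :=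
  dartOrderSign x y s * dartOrderSign x y s'

theorem edgeSign_comm (x y : D.Dart) (s s' : D.State) :
    edgeSign x y s s' = edgeSign x y s' s := mul_comm _ _

/-- The value of `x - y` on the indicator function of the cycle whose first arc is the later one of
the first arcs of the cycles through `x` and `y`. -/
noncomputable def lateSign (x y : D.Dart) (s : D.State) : ℚ := if rt s x < rt s y then -1 else 1

namespace Switch

variable {s s' : D.State} {x y i j : D.Dart}

theorem rootsBelow_eq (h : Switch s s' x y i j) (hs : cyc s x ≠ cyc s y) (a : D.Arc) :
    (-1 : ℚ) ^ rootsBelow s' a =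
      (if max (rt s x) (rt s y) < a then -1 else 1) * (-1) ^ rootsBelow s a := by
  unfold rootsBelow
  rw [h.Roots_eq hs, Finset.filter_erase]
  have hmax : max (rt s x) (rt s y) ∈ Roots s := by
    rcases max_choice (rt s x) (rt s y) with h' | h' <;> rw [h'] <;> exact rt_mem_Roots s _
  split_ifs with hlt
  · have hmem : max (rt s x) (rt s y) ∈ (Roots s).filter fun r => r < a :=
      Finset.mem_filter.mpr ⟨hmax, hlt⟩
    rw [← Finset.card_erase_add_one hmem, pow_succ]
    ring
  · rw [Finset.erase_eq_of_notMem, one_mul]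
    exact fun h' => hlt (Finset.mem_filter.mp h').2

/-- The smaller first arc survives the merge and contributes the same sign at both ends of the edge.
What remains is the coefficient of a contraction in an exterior algebra: the position of the removed
arc and the value of `x - y` on it. -/
theorem edgeSign_eq (h : Switch s s' x y i j) (hs : cyc s x ≠ cyc s y) :
    edgeSign x y s s' =
      lateSign x y s * (-1) ^ rootsBelow s (max (rt s x) (rt s y)) := by
  unfold edgeSign lateSign
  rw [dartOrderSign_of_ne hs, dartOrderSign_of_eq (h.not_cyc_ne hs),
    h.rt_of_touch hs (touch_left s s' x y), h.rootsBelow_eq hs,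
    if_neg (min_le_max).not_gt, one_mul]
  have hx := neg_one_pow_mul_self (rootsBelow s (rt s x))
  have hy := neg_one_pow_mul_self (rootsBelow s (rt s y))
  rcases le_total (rt s x) (rt s y) with hle | hle
  · rw [min_eq_left hle, max_eq_right hle]
    linear_combination (if rt s x < rt s y then (-1 : ℚ) else 1) *
      (-1) ^ rootsBelow s (rt s y) * hx
  · rw [min_eq_right hle, max_eq_left hle]
    linear_combination (if rt s x < rt s y then (-1 : ℚ) else 1) *
      (-1) ^ rootsBelow s (rt s x) * hy

theorem card_Roots (h : Switch s s' x y i j) (hs : cyc s x ≠ cyc s y) :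
    (Roots s').card + 1 = (Roots s).card := by
  rw [h.Roots_eq hs, Finset.card_erase_add_one]
  rcases max_choice (rt s x) (rt s y) with h' | h' <;> rw [h'] <;> exact rt_mem_Roots s _

end Switch

/-! ### Faces of the cube of states -/

/-- This is the anticommutation of two merges. Here `a < b` and `c < d` are the first arcs at the
two crossings and `ε` is the parity of a position. If `b ≠ d`, removing the smaller of them shifts
the larger by one place. If `b = d`, neither second removal is shifted, but the two second merges
carry opposite late signs. -/
theorem order_face {α : Type*} [LinearOrder α] (ε : α → ℚ) (hε : ∀ a, ε a * ε a = 1)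
    {a b c d : α} (hab : a < b) (hcd : c < d)
    (hne : (if c = a ∨ c = b then a else c) ≠ (if d = a ∨ d = b then a else d)) :
    (-1 * ε b) *
    ((if (if c = a ∨ c = b then a else c) < (if d = a ∨ d = b then a else d) then -1 else 1) *
      ((if b < max (if c = a ∨ c = b then a else c) (if d = a ∨ d = b then a else d)
        then -1 else 1) *
        ε (max (if c = a ∨ c = b then a else c) (if d = a ∨ d = b then a else d)))) *
    ((-1 * ε d) *
    ((if (if a = c ∨ a = d then c else a) < (if b = c ∨ b = d then c else b) then -1 else 1) *
      ((if d < max (if a = c ∨ a = d then c else a) (if b = c ∨ b = d then c else b)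
        then -1 else 1) *
        ε (max (if a = c ∨ a = d then c else a) (if b = c ∨ b = d then c else b))))) = -1 := by
  have ha := hε a
  have hb := hε b
  have hc := hε c
  have hd := hε d
  rcases lt_trichotomy b d with hbd | rfl | hbd
  · have h1 : a < d := hab.trans hbd
    have h2 : c ≠ d := hcd.ne
    have e1 : (if d = a ∨ d = b then a else d) = d := by simp [h1.ne', hbd.ne']
    have e2 : (if c = a ∨ c = b then a else c) < d := by split_ifs <;> assumption
    rw [e1, if_pos e2, max_eq_right e2.le, if_pos hbd]
    by_cases hbc : b = c
    · subst hbc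
      have e4 : (if a = b ∨ a = d then b else a) = a := by simp [hab.ne, h1.ne]
      simp only [true_or, if_true, e4, max_eq_right hab.le, if_pos hab, if_neg hcd.not_gt]
      linear_combination -hb * ε d ^ 2 - hd
    · have e4 : (if b = c ∨ b = d then c else b) = b := by simp [hbc, hbd.ne]
      have e3 : (if a = c ∨ a = d then c else a) < b := by
        simp only [h1.ne, or_false]
        split_ifs with h <;> [exact h ▸ hab; exact hab]
      rw [e4, if_pos e3, max_eq_right e3.le, if_neg hbd.not_gt]
      linear_combination -hb * ε d ^ 2 - hd
  · simp only [or_true, if_true] at hne ⊢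
    have hca : c ≠ a := by
      rintro rfl
      simp at hne
    simp only [hca, hca.symm, hcd.ne, hab.ne, or_self, if_false]
    rcases lt_or_gt_of_ne hca with h | h
    · rw [if_pos h, max_eq_right h.le, if_neg hab.not_gt, if_neg h.not_gt, max_eq_left h.le,
        if_neg hab.not_gt]
      linear_combination -hb * ε a ^ 2 - ha
    · rw [if_neg h.not_gt, max_eq_left h.le, if_neg hcd.not_gt, if_pos h, max_eq_right h.le,
        if_neg hcd.not_gt]
      linear_combination -hb * ε c ^ 2 - hc
  · have h1 : c < b := hcd.trans hbd
    have e1 : (if b = c ∨ b = d then c else b) = b := by simp [h1.ne', hbd.ne']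
    have e2 : (if a = c ∨ a = d then c else a) < b := by split_ifs <;> assumption
    rw [e1, if_pos e2, max_eq_right e2.le, if_pos hbd]
    by_cases hda : d = a
    · subst hda
      simp only [true_or, if_true, hcd.ne, h1.ne, or_self, if_false, max_eq_right hcd.le,
        if_neg hab.not_gt, if_pos hcd]
      linear_combination -hb * ε d ^ 2 - hd
    · have e4 : (if d = a ∨ d = b then a else d) = d := by simp [hda, hbd.ne]
      have e3 : (if c = a ∨ c = b then a else c) < d := by
        simp only [h1.ne, or_false]
        split_ifs with h <;> [exact h ▸ hcd; exact hcd]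
      rw [e4, if_pos e3, max_eq_right e3.le, if_neg hbd.not_gt]
      linear_combination -hb * ε d ^ 2 - hd

/-- Four states that differ in the smoothings of two crossings only. -/
structure Square (s₀ s₁ s₂ s₃ : D.State) (x y i j x' y' i' j' : D.Dart) : Prop where
  left : Switch s₀ s₁ x y i j
  right : Switch s₂ s₃ x y i j
  bot : Switch s₀ s₂ x' y' i' j'
  top : Switch s₁ s₃ x' y' i' j'

theorem rt_next (s : D.State) (u : D.Dart) : rt s (next s u) = rt s u := by
  rw [rt, cyc_next, rt]

theorem Switch.edgeSign_swap {s s' : D.State} {x y i j : D.Dart} (h : Switch s s' x y i j)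
    (hs : cyc s x ≠ cyc s y) : edgeSign y x s s' = -edgeSign x y s s' := by
  unfold edgeSign
  rw [dartOrderSign_swap_of_ne hs, dartOrderSign_swap_of_eq (h.not_cyc_ne hs)]
  ring

namespace Square

variable {s₀ s₁ s₂ s₃ : D.State} {x y i j x' y' i' j' : D.Dart}

/-- The product of the signs of the four edges of a square. -/
noncomputable def prodSign (s₀ s₁ s₂ s₃ : D.State) (x y x' y' : D.Dart) : ℚ :=
  edgeSign x y s₀ s₁ * edgeSign x' y' s₁ s₃ * (edgeSign x' y' s₀ s₂ * edgeSign x y s₂ s₃)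

theorem flip_left (q : Square s₀ s₁ s₂ s₃ x y i j x' y' i' j') :
    Square s₁ s₀ s₃ s₂ x y j i x' y' i' j' :=
  ⟨q.left.symm, q.right.symm, q.top, q.bot⟩

theorem flip_bot (q : Square s₀ s₁ s₂ s₃ x y i j x' y' i' j') :
    Square s₂ s₃ s₀ s₁ x y i j x' y' j' i' :=
  ⟨q.right, q.left, q.bot.symm, q.top.symm⟩

theorem trans (q : Square s₀ s₁ s₂ s₃ x y i j x' y' i' j') :
    Square s₀ s₂ s₁ s₃ x' y' i' j' x y i j :=
  ⟨q.bot, q.top, q.left, q.right⟩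

theorem swap_left (q : Square s₀ s₁ s₂ s₃ x y i j x' y' i' j') :
    Square s₀ s₁ s₂ s₃ y x j i x' y' i' j' :=
  ⟨q.left.swap, q.right.swap, q.bot, q.top⟩

theorem swap_bot (q : Square s₀ s₁ s₂ s₃ x y i j x' y' i' j') :
    Square s₀ s₁ s₂ s₃ x y i j y' x' j' i' :=
  ⟨q.left, q.right, q.bot.swap, q.top.swap⟩

theorem prodSign_of_lt (q : Square s₀ s₁ s₂ s₃ x y i j x' y' i' j')
    (h1 : rt s₀ x < rt s₀ y) (h2 : rt s₀ x' < rt s₀ y') (h3 : cyc s₁ x' ≠ cyc s₁ y')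
    (h4 : cyc s₂ x ≠ cyc s₂ y) : prodSign s₀ s₁ s₂ s₃ x y x' y' = -1 := by
  have hl : cyc s₀ x ≠ cyc s₀ y := fun h => h1.ne (rt_eq_iff.mpr h)
  have hb : cyc s₀ x' ≠ cyc s₀ y' := fun h => h2.ne (rt_eq_iff.mpr h)
  have h3' : rt s₁ x' ≠ rt s₁ y' := fun h => h3 (rt_eq_iff.mp h)
  unfold prodSign
  rw [q.left.edgeSign_eq hl, q.bot.edgeSign_eq hb, q.top.edgeSign_eq h3, q.right.edgeSign_eq h4,
    q.left.rootsBelow_eq hl, q.bot.rootsBelow_eq hb]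
  unfold lateSign
  rw [q.left.rt_eq hl x', q.left.rt_eq hl y'] at h3' ⊢
  rw [q.bot.rt_eq hb x, q.bot.rt_eq hb y]
  simp only [if_pos h1, if_pos h2, min_eq_left h1.le, min_eq_left h2.le, max_eq_right h1.le,
    max_eq_right h2.le] at h3' ⊢
  exact order_face (fun a => (-1 : ℚ) ^ rootsBelow s₀ a) (fun a => neg_one_pow_mul_self _) h1 h2 h3'

theorem prodSign_swap_left (q : Square s₀ s₁ s₂ s₃ x y i j x' y' i' j')
    (hl : cyc s₀ x ≠ cyc s₀ y) (hr : cyc s₂ x ≠ cyc s₂ y) :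
    prodSign s₀ s₁ s₂ s₃ y x x' y' = prodSign s₀ s₁ s₂ s₃ x y x' y' := by
  unfold prodSign
  rw [q.left.edgeSign_swap hl, q.right.edgeSign_swap hr]
  ring

theorem prodSign_trans (s₀ s₁ s₂ s₃ : D.State) (x y x' y' : D.Dart) :
    prodSign s₀ s₂ s₁ s₃ x' y' x y = prodSign s₀ s₁ s₂ s₃ x y x' y' := by
  unfold prodSign; ring

theorem prodSign_flip_left (s₀ s₁ s₂ s₃ : D.State) (x y x' y' : D.Dart) :
    prodSign s₁ s₀ s₃ s₂ x y x' y' = prodSign s₀ s₁ s₂ s₃ x y x' y' := by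
  unfold prodSign
  rw [edgeSign_comm x y s₁ s₀, edgeSign_comm x y s₃ s₂]
  ring

theorem prodSign_of_ne (q : Square s₀ s₁ s₂ s₃ x y i j x' y' i' j')
    (hl : cyc s₀ x ≠ cyc s₀ y) (hb : cyc s₀ x' ≠ cyc s₀ y') (h3 : cyc s₁ x' ≠ cyc s₁ y')
    (h4 : cyc s₂ x ≠ cyc s₂ y) : prodSign s₀ s₁ s₂ s₃ x y x' y' = -1 := by
  have hl' : rt s₀ x ≠ rt s₀ y := fun h => hl (rt_eq_iff.mp h)
  have hb' : rt s₀ x' ≠ rt s₀ y' := fun h => hb (rt_eq_iff.mp h)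
  rcases lt_or_gt_of_ne hl' with h1 | h1 <;> rcases lt_or_gt_of_ne hb' with h2 | h2
  · exact q.prodSign_of_lt h1 h2 h3 h4
  · rw [← prodSign_trans, ← q.trans.prodSign_swap_left hb h3, prodSign_trans]
    exact q.swap_bot.prodSign_of_lt h1 h2 h3.symm h4
  · rw [← q.prodSign_swap_left hl h4]
    exact q.swap_left.prodSign_of_lt h1 h2 h3 h4.symm
  · rw [← q.prodSign_swap_left hl h4, ← prodSign_trans,
      ← q.swap_left.trans.prodSign_swap_left hb h3, prodSign_trans]
    exact q.swap_left.swap_bot.prodSign_of_lt h1 h2 h3.symm h4.symm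

/-- Telescope `sum_mul_sub` along `s₀`, `s₁`, `s₃`. The total vanishes because `f` is invariant in
`s₀` and `F` in `s₃`; the vanishing of `f` at the reversed ends removes the other halves of the two
local terms. -/
theorem pairing (q : Square s₀ s₁ s₂ s₃ x y i j x' y' i' j') (f F : D.Dart → ℚ)
    (hf : ∀ u, f (next s₀ u) = f u) (hF : ∀ u, F (next s₃ u) = F u)
    (fx : f (rev x) = 0) (fy : f (rev y) = 0) (fx' : f (rev x') = 0) (fy' : f (rev y') = 0) :
    (f x - f y) * (F x - F y) + (f x' - f y') * (F x' - F y') = 0 := by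
  have h1 := q.left.sum_mul_sub f F
  have h2 := q.top.sum_mul_sub f F
  have h3 : ∑ u, f u * (F (next s₀ u) - F (next s₃ u)) = 0 := by
    have hb : Function.Bijective (next s₀) :=
      Finite.injective_iff_bijective.mp (next_injective s₀)
    have h3 : ∑ u, f u * F (next s₀ u) = ∑ u, f u * F u := by
      rw [← hb.sum_comp (fun u => f u * F u)]
      exact Finset.sum_congr rfl fun u _ => by rw [hf]
    simp only [mul_sub, Finset.sum_sub_distrib, h3, hF, sub_self]
  have fi : f i = f x := by rw [← q.left.next_i, hf]
  have fj : f j = f y := by rw [← q.left.next_j, hf]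
  have fi' : f i' = f x' := by rw [← q.bot.next_i, hf]
  have fj' : f j' = f y' := by rw [← q.bot.next_j, hf]
  rw [fx, fy, fi, fj] at h1
  rw [fx', fy', fi', fj'] at h2
  have h4 : ∑ u, f u * (F (next s₀ u) - F (next s₃ u)) =
      ∑ u, f u * (F (next s₀ u) - F (next s₁ u)) + ∑ u, f u * (F (next s₁ u) - F (next s₃ u)) := by
    rw [← Finset.sum_add_distrib]
    exact Finset.sum_congr rfl fun u _ => by ring
  rw [h3, h1, h2] at h4
  linarith

theorem indicator_sub {s : D.State} {g : D.Arc → ℤˣ} {u v : D.Dart} (hu : dartSign g u = 1)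
    (hv : dartSign g v = 1) (h : cyc s u ≠ cyc s v) :
    (if rt s u = max (rt s u) (rt s v) ∧ dartSign g u = 1 then (1 : ℚ) else 0) -
      (if rt s v = max (rt s u) (rt s v) ∧ dartSign g v = 1 then (1 : ℚ) else 0) =
      lateSign u v s := by
  have hne : rt s u ≠ rt s v := fun h' => h (rt_eq_iff.mp h')
  unfold lateSign
  rcases lt_or_gt_of_ne hne with hlt | hlt
  · simp [max_eq_right hlt.le, hlt, hlt.ne, hv]
  · simp [max_eq_left hlt.le, hlt.not_gt, hlt.ne, hu]

theorem lateSign_mul_self (u v : D.Dart) (s : D.State) : lateSign u v s * lateSign u v s = 1 := by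
  unfold lateSign
  split_ifs <;> norm_num

/-- Both paths merge and then split. Both crossings join the same two cycles of `s₀`, and likewise
of `s₃`, so the position signs cancel. The late signs are compared by `pairing` the later cycle in
`s₀` with the later cycle in `s₃`. -/
theorem prodSign_of_eq (q : Square s₀ s₁ s₂ s₃ x y i j x' y' i' j')
    (hl : cyc s₀ x ≠ cyc s₀ y) (hb : cyc s₀ x' ≠ cyc s₀ y') (h3 : cyc s₃ x' ≠ cyc s₃ y')
    (h4 : cyc s₃ x ≠ cyc s₃ y) {g : D.Arc → ℤˣ} (hg₀ : Compat g s₀) (hg₃ : Compat g s₃)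
    (hx : dartSign g x = 1) (hy : dartSign g y = 1) (hx' : dartSign g x' = 1)
    (hy' : dartSign g y' = 1) : prodSign s₀ s₁ s₂ s₃ x y x' y' = -1 := by
  have e1 : cyc s₁ x' = cyc s₁ y' := q.top.symm.not_cyc_ne h3
  have hl' : rt s₀ x ≠ rt s₀ y := fun h => hl (rt_eq_iff.mp h)
  have hb' : rt s₀ x' ≠ rt s₀ y' := fun h => hb (rt_eq_iff.mp h)
  have hmax : max (rt s₀ x) (rt s₀ y) = max (rt s₀ x') (rt s₀ y') := by
    rw [← rt_eq_iff, q.left.rt_eq hl, q.left.rt_eq hl] at e1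
    have key : (rt s₀ x' = rt s₀ x ∧ rt s₀ y' = rt s₀ y) ∨
        (rt s₀ x' = rt s₀ y ∧ rt s₀ y' = rt s₀ x) := by
      have hm := min_choice (rt s₀ x) (rt s₀ y)
      generalize min (rt s₀ x) (rt s₀ y) = m at *
      grind
    rcases key with ⟨k1, k2⟩ | ⟨k1, k2⟩
    · rw [k1, k2]
    · rw [k1, k2, max_comm]
  have hR : Roots s₁ = Roots s₂ := by
    rw [q.left.Roots_eq hl, q.bot.Roots_eq hb, hmax]
  have hmem : ∀ u v : D.Dart, max (rt s₃ u) (rt s₃ v) ∈ Roots s₃ := by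
    intro u v
    rcases max_choice (rt s₃ u) (rt s₃ v) with h | h <;> rw [h] <;> exact rt_mem_Roots _ _
  have hmax' : max (rt s₃ x) (rt s₃ y) = max (rt s₃ x') (rt s₃ y') := by
    rw [q.top.symm.Roots_eq h3, q.right.symm.Roots_eq h4] at hR
    by_contra hne
    have : max (rt s₃ x) (rt s₃ y) ∈ (Roots s₃).erase (max (rt s₃ x') (rt s₃ y')) :=
      Finset.mem_erase.mpr ⟨hne, hmem x y⟩
    rw [hR] at this
    exact (Finset.mem_erase.mp this).1 rfl
  have hp := q.pairing
    (fun u => if rt s₀ u = max (rt s₀ x) (rt s₀ y) ∧ dartSign g u = 1 then 1 else 0)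
    (fun u => if rt s₃ u = max (rt s₃ x) (rt s₃ y) ∧ dartSign g u = 1 then 1 else 0)
    (fun u => by simp only [rt_next, hg₀ u]) (fun u => by simp only [rt_next, hg₃ u])
    (by simp [hx]) (by simp [hy]) (by simp [hx']) (by simp [hy'])
  rw [indicator_sub hx hy hl, indicator_sub hx hy h4, hmax, hmax', indicator_sub hx' hy' hb,
    indicator_sub hx' hy' h3] at hp
  unfold prodSign
  rw [q.left.edgeSign_eq hl, q.bot.edgeSign_eq hb, edgeSign_comm x' y' s₁ s₃,
    q.top.symm.edgeSign_eq h3, edgeSign_comm x y s₂ s₃, q.right.symm.edgeSign_eq h4, hmax, hmax']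
  have n1 := neg_one_pow_mul_self (rootsBelow s₀ (max (rt s₀ x') (rt s₀ y')))
  have n2 := neg_one_pow_mul_self (rootsBelow s₃ (max (rt s₃ x') (rt s₃ y')))
  have l1 := lateSign_mul_self x' y' s₀
  have l2 := lateSign_mul_self x' y' s₃
  generalize (-1 : ℚ) ^ rootsBelow s₀ (max (rt s₀ x') (rt s₀ y')) = e at *
  generalize (-1 : ℚ) ^ rootsBelow s₃ (max (rt s₃ x') (rt s₃ y')) = e' at *
  have hp' : lateSign x y s₀ * lateSign x y s₃ = -(lateSign x' y' s₀ * lateSign x' y' s₃) := by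
    linarith
  calc _ = (lateSign x y s₀ * lateSign x y s₃) * (lateSign x' y' s₀ * lateSign x' y' s₃) *
        (e * e) * (e' * e') := by ring
    _ = -((lateSign x' y' s₀ * lateSign x' y' s₀) * (lateSign x' y' s₃ * lateSign x' y' s₃)) := by
        rw [hp', n1, n2]; ring
    _ = -1 := by rw [l1, l2]; norm_num

/-- With both moves out of `s₀` merging, the second moves behave alike: they split exactly if both
crossings join the same pair of cycles, and merge otherwise. -/
theorem prodSign_of_max (q : Square s₀ s₁ s₂ s₃ x y i j x' y' i' j')
    (hl : cyc s₀ x ≠ cyc s₀ y) (hb : cyc s₀ x' ≠ cyc s₀ y') {g : D.Arc → ℤˣ} (hg₀ : Compat g s₀)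
    (hx : dartSign g x = 1) (hy : dartSign g y = 1) (hx' : dartSign g x' = 1)
    (hy' : dartSign g y' = 1) : prodSign s₀ s₁ s₂ s₃ x y x' y' = -1 := by
  have hg₁ := q.left.compat hg₀ (hx.trans hy.symm)
  have hg₂ := q.bot.compat hg₀ (hx'.trans hy'.symm)
  have hg₃ := q.top.compat hg₁ (hx'.trans hy'.symm)
  have hiff : cyc s₁ x' = cyc s₁ y' ↔ cyc s₂ x = cyc s₂ y := by
    have hl' : rt s₀ x ≠ rt s₀ y := fun h => hl (rt_eq_iff.mp h)
    have hb' : rt s₀ x' ≠ rt s₀ y' := fun h => hb (rt_eq_iff.mp h)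
    rw [← rt_eq_iff, ← rt_eq_iff, q.left.rt_eq hl, q.left.rt_eq hl, q.bot.rt_eq hb,
      q.bot.rt_eq hb]
    have hm := min_choice (rt s₀ x) (rt s₀ y)
    have hm' := min_choice (rt s₀ x') (rt s₀ y')
    generalize min (rt s₀ x) (rt s₀ y) = m at *
    generalize min (rt s₀ x') (rt s₀ y') = m' at *
    grind
  by_cases h : cyc s₁ x' = cyc s₁ y'
  · exact q.prodSign_of_eq hl hb (q.top.cyc_ne_of_dartSign hg₁ (hx'.trans hy'.symm) h)
      (q.right.cyc_ne_of_dartSign hg₂ (hx.trans hy.symm) (hiff.mp h)) hg₀ hg₃ hx hy hx' hy'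
  · exact q.prodSign_of_ne hl hb h (fun h' => h (hiff.mpr h'))

/-- Some corner of the face is one from which both moves merge, and the symmetries of the square
bring it to `s₀`. The remaining patterns are excluded by counting the cycles along the two paths. -/
theorem prodSign_eq (q : Square s₀ s₁ s₂ s₃ x y i j x' y' i' j') {g : D.Arc → ℤˣ}
    (hg₀ : Compat g s₀) (hx : dartSign g x = 1) (hy : dartSign g y = 1)
    (hx' : dartSign g x' = 1) (hy' : dartSign g y' = 1) :
    prodSign s₀ s₁ s₂ s₃ x y x' y' = -1 := by
  have hg₁ := q.left.compat hg₀ (hx.trans hy.symm)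
  have hg₂ := q.bot.compat hg₀ (hx'.trans hy'.symm)
  have hg₃ := q.top.compat hg₁ (hx'.trans hy'.symm)
  have f2 : prodSign s₂ s₃ s₀ s₁ x y x' y' = prodSign s₀ s₁ s₂ s₃ x y x' y' := by
    rw [← prodSign_trans, prodSign_flip_left, prodSign_trans]
  by_cases hl : cyc s₀ x = cyc s₀ y <;> by_cases hb : cyc s₀ x' = cyc s₀ y'
  · have hl1 := q.left.cyc_ne_of_dartSign hg₀ (hx.trans hy.symm) hl
    have hb1 := q.bot.cyc_ne_of_dartSign hg₀ (hx'.trans hy'.symm) hb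
    by_cases ht : cyc s₁ x' = cyc s₁ y'
    · have ht1 := q.top.cyc_ne_of_dartSign hg₁ (hx'.trans hy'.symm) ht
      by_cases hr : cyc s₂ x = cyc s₂ y
      · have hr1 := q.right.cyc_ne_of_dartSign hg₂ (hx.trans hy.symm) hr
        rw [← prodSign_flip_left, ← prodSign_trans, ← prodSign_flip_left, prodSign_trans]
        exact q.flip_left.flip_bot.prodSign_of_max hr1 ht1 hg₃ hx hy hx' hy'
      · rw [← f2]
        exact q.flip_bot.prodSign_of_max hr hb1 hg₂ hx hy hx' hy'
    · rw [← prodSign_flip_left]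
      exact q.flip_left.prodSign_of_max hl1 ht hg₁ hx hy hx' hy'
  · have hl1 := q.left.cyc_ne_of_dartSign hg₀ (hx.trans hy.symm) hl
    by_cases ht : cyc s₁ x' = cyc s₁ y'
    · have ht1 := q.top.cyc_ne_of_dartSign hg₁ (hx'.trans hy'.symm) ht
      by_cases hr : cyc s₂ x = cyc s₂ y
      · have hr1 := q.right.cyc_ne_of_dartSign hg₂ (hx.trans hy.symm) hr
        rw [← prodSign_flip_left, ← prodSign_trans, ← prodSign_flip_left, prodSign_trans]
        exact q.flip_left.flip_bot.prodSign_of_max hr1 ht1 hg₃ hx hy hx' hy'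
      · exfalso
        have c1 := q.left.symm.card_Roots hl1
        have c2 := q.bot.card_Roots hb
        have c3 := q.top.symm.card_Roots ht1
        have c4 := q.right.card_Roots hr
        omega
    · rw [← prodSign_flip_left]
      exact q.flip_left.prodSign_of_max hl1 ht hg₁ hx hy hx' hy'
  · have hb1 := q.bot.cyc_ne_of_dartSign hg₀ (hx'.trans hy'.symm) hb
    by_cases hr : cyc s₂ x = cyc s₂ y
    · have hr1 := q.right.cyc_ne_of_dartSign hg₂ (hx.trans hy.symm) hr
      by_cases ht : cyc s₁ x' = cyc s₁ y'
      · have ht1 := q.top.cyc_ne_of_dartSign hg₁ (hx'.trans hy'.symm) ht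
        rw [← prodSign_flip_left, ← prodSign_trans, ← prodSign_flip_left, prodSign_trans]
        exact q.flip_left.flip_bot.prodSign_of_max hr1 ht1 hg₃ hx hy hx' hy'
      · exfalso
        have c1 := q.left.card_Roots hl
        have c2 := q.bot.symm.card_Roots hb1
        have c3 := q.top.card_Roots ht
        have c4 := q.right.symm.card_Roots hr1
        omega
    · rw [← f2]
      exact q.flip_bot.prodSign_of_max hr hb1 hg₂ hx hy hx' hy'
  · exact q.prodSign_of_max hl hb hg₀ hx hy hx' hy'

end Square

/-! ### Partial differentials for arbitrary darts in place of the labelled ends -/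

/-- The sign of the bar operation on a label. -/
def barUnit (b : Bool) (e : ℤˣ) : ℚ := if b = true ∧ e = -1 then -1 else 1

theorem barSign_eq (t : EnhancedState D) (x : D.Dart) :
    barSign t x = barUnit (t.2 (cyc t.1 x)) (agr t.1 x) := by
  unfold barSign barUnit agr
  by_cases h : Agrees t.1 x
  · simp [h]
  · simp [h]

/-- `localCoeff` for two arbitrary darts. -/
noncomputable def dartLocalCoeff (x y : D.Dart) (t t' : EnhancedState D) : ℚ :=
  if cyc t.1 x ≠ cyc t.1 y then
    barSign t x * barSign t y * barSign t' x *
      mulCoeff (t.2 (cyc t.1 x)) (t.2 (cyc t.1 y)) (t'.2 (cyc t'.1 x))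
  else if cyc t'.1 x ≠ cyc t'.1 y then
    barSign t x * barSign t' x * barSign t' y *
      comulCoeff (t.2 (cyc t.1 x)) (t'.2 (cyc t'.1 x)) (t'.2 (cyc t'.1 y))
  else 0

/-- `Adjacent` for two arbitrary darts. -/
def DartAdjacent (x y : D.Dart) (c : Fin D.n) (t t' : EnhancedState D) : Prop :=
  t.1 c = false ∧ t'.1 = Function.update t.1 c true ∧
    ∀ u : D.Dart, cyc t.1 u ≠ cyc t.1 x → cyc t.1 u ≠ cyc t.1 y →
      t'.2 (cyc t'.1 u) = t.2 (cyc t.1 u)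

/-- `partialCoeff` for two arbitrary darts. -/
noncomputable def dartPartial (x y : D.Dart) (c : Fin D.n) (t t' : EnhancedState D) : ℚ :=
  if DartAdjacent x y c t t' then edgeSign x y t.1 t'.1 * dartLocalCoeff x y t t' else 0

theorem partialCoeff_eq (σ : SourceSink D.n) (c : Fin D.n) (t t' : EnhancedState D) :
    partialCoeff σ c t t' = dartPartial (site₁ σ c) (site₂ σ c) c t t' := rfl

theorem barUnit_neg_mul_mul (a b c : Bool) (α β γ : ℤˣ) :
    barUnit a (-α) * barUnit b (-β) * barUnit c (-γ) * mulCoeff a b c =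
      barUnit a α * barUnit b β * barUnit c γ * mulCoeff a b c := by
  rcases Int.units_eq_one_or α with rfl | rfl <;> rcases Int.units_eq_one_or β with rfl | rfl <;>
  rcases Int.units_eq_one_or γ with rfl | rfl <;> cases a <;> cases b <;> cases c <;>
  simp [barUnit, mulCoeff]

theorem barUnit_neg_mul_comul (a b c : Bool) (α β γ : ℤˣ) :
    barUnit a (-α) * barUnit b (-β) * barUnit c (-γ) * comulCoeff a b c =
      -(barUnit a α * barUnit b β * barUnit c γ * comulCoeff a b c) := by
  rcases Int.units_eq_one_or α with rfl | rfl <;> rcases Int.units_eq_one_or β with rfl | rfl <;>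
  rcases Int.units_eq_one_or γ with rfl | rfl <;> cases a <;> cases b <;> cases c <;>
  simp [barUnit, comulCoeff]

theorem mulCoeff_comm (a b c : Bool) : mulCoeff a b c = mulCoeff b a c := by
  cases a <;> cases b <;> cases c <;> rfl

theorem comulCoeff_comm (a b c : Bool) : comulCoeff a b c = comulCoeff a c b := by
  cases a <;> cases b <;> cases c <;> rfl

theorem unit_mul_barUnit_not (a : Bool) (α : ℤˣ) :
    ((α : ℤ) : ℚ) * barUnit (!a) α = barUnit a α := by
  rcases Int.units_eq_one_or α with rfl | rfl <;> cases a <;> simp [barUnit]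

theorem barSign_congr {t : EnhancedState D} {x y : D.Dart} (h : ocyc t.1 x = ocyc t.1 y) :
    barSign t x = barSign t y := by
  rw [barSign_eq, barSign_eq, cyc_eq_of_ocyc_eq h, agr_eq_of_ocyc_eq h]

theorem dartAdjacent_congr {x y x' y' : D.Dart} {c : Fin D.n} {t t' : EnhancedState D}
    (hx : cyc t.1 x = cyc t.1 x') (hy : cyc t.1 y = cyc t.1 y') :
    DartAdjacent x y c t t' ↔ DartAdjacent x' y' c t t' := by
  unfold DartAdjacent
  rw [hx, hy]

theorem dartAdjacent_swap {x y : D.Dart} {c : Fin D.n} {t t' : EnhancedState D} :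
    DartAdjacent x y c t t' ↔ DartAdjacent y x c t t' := by
  unfold DartAdjacent
  constructor <;> rintro ⟨h1, h2, h3⟩ <;> exact ⟨h1, h2, fun u hx hy => h3 u hy hx⟩

/-- In a merge or a split the two ends lie on different cycles in exactly one of the two states, so
exchanging the labels 1 and 2 changes exactly one order sign. -/
theorem Switch.dartPartial_swap {t t' : EnhancedState D} {x y i j : D.Dart}
    (h : Switch t.1 t'.1 x y i j) (c : Fin D.n) :
    dartPartial y x c t t' = -dartPartial x y c t t' := by
  unfold dartPartial
  rw [dartAdjacent_swap]
  by_cases hA : DartAdjacent x y c t t'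
  swap
  · rw [if_neg hA, if_neg hA, neg_zero]
  rw [if_pos hA, if_pos hA]
  unfold dartLocalCoeff
  by_cases hs : cyc t.1 x = cyc t.1 y
  · rw [if_neg (not_not.mpr hs), if_neg (not_not.mpr hs.symm)]
    by_cases hs' : cyc t'.1 x = cyc t'.1 y
    · rw [if_neg (not_not.mpr hs'), if_neg (not_not.mpr hs'.symm)]
      simp
    · rw [if_pos hs', if_pos (Ne.symm hs'), edgeSign_comm, h.symm.edgeSign_swap hs',
        edgeSign_comm, barSign_congr (h.symm.ocyc_eq_of_cyc_ne hs'), comulCoeff_comm, hs]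
      ring
  · rw [if_pos hs, if_pos (Ne.symm hs), h.edgeSign_swap hs,
      barSign_congr (h.ocyc_eq_of_cyc_ne hs), mulCoeff_comm, h.not_cyc_ne hs]
    ring

theorem barSign_rev (t : EnhancedState D) (x : D.Dart) :
    barSign t (rev x) = barUnit (t.2 (cyc t.1 x)) (-agr t.1 x) := by
  rw [barSign_eq, cyc_rev, agr_rev]

/-- Reversing the source-sink orientation changes a bar sign for each label `X` involved. A term of
the multiplication involves an even number of them. A term of the comultiplication involves an odd
number, and there the exchange of the two new cycles in the local order compensates. -/
theorem Switch.dartPartial_reverse {t t' : EnhancedState D} {x y i j : D.Dart}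
    (h : Switch t.1 t'.1 x y i j) (c : Fin D.n) :
    dartPartial (rev i) (rev j) c t t' = dartPartial x y c t t' := by
  have oi := ocyc_of_next h.next_i
  have oj := ocyc_of_next h.next_j
  have oi' := ocyc_of_next h.next_i'
  have oj' := ocyc_of_next h.next_j'
  have ci : cyc t.1 (rev i) = cyc t.1 x := by rw [cyc_rev, cyc_eq_of_ocyc_eq oi]
  have cj : cyc t.1 (rev j) = cyc t.1 y := by rw [cyc_rev, cyc_eq_of_ocyc_eq oj]
  have ci' : cyc t'.1 (rev i) = cyc t'.1 y := by rw [cyc_rev, cyc_eq_of_ocyc_eq oi']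
  have cj' : cyc t'.1 (rev j) = cyc t'.1 x := by rw [cyc_rev, cyc_eq_of_ocyc_eq oj']
  have bi : barSign t (rev i) = barUnit (t.2 (cyc t.1 x)) (-agr t.1 x) := by
    rw [barSign_rev, cyc_eq_of_ocyc_eq oi, agr_eq_of_ocyc_eq oi]
  have bj : barSign t (rev j) = barUnit (t.2 (cyc t.1 y)) (-agr t.1 y) := by
    rw [barSign_rev, cyc_eq_of_ocyc_eq oj, agr_eq_of_ocyc_eq oj]
  have bi' : barSign t' (rev i) = barUnit (t'.2 (cyc t'.1 y)) (-agr t'.1 y) := by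
    rw [barSign_rev, cyc_eq_of_ocyc_eq oi', agr_eq_of_ocyc_eq oi']
  have bj' : barSign t' (rev j) = barUnit (t'.2 (cyc t'.1 x)) (-agr t'.1 x) := by
    rw [barSign_rev, cyc_eq_of_ocyc_eq oj', agr_eq_of_ocyc_eq oj']
  unfold dartPartial
  rw [dartAdjacent_congr ci cj]
  by_cases hA : DartAdjacent x y c t t'
  swap
  · rw [if_neg hA, if_neg hA]
  rw [if_pos hA, if_pos hA]
  unfold dartLocalCoeff edgeSign
  rw [dartOrderSign_congr ci cj, dartOrderSign_congr ci' cj', ci, cj, ci', cj', bi, bj, bi', bj']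
  by_cases hs : cyc t.1 x = cyc t.1 y
  · rw [if_neg (not_not.mpr hs), if_neg (not_not.mpr hs)]
    by_cases hs' : cyc t'.1 x = cyc t'.1 y
    · rw [if_neg (not_not.mpr hs'), if_neg (not_not.mpr hs'.symm), mul_zero, mul_zero]
    · rw [if_pos hs', if_pos (Ne.symm hs'), dartOrderSign_swap_of_ne hs', barUnit_neg_mul_comul,
        barSign_eq, barSign_eq, barSign_eq, comulCoeff_comm]
      ring
  · have hs' := h.not_cyc_ne hs
    rw [if_pos hs, if_pos hs, dartOrderSign_swap_of_eq hs', barUnit_neg_mul_mul,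
      ← agr_eq_of_ocyc_eq (h.ocyc_eq_of_cyc_ne hs), ← hs', barSign_eq, barSign_eq, barSign_eq]

/-! ### Multiplication by `X` at a dart -/

/-- The enhanced state in which the label of the cycle through `u` is changed. -/
noncomputable def toggle (u : D.Dart) (t : EnhancedState D) : EnhancedState D :=
  ⟨t.1, fun z => if z = cyc t.1 u then !t.2 z else t.2 z⟩

@[simp] theorem toggle_fst (u : D.Dart) (t : EnhancedState D) : (toggle u t).1 = t.1 := rfl

theorem toggle_snd (u v : D.Dart) (t : EnhancedState D) : (toggle u t).2 (cyc t.1 v) =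
    if cyc t.1 v = cyc t.1 u then !t.2 (cyc t.1 v) else t.2 (cyc t.1 v) := rfl

theorem toggle_toggle (u : D.Dart) (t : EnhancedState D) : toggle u (toggle u t) = t := by
  obtain ⟨s, ℓ⟩ := t
  unfold toggle
  simp only [Sigma.mk.injEq, heq_eq_eq, true_and]
  funext z
  split_ifs <;> simp

theorem toggle_congr {u v : D.Dart} {t : EnhancedState D} (h : cyc t.1 u = cyc t.1 v) :
    toggle u t = toggle v t := by
  unfold toggle
  rw [h]

theorem mulCoeff_not_left (a b c : Bool) : mulCoeff (!a) b c = mulCoeff a b (!c) := by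
  cases a <;> cases b <;> cases c <;> rfl

theorem comulCoeff_not_left (a b c : Bool) : comulCoeff (!a) b c = comulCoeff a (!b) c := by
  cases a <;> cases b <;> cases c <;> rfl

theorem barUnit_mul_mulCoeff (a b c : Bool) (α β γ : ℤˣ) :
    ((α : ℤ) : ℚ) * (barUnit (!a) α * barUnit b β * barUnit c γ * mulCoeff (!a) b c) =
      ((γ : ℤ) : ℚ) * (barUnit a α * barUnit b β * barUnit (!c) γ * mulCoeff a b (!c)) := by
  rw [mulCoeff_not_left]
  linear_combination (barUnit b β * barUnit c γ * mulCoeff a b (!c)) * unit_mul_barUnit_not a α -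
    (barUnit b β * barUnit a α * mulCoeff a b (!c)) * unit_mul_barUnit_not c γ

theorem barUnit_mul_comulCoeff (a b c : Bool) (α β γ : ℤˣ) :
    ((α : ℤ) : ℚ) * (barUnit (!a) α * barUnit b β * barUnit c γ * comulCoeff (!a) b c) =
      ((β : ℤ) : ℚ) * (barUnit a α * barUnit (!b) β * barUnit c γ * comulCoeff a (!b) c) := by
  rw [comulCoeff_not_left]
  linear_combination (barUnit b β * barUnit c γ * comulCoeff a (!b) c) * unit_mul_barUnit_not a α -
    (barUnit a α * barUnit c γ * comulCoeff a (!b) c) * unit_mul_barUnit_not b β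

/-- Multiplication and comultiplication are linear over `ℚ[X]/(X² - 1)`. The sign `agr` in front
makes multiplication by `X` refer to the local orientation, in which the bar operations disappear.
-/
theorem Switch.toggle_dartPartial_aux {t t' : EnhancedState D} {x y i j : D.Dart}
    (h : Switch t.1 t'.1 x y i j) (c : Fin D.n) {v v' : D.Dart} (hv : v = x ∨ v = y)
    (hv' : v' = x ∨ v' = y) :
    ((agr t.1 v : ℤ) : ℚ) * dartPartial x y c (toggle v t) t' =
      ((agr t'.1 v' : ℤ) : ℚ) * dartPartial x y c t (toggle v' t') := by
  have hA : DartAdjacent x y c (toggle v t) t' ↔ DartAdjacent x y c t (toggle v' t') := by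
    unfold DartAdjacent
    simp only [toggle_fst]
    refine and_congr_right fun _ => and_congr_right fun _ => forall_congr' fun u => ?_
    refine imp_congr_right fun hx => imp_congr_right fun hy => ?_
    have hu : ¬ Touch t.1 t'.1 x y u := fun hu => (h.touch_iff.mp hu).elim hx hy
    have hu' : ¬ (cyc t'.1 u = cyc t'.1 x ∨ cyc t'.1 u = cyc t'.1 y) := by rwa [← h.touch_iff']
    push Not at hu'
    have h1 : cyc t.1 u ≠ cyc t.1 v := by rcases hv with rfl | rfl <;> assumption
    have h2 : cyc t'.1 u ≠ cyc t'.1 v' := by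
      rcases hv' with rfl | rfl
      · exact hu'.1
      · exact hu'.2
    rw [toggle_snd, toggle_snd, if_neg h1, if_neg h2]
  unfold dartPartial
  rw [hA]
  by_cases hA' : DartAdjacent x y c t (toggle v' t')
  swap
  · rw [if_neg hA', if_neg hA', mul_zero, mul_zero]
  rw [if_pos hA', if_pos hA', toggle_fst, toggle_fst]
  unfold dartLocalCoeff
  simp only [toggle_fst, toggle_snd, barSign_eq]
  by_cases hs : cyc t.1 x = cyc t.1 y
  · by_cases hs' : cyc t'.1 x = cyc t'.1 y
    · simp [hs, hs']
    · have ho := agr_eq_of_ocyc_eq (h.symm.ocyc_eq_of_cyc_ne hs')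
      have e1 : cyc t.1 x = cyc t.1 v := by rcases hv with rfl | rfl <;> simp [hs]
      have e2 : agr t.1 v = agr t.1 x := by rcases hv with rfl | rfl <;> simp [ho]
      rw [if_neg (not_not.mpr hs), if_neg (not_not.mpr hs), if_pos hs', if_pos hs', if_pos e1, e2]
      rcases hv' with rfl | rfl
      · rw [if_pos rfl, if_neg (Ne.symm hs')]
        linear_combination edgeSign v' y t.1 t'.1 * barUnit_mul_comulCoeff (t.2 (cyc t.1 v'))
          (t'.2 (cyc t'.1 v')) (t'.2 (cyc t'.1 y)) (agr t.1 v') (agr t'.1 v') (agr t'.1 y)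
      · rw [if_pos rfl, if_neg hs', comulCoeff_comm, comulCoeff_comm (t.2 _)]
        linear_combination edgeSign x v' t.1 t'.1 * barUnit_mul_comulCoeff (t.2 (cyc t.1 x))
          (t'.2 (cyc t'.1 v')) (t'.2 (cyc t'.1 x)) (agr t.1 x) (agr t'.1 v') (agr t'.1 x)
  · have hs' := h.not_cyc_ne hs
    have ho := agr_eq_of_ocyc_eq (h.ocyc_eq_of_cyc_ne hs)
    have e1 : cyc t'.1 x = cyc t'.1 v' := by rcases hv' with rfl | rfl <;> simp [hs']
    have e2 : agr t'.1 v' = agr t'.1 x := by rcases hv' with rfl | rfl <;> simp [ho]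
    rw [if_pos hs, if_pos hs, if_pos e1, e2]
    rcases hv with rfl | rfl
    · rw [if_pos rfl, if_neg (Ne.symm hs)]
      linear_combination edgeSign v y t.1 t'.1 * barUnit_mul_mulCoeff (t.2 (cyc t.1 v))
        (t.2 (cyc t.1 y)) (t'.2 (cyc t'.1 v)) (agr t.1 v) (agr t.1 y) (agr t'.1 v)
    · rw [if_pos rfl, if_neg hs, mulCoeff_comm, mulCoeff_comm (t.2 _)]
      linear_combination edgeSign x v t.1 t'.1 * barUnit_mul_mulCoeff (t.2 (cyc t.1 v))
        (t.2 (cyc t.1 x)) (t'.2 (cyc t'.1 x)) (agr t.1 v) (agr t.1 x) (agr t'.1 x)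

/-- Multiplication by `X` at a dart commutes with the partial differentials. -/
theorem Switch.toggle_dartPartial {t t' : EnhancedState D} {x y i j : D.Dart}
    (h : Switch t.1 t'.1 x y i j) (c : Fin D.n) (u : D.Dart) :
    ((agr t.1 u : ℤ) : ℚ) * dartPartial x y c (toggle u t) t' =
      ((agr t'.1 u : ℤ) : ℚ) * dartPartial x y c t (toggle u t') := by
  by_cases hu : Touch t.1 t'.1 x y u
  · obtain ⟨v, v', hv, hv', h1 | h1⟩ := hu
    · rw [toggle_congr (cyc_eq_of_ocyc_eq h1.1), toggle_congr (cyc_eq_of_ocyc_eq h1.2),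
        agr_eq_of_ocyc_eq h1.1, agr_eq_of_ocyc_eq h1.2]
      exact h.toggle_dartPartial_aux c hv hv'
    · have e1 : cyc t.1 u = cyc t.1 v := by rw [← cyc_rev, cyc_eq_of_ocyc_eq h1.1]
      have e2 : cyc t'.1 u = cyc t'.1 v' := by rw [← cyc_rev, cyc_eq_of_ocyc_eq h1.2]
      have a1 : agr t.1 u = -agr t.1 v := by rw [← agr_eq_of_ocyc_eq h1.1, agr_rev, neg_neg]
      have a2 : agr t'.1 u = -agr t'.1 v' := by rw [← agr_eq_of_ocyc_eq h1.2, agr_rev, neg_neg]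
      rw [toggle_congr e1, toggle_congr e2, a1, a2]
      push_cast
      rw [neg_mul, neg_mul, h.toggle_dartPartial_aux c hv hv']
  -- The cycle through `u` avoids the crossing: its label only enters the adjacency condition, on
  -- both sides in the same way.
  · rw [(h.agr_eq_of_not_touch hu).2]
    congr 1
    have hA : DartAdjacent x y c (toggle u t) t' ↔ DartAdjacent x y c t (toggle u t') := by
      unfold DartAdjacent
      simp only [toggle_fst]
      refine and_congr_right fun _ => and_congr_right fun _ => forall_congr' fun w => ?_
      refine imp_congr_right fun _ => imp_congr_right fun _ => ?_
      rw [toggle_snd, toggle_snd, h.cyc_iff_of_not_touch hu]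
      split_ifs
      · cases t.2 (cyc t.1 w) <;> cases t'.2 (cyc t'.1 w) <;> simp
      · rfl
    have n1 : ¬ (cyc t.1 u = cyc t.1 x ∨ cyc t.1 u = cyc t.1 y) := by rwa [← h.touch_iff]
    have n2 : ¬ (cyc t'.1 u = cyc t'.1 x ∨ cyc t'.1 u = cyc t'.1 y) := by rwa [← h.touch_iff']
    push Not at n1 n2
    unfold dartPartial dartLocalCoeff
    rw [hA]
    simp only [toggle_fst, toggle_snd, barSign_eq, if_neg n1.1.symm,
      if_neg n1.2.symm, if_neg n2.1.symm, if_neg n2.2.symm]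

/-! ### Partial differentials evaluated on joint eigenfunctions -/

theorem EnhancedState.ext_cyc {t t' : EnhancedState D} (h1 : t.1 = t'.1)
    (h2 : ∀ u, t.2 (cyc t.1 u) = t'.2 (cyc t'.1 u)) : t = t' := by
  obtain ⟨s, ℓ⟩ := t
  obtain ⟨s', ℓ'⟩ := t'
  obtain rfl : s = s' := h1
  congr 1
  funext z
  rw [← cyc_root s z]
  exact h2 _

/-- The joint eigenfunctions of the multiplications by `X` at all darts. -/
def IsEigen (g : D.Arc → ℤˣ) (f : EnhancedState D → ℚ) : Prop :=
  ∀ u t, f (toggle u t) = ((agr t.1 u : ℤ) : ℚ) * ((dartSign g u : ℤ) : ℚ) * f t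

/-- The enhanced state with all labels `1`. -/
def ones (s : D.State) : EnhancedState D := ⟨s, fun _ => false⟩

/-- The label of the cycle through `u`. -/
def label (t : EnhancedState D) (u : D.Dart) : Bool := t.2 (cyc t.1 u)

theorem label_toggle (u v : D.Dart) (t : EnhancedState D) :
    label (toggle u t) v = if cyc t.1 v = cyc t.1 u then !label t v else label t v := rfl

theorem label_ones (s : D.State) (u : D.Dart) : label (ones s) u = false := rfl

@[simp] theorem ones_fst (s : D.State) : (ones s).1 = s := rfl

theorem label_congr {t : EnhancedState D} {s : D.State} (ht : t.1 = s) {u v : D.Dart}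
    (h : cyc s u = cyc s v) : label t u = label t v := by
  subst ht
  rw [label, h, label]

/-- The local coefficient as a function of the states and the labels at the two darts. -/
noncomputable def localForm (x y : D.Dart) (s s' : D.State) (a b c d : Bool) : ℚ :=
  if cyc s x ≠ cyc s y then
    barUnit a (agr s x) * barUnit b (agr s y) * barUnit c (agr s' x) * mulCoeff a b c
  else if cyc s' x ≠ cyc s' y then
    barUnit a (agr s x) * barUnit c (agr s' x) * barUnit d (agr s' y) * comulCoeff a c d
  else 0

theorem dartLocalCoeff_eq (x y : D.Dart) (t t' : EnhancedState D) :
    dartLocalCoeff x y t t' =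
      localForm x y t.1 t'.1 (label t x) (label t y) (label t' x) (label t' y) := by
  unfold dartLocalCoeff localForm
  simp only [barSign_eq]
  rfl

/-- The coefficient of an edge of the cube of states on the eigenspace of `g`. -/
noncomputable def edgeCoeff (x y : D.Dart) (g : D.Arc → ℤˣ) (s s' : D.State) : ℚ :=
  edgeSign x y s s' *
    (if cyc s x ≠ cyc s y then 1 + ((dartSign g x : ℤ) : ℚ) * ((dartSign g y : ℤ) : ℚ)
    else if cyc s' x ≠ cyc s' y then ((dartSign g x : ℤ) : ℚ) else 0)

theorem unit_mul_self (e : ℤˣ) : ((e : ℤ) : ℚ) * ((e : ℤ) : ℚ) = 1 := by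
  rcases Int.units_eq_one_or e with rfl | rfl <;> norm_num

theorem barUnit_true (e : ℤˣ) : barUnit true e = ((e : ℤ) : ℚ) := by
  rcases Int.units_eq_one_or e with rfl | rfl <;> simp [barUnit]

theorem barUnit_false (e : ℤˣ) : barUnit false e = 1 := by simp [barUnit]

theorem eq_of_eq_update {s s' : D.State} {c : Fin D.n} {s₂ : D.State} (hs : s c = false)
    (h : s' = Function.update s c true) (h2 : s₂ c = false)
    (h3 : s' = Function.update s₂ c true) : s₂ = s := by
  funext d
  by_cases hd : d = c
  · rw [hd, hs, h2]
  · have := congrFun (h.symm.trans h3) d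
    simpa [Function.update_of_ne hd] using this.symm

theorem dartAdjacent_ones {x y : D.Dart} {s s' : D.State} {c : Fin D.n} (hc : s c = false)
    (hs' : s' = Function.update s c true) (t : EnhancedState D) :
    DartAdjacent x y c t (ones s') ↔ t.1 = s ∧
      ∀ u, cyc s u ≠ cyc s x → cyc s u ≠ cyc s y → label t u = false := by
  constructor
  · rintro ⟨h1, h2, h3⟩
    have : t.1 = s := eq_of_eq_update hc hs' h1 h2
    refine ⟨this, fun u hx hy => ?_⟩
    rw [← this] at hx hy
    exact (h3 u hx hy).symm
  · rintro ⟨rfl, h3⟩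
    exact ⟨hc, hs', fun u hx hy => (h3 u hx hy).symm⟩

/-- The term `1 ⊗ 1` occurs in `Δ(X)` only, so a single source state contributes: the one with `X`
on the cycle that splits. The eigenvalue at `x` expresses `f` there by its value at the labelling by
`1`. -/
theorem sum_dartPartial_split {s s' : D.State} {x y : D.Dart} {c : Fin D.n} (hc : s c = false)
    (hs' : s' = Function.update s c true) (hs : cyc s x = cyc s y) (hsx : cyc s' x ≠ cyc s' y)
    {g : D.Arc → ℤˣ} {f : EnhancedState D → ℚ} (hf : IsEigen g f) :
    ∑ t, f t * dartPartial x y c t (ones s') =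
      edgeSign x y s s' * ((dartSign g x : ℤ) : ℚ) * f (ones s) := by
  have hform : ∀ a b c d, localForm x y s s' a b c d =
      barUnit a (agr s x) * barUnit c (agr s' x) * barUnit d (agr s' y) * comulCoeff a c d := by
    intro a b c d
    rw [localForm, if_neg (not_not.mpr hs), if_pos hsx]
  rw [Finset.sum_eq_single (toggle x (ones s))]
  · have hA : DartAdjacent x y c (toggle x (ones s)) (ones s') := by
      rw [dartAdjacent_ones hc hs']
      refine ⟨rfl, fun u hx _ => ?_⟩
      rw [label_toggle, ones_fst, if_neg hx, label_ones]
    rw [dartPartial, if_pos hA, hf, dartLocalCoeff_eq, toggle_fst, ones_fst, ones_fst, hform,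
      label_toggle, if_pos rfl, label_ones, label_ones, label_ones, Bool.not_false, barUnit_true,
      barUnit_false, barUnit_false]
    simp only [comulCoeff]
    linear_combination (edgeSign x y s s' * (dartSign g x : ℤ) * f (ones s)) *
      unit_mul_self (agr s x)
  · intro t _ ht
    rw [dartPartial]
    split_ifs with hA
    · obtain ⟨h1, h2⟩ := (dartAdjacent_ones hc hs' t).mp hA
      have : label t x = false := by
        by_contra hne
        rw [Bool.not_eq_false] at hne
        apply ht
        refine EnhancedState.ext_cyc h1 fun u => ?_
        change label t u = label (toggle x (ones s)) u
        rw [label_toggle, ones_fst, label_ones]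
        by_cases hu : cyc s u = cyc s x
        · rw [if_pos hu, label_congr h1 hu, hne, Bool.not_false]
        · rw [if_neg hu, h2 u hu (by rwa [← hs])]
      rw [dartLocalCoeff_eq, h1, ones_fst, hform, this, label_ones, label_ones]
      simp [comulCoeff]
    · rw [mul_zero]
  · exact fun h' => absurd (Finset.mem_univ _) h'

/-- The label `1` arises as `1 · 1` and as `X · X`; these account for the two summands of the
factor. -/
theorem sum_dartPartial_merge {s s' : D.State} {x y : D.Dart} {c : Fin D.n} (hc : s c = false)
    (hs' : s' = Function.update s c true) (hs : cyc s x ≠ cyc s y)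
    {g : D.Arc → ℤˣ} {f : EnhancedState D → ℚ} (hf : IsEigen g f) :
    ∑ t, f t * dartPartial x y c t (ones s') =
      edgeSign x y s s' * (1 + ((dartSign g x : ℤ) : ℚ) * ((dartSign g y : ℤ) : ℚ)) *
        f (ones s) := by
  have hform : ∀ a b c d, localForm x y s s' a b c d =
      barUnit a (agr s x) * barUnit b (agr s y) * barUnit c (agr s' x) * mulCoeff a b c := by
    intro a b c d
    rw [localForm, if_pos hs]
  set T := toggle x (toggle y (ones s)) with hT
  have T1 : T.1 = s := rfl
  have Tx : label T x = true := by
    simp [hT, label_toggle, hs, label_ones]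
  have Ty : label T y = true := by
    simp [hT, label_toggle, Ne.symm hs, label_ones]
  have Tu : ∀ u, cyc s u ≠ cyc s x → cyc s u ≠ cyc s y → label T u = false := by
    intro u hx hy
    simp [hT, label_toggle, hx, hy, label_ones]
  have hne : ones s ≠ T := by
    intro h'
    rw [← h', label_ones] at Tx
    exact absurd Tx (by decide)
  have hsub : ∑ t ∈ ({ones s, T} : Finset (EnhancedState D)),
      f t * dartPartial x y c t (ones s') = ∑ t, f t * dartPartial x y c t (ones s') := by
    apply Finset.sum_subset (Finset.subset_univ _)
    intro t _ ht
    simp only [Finset.mem_insert, Finset.mem_singleton, not_or] at ht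
    rw [dartPartial]
    split_ifs with hA
    · obtain ⟨h1, h2⟩ := (dartAdjacent_ones hc hs' t).mp hA
      rw [dartLocalCoeff_eq, h1, ones_fst, hform, label_ones]
      have : mulCoeff (label t x) (label t y) false = 0 := by
        by_contra hm
        have hxy : label t x = label t y := by
          revert hm
          cases label t x <;> cases label t y <;> simp [mulCoeff]
        have hext : ∀ t₂ : EnhancedState D, t₂.1 = s → label t₂ x = label t x →
            label t₂ y = label t y → (∀ u, cyc s u ≠ cyc s x → cyc s u ≠ cyc s y →
              label t₂ u = false) → t = t₂ := by
          intro t₂ e1 e2 e3 e4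
          refine EnhancedState.ext_cyc (h1.trans e1.symm) fun u => ?_
          change label t u = label t₂ u
          by_cases hux : cyc s u = cyc s x
          · rw [label_congr h1 hux, label_congr e1 hux, e2]
          by_cases huy : cyc s u = cyc s y
          · rw [label_congr h1 huy, label_congr e1 huy, e3]
          rw [h2 u hux huy, e4 u hux huy]
        cases hb : label t x
        · exact ht.1 (hext _ rfl (by rw [label_ones, hb]) (by rw [label_ones, ← hxy, hb])
            (fun u _ _ => label_ones s u))
        · exact ht.2 (hext T rfl (by rw [Tx, hb]) (by rw [Ty, ← hxy, hb]) Tu)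
      rw [this, mul_zero, mul_zero, mul_zero]
    · rw [mul_zero]
  rw [← hsub, Finset.sum_pair hne]
  have fT : f T = (agr s x : ℤ) * (dartSign g x : ℤ) * ((agr s y : ℤ) * (dartSign g y : ℤ) *
      f (ones s)) := by
    rw [hT, hf, hf]; rfl
  have P0 : dartPartial x y c (ones s) (ones s') = edgeSign x y s s' := by
    rw [dartPartial, if_pos ((dartAdjacent_ones hc hs' _).mpr ⟨rfl, fun u _ _ => label_ones s u⟩),
      dartLocalCoeff_eq, ones_fst, ones_fst, hform]
    simp [label_ones, barUnit_false, mulCoeff]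
  have PT : dartPartial x y c T (ones s') =
      edgeSign x y s s' * ((agr s x : ℤ) * (agr s y : ℤ)) := by
    rw [dartPartial, if_pos ((dartAdjacent_ones hc hs' _).mpr ⟨rfl, Tu⟩),
      dartLocalCoeff_eq, ones_fst, T1, hform, Tx, Ty, label_ones, barUnit_true, barUnit_true,
      barUnit_false]
    simp [mulCoeff]
  rw [P0, PT, fT]
  have ax := unit_mul_self (agr s x)
  have ay := unit_mul_self (agr s y)
  linear_combination edgeSign x y s s' * (dartSign g x : ℤ) * (dartSign g y : ℤ) * f (ones s) *
    (((agr s y : ℤ) : ℚ) * ((agr s y : ℤ) : ℚ) * ax + ay)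

theorem sum_dartPartial {s s' : D.State} {x y : D.Dart} {c : Fin D.n} (hc : s c = false)
    (hs' : s' = Function.update s c true) {g : D.Arc → ℤˣ} {f : EnhancedState D → ℚ}
    (hf : IsEigen g f) :
    ∑ t, f t * dartPartial x y c t (ones s') = edgeCoeff x y g s s' * f (ones s) := by
  unfold edgeCoeff
  by_cases hs : cyc s x = cyc s y
  · rw [if_neg (not_not.mpr hs)]
    by_cases hsx : cyc s' x = cyc s' y
    · rw [if_neg (not_not.mpr hsx), mul_zero, zero_mul]
      refine Finset.sum_eq_zero fun t _ => ?_
      rw [dartPartial]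
      split_ifs with hA
      · rw [dartLocalCoeff_eq, ((dartAdjacent_ones hc hs' t).mp hA).1, ones_fst, localForm,
          if_neg (not_not.mpr hs), if_neg (not_not.mpr hsx), mul_zero, mul_zero]
      · rw [mul_zero]
    · rw [if_pos hsx, sum_dartPartial_split hc hs' hs hsx hf]
  · rw [if_pos hs, sum_dartPartial_merge hc hs' hs hf]

/-! ### The two ends of a passage -/

theorem word_fst_eq_iff {p r : Fin (2 * D.n)} :
    (D.word r).1 = (D.word p).1 ↔ r = p ∨ r = D.other p := by
  constructor
  · intro h
    by_cases hb : (D.word r).2 = (D.word p).2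
    · exact Or.inl (D.word.injective (Prod.ext h hb))
    · right
      apply D.word.injective
      rw [word_other]
      refine Prod.ext h ?_
      revert hb
      cases (D.word r).2 <;> cases (D.word p).2 <;> simp
  · rintro (rfl | rfl)
    · rfl
    · rw [word_other]

theorem oriented_update_iff (s : D.State) (c : Fin D.n) :
    D.Oriented (Function.update s c (!s c)) c ↔ ¬ D.Oriented s c := by
  unfold Oriented
  rw [Function.update_self]
  cases s c <;> simp

theorem oriented_update_of_ne (s : D.State) {c d : Fin D.n} (h : d ≠ c) (b : Bool) :
    D.Oriented (Function.update s c b) d ↔ D.Oriented s d := by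
  unfold Oriented
  rw [Function.update_of_ne h]

theorem switch_of_oriented (s : D.State) (p : Fin (2 * D.n)) (h : D.Oriented s (D.word p).1) :
    Switch s (Function.update s (D.word p).1 (!s (D.word p).1)) (p.succ, true) (p.castSucc, false)
      ((D.other p).castSucc, true) ((D.other p).succ, false) := by
  have hq : (D.word (D.other p)).1 = (D.word p).1 := by rw [word_other]
  have hs' : ¬ D.Oriented (Function.update s (D.word p).1 (!s (D.word p).1)) (D.word p).1 := by
    rw [oriented_update_iff]; exact not_not.mpr h
  have hne := other_ne p
  constructor
  · rw [next_castSucc_true, hq, if_pos h, other_other]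
  · rw [next_succ_false, hq, if_pos h, other_other]
  · rw [next_castSucc_true, hq, if_neg hs', other_other]
  · rw [next_succ_false, hq, if_neg hs', other_other]
  · intro u h1 h2 h3 h4
    rcases dart_cases u with ⟨r, rfl⟩ | ⟨r, rfl⟩ | rfl | rfl
    · have : (D.word r).1 ≠ (D.word p).1 := by
        rw [Ne, word_fst_eq_iff]
        rintro (rfl | rfl)
        · exact h4 rfl
        · exact h1 rfl
      rw [next_castSucc_true, next_castSucc_true]
      simp only [oriented_update_of_ne s this]
    · have : (D.word r).1 ≠ (D.word p).1 := by
        rw [Ne, word_fst_eq_iff]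
        rintro (rfl | rfl)
        · exact h3 rfl
        · exact h2 rfl
      rw [next_succ_false, next_succ_false]
      simp only [oriented_update_of_ne s this]
    · rw [next_last_true, next_last_true]
    · rw [next_zero_false, next_zero_false]
  · simp
  · simp
  · simp [rev]
  · simpa [rev] using hne
  · simpa [rev] using hne
  · simp [rev]

theorem switch_of_not_oriented (s : D.State) (p : Fin (2 * D.n))
    (h : ¬ D.Oriented s (D.word p).1) :
    Switch s (Function.update s (D.word p).1 (!s (D.word p).1)) (p.succ, true) (p.castSucc, false)
      ((D.other p).succ, false) ((D.other p).castSucc, true) := by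
  have := switch_of_oriented (Function.update s (D.word p).1 (!s (D.word p).1)) p
    ((oriented_update_iff s _).mpr h)
  have h2 := this.symm
  simpa using h2

theorem exists_switch (p : Fin (2 * D.n)) (s : D.State) :
    ∃ i j, Switch s (Function.update s (D.word p).1 (!s (D.word p).1)) (p.succ, true)
      (p.castSucc, false) i j ∧ (i = ((D.other p).castSucc, true) ∨ i = ((D.other p).succ, false)) ∧
      (j = ((D.other p).castSucc, true) ∨ j = ((D.other p).succ, false)) := by
  by_cases h : D.Oriented s (D.word p).1
  · exact ⟨_, _, switch_of_oriented s p h, Or.inl rfl, Or.inr rfl⟩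
  · exact ⟨_, _, switch_of_not_oriented s p h, Or.inr rfl, Or.inl rfl⟩

/-- The passage of the strand through `c` both of whose ends point away from `c`. -/
def sourcePassage (σ : SourceSink D.n) (c : Fin D.n) : Fin (2 * D.n) :=
  D.word.symm (c, σ.source c)

theorem word_sourcePassage (σ : SourceSink D.n) (c : Fin D.n) :
    (D.word (sourcePassage σ c)).1 = c := by simp [sourcePassage]

theorem site_cases (σ : SourceSink D.n) (c : Fin D.n) :
    (σ.labelAfter c = true ∧ site₁ σ c = ((sourcePassage σ c).succ, true) ∧
      site₂ σ c = ((sourcePassage σ c).castSucc, false)) ∨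
    (σ.labelAfter c = false ∧ site₁ σ c = ((sourcePassage σ c).castSucc, false) ∧
      site₂ σ c = ((sourcePassage σ c).succ, true)) := by
  cases h : σ.labelAfter c <;> simp [site₁, site₂, h, sourcePassage]

/-- The ends with which `i` and `j` of a switch are joined depend on the state only through the
smoothing of the crossing; two states with the same smoothing have the same `i` and `j`. -/
theorem exists_switch_site (σ : SourceSink D.n) (c : Fin D.n) (b : Bool) :
    ∃ i j, ∀ s : D.State, s c = b →
      Switch s (Function.update s c (!s c)) (site₁ σ c) (site₂ σ c) i j := by
  have key : ∃ i j, ∀ s : D.State, s c = b →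
      Switch s (Function.update s c (!s c)) ((sourcePassage σ c).succ, true)
        ((sourcePassage σ c).castSucc, false) i j := by
    have hw := word_sourcePassage σ c
    by_cases h : b = false ↔ D.sign c = 1
    · refine ⟨((D.other (sourcePassage σ c)).castSucc, true),
        ((D.other (sourcePassage σ c)).succ, false), fun s hs => ?_⟩
      have := switch_of_oriented s (sourcePassage σ c) (by rw [hw, Oriented, hs]; exact h)
      rwa [hw] at this
    · refine ⟨((D.other (sourcePassage σ c)).succ, false),
        ((D.other (sourcePassage σ c)).castSucc, true), fun s hs => ?_⟩
      have := switch_of_not_oriented s (sourcePassage σ c) (by rw [hw, Oriented, hs]; exact h)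
      rwa [hw] at this
  obtain ⟨i, j, h⟩ := key
  rcases site_cases σ c with ⟨-, h1, h2⟩ | ⟨-, h1, h2⟩ <;> rw [h1, h2]
  · exact ⟨i, j, h⟩
  · exact ⟨j, i, fun s hs => (h s hs).swap⟩

theorem update_not_of_false {s : D.State} {c : Fin D.n} (h : s c = false) :
    Function.update s c (!s c) = Function.update s c true := by rw [h]; rfl

theorem exists_switch_site_true (σ : SourceSink D.n) {s s' : D.State} {c : Fin D.n}
    (hc : s c = false) (hs' : s' = Function.update s c true) :
    ∃ i j, Switch s s' (site₁ σ c) (site₂ σ c) i j := by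
  obtain ⟨i, j, h⟩ := exists_switch_site σ c (s c)
  have := h s rfl
  rw [update_not_of_false hc, ← hs'] at this
  exact ⟨i, j, this⟩

/-! ### Independence of the source-sink orientations and local orders -/

theorem dartPartial_of_not {x y : D.Dart} {c : Fin D.n} {t t' : EnhancedState D}
    (h : ¬ (t.1 c = false ∧ t'.1 = Function.update t.1 c true)) :
    dartPartial x y c t t' = 0 :=
  if_neg fun h' => h ⟨h'.1, h'.2.1⟩

/-- Using the other strand as the source amounts to `Switch.dartPartial_reverse`. At a positive
crossing the `A`-smoothing is the oriented one and the reversed ends appear in exchanged order,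
which costs a sign; at a negative crossing they keep their order. -/
theorem dartPartial_other (p : Fin (2 * D.n)) : ∃ r : ℤˣ, ∀ t t' : EnhancedState D,
    dartPartial ((D.other p).succ, true) ((D.other p).castSucc, false) (D.word p).1 t t' =
      ((r : ℤ) : ℚ) * dartPartial (p.succ, true) (p.castSucc, false) (D.word p).1 t t' := by
  by_cases hsign : D.sign (D.word p).1 = 1
  · refine ⟨-1, fun t t' => ?_⟩
    by_cases h : t.1 (D.word p).1 = false ∧ t'.1 = Function.update t.1 (D.word p).1 true
    · have hsw := switch_of_oriented t.1 p (by rw [Oriented]; simp [h.1, hsign])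
      rw [update_not_of_false h.1, ← h.2] at hsw
      have h1 := hsw.dartPartial_reverse (D.word p).1
      have h2 := hsw.reverse.dartPartial_swap (D.word p).1
      rw [h1] at h2
      simp only [rev] at h2
      rw [show (((D.other p).succ, true) : D.Dart) = ((D.other p).succ, !false) from rfl,
        show (((D.other p).castSucc, false) : D.Dart) = ((D.other p).castSucc, !true) from rfl, h2]
      simp
    · rw [dartPartial_of_not h, dartPartial_of_not h, mul_zero]
  · refine ⟨1, fun t t' => ?_⟩
    by_cases h : t.1 (D.word p).1 = false ∧ t'.1 = Function.update t.1 (D.word p).1 true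
    · have hsw := switch_of_not_oriented t.1 p (by rw [Oriented]; simp [h.1, hsign])
      rw [update_not_of_false h.1, ← h.2] at hsw
      have h1 := hsw.dartPartial_reverse (D.word p).1
      simp only [rev] at h1
      rw [show (((D.other p).succ, true) : D.Dart) = ((D.other p).succ, !false) from rfl,
        show (((D.other p).castSucc, false) : D.Dart) = ((D.other p).castSucc, !true) from rfl, h1]
      simp
    · rw [dartPartial_of_not h, dartPartial_of_not h, mul_zero]

theorem partialCoeff_eq_over (σ : SourceSink D.n) (c : Fin D.n) : ∃ r : ℤˣ,
    ∀ t t' : EnhancedState D, partialCoeff σ c t t' = ((r : ℤ) : ℚ) *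
      dartPartial ((D.word.symm (c, true)).succ, true) ((D.word.symm (c, true)).castSucc, false)
        c t t' := by
  have h1 : ∃ r : ℤˣ, ∀ t t' : EnhancedState D,
      dartPartial ((sourcePassage σ c).succ, true) ((sourcePassage σ c).castSucc, false) c t t' =
        ((r : ℤ) : ℚ) * dartPartial ((D.word.symm (c, true)).succ, true)
          ((D.word.symm (c, true)).castSucc, false) c t t' := by
    unfold sourcePassage
    cases σ.source c
    · obtain ⟨r, hr⟩ := dartPartial_other (D.word.symm (c, true))
      have e : D.other (D.word.symm (c, true)) = D.word.symm (c, false) := by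
        simp [other]
      rw [e] at hr
      simp only [Equiv.apply_symm_apply] at hr
      exact ⟨r, hr⟩
    · exact ⟨1, fun t t' => by simp⟩
  obtain ⟨r, hr⟩ := h1
  rcases site_cases σ c with ⟨-, e1, e2⟩ | ⟨-, e1, e2⟩
  · refine ⟨r, fun t t' => ?_⟩
    rw [partialCoeff_eq, e1, e2, hr]
  · refine ⟨-r, fun t t' => ?_⟩
    rw [partialCoeff_eq, e1, e2]
    by_cases h : t.1 c = false ∧ t'.1 = Function.update t.1 c true
    · obtain ⟨i, j, hsw, -⟩ := exists_switch (sourcePassage σ c) t.1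
      rw [word_sourcePassage, update_not_of_false h.1, ← h.2] at hsw
      rw [hsw.dartPartial_swap, hr]
      push_cast
      ring
    · rw [dartPartial_of_not h, dartPartial_of_not h, mul_zero]

/-- Up to a sign for each crossing, the partial differentials do not depend on the source-sink
orientations and local orders. -/
theorem exists_partialCoeff_eq (σ τ : SourceSink D.n) : ∃ r : Fin D.n → ℤˣ,
    ∀ c, ∀ t t' : EnhancedState D,
      partialCoeff σ c t t' = ((r c : ℤ) : ℚ) * partialCoeff τ c t t' := by
  choose r hr using partialCoeff_eq_over σ
  choose q hq using partialCoeff_eq_over τ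
  refine ⟨fun c => r c * q c, fun c t t' => ?_⟩
  rw [hr, hq, ← mul_assoc]
  push_cast
  have := unit_mul_self (q c)
  congr 1
  linear_combination -((r c : ℤ) : ℚ) * this

/-! ### Eigenfunctions -/

/-- The character of the labels given by arc signs. -/
noncomputable def gchar (g : D.Arc → ℤˣ) (t : EnhancedState D) : ℚ :=
  ∏ a ∈ Roots t.1, if label t (a, true) = true then ((g a : ℤ) : ℚ) else 1

theorem cyc_eq_iff_of_mem_Roots {s : D.State} {a : D.Arc} (ha : a ∈ Roots s) (u : D.Dart) :
    cyc s (a, true) = cyc s u ↔ a = rt s u := by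
  rw [← rt_eq_iff, mem_Roots.mp ha]

theorem gchar_toggle (g : D.Arc → ℤˣ) (u : D.Dart) (t : EnhancedState D) :
    gchar g (toggle u t) = ((g (rt t.1 u) : ℤ) : ℚ) * gchar g t := by
  unfold gchar
  rw [toggle_fst, ← Finset.mul_prod_erase _ _ (rt_mem_Roots t.1 u),
    ← Finset.mul_prod_erase _ _ (rt_mem_Roots t.1 u), ← mul_assoc]
  congr 1
  · rw [label_toggle, if_pos (cyc_rt _ _)]
    have := unit_mul_self (g (rt t.1 u))
    cases label t (rt t.1 u, true) <;> simp [this]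
  · refine Finset.prod_congr rfl fun a ha => ?_
    obtain ⟨h1, h2⟩ := Finset.mem_erase.mp ha
    have h3 : ¬ cyc t.1 (a, true) = cyc t.1 u := by rwa [cyc_eq_iff_of_mem_Roots h2]
    rw [label_toggle, if_neg h3]

theorem gchar_ones (g : D.Arc → ℤˣ) (s : D.State) : gchar g (ones s) = 1 := by
  unfold gchar
  exact Finset.prod_eq_one fun a _ => by simp [label_ones]

theorem Compat.agr_mul {g : D.Arc → ℤˣ} {s : D.State} (hg : Compat g s) (u : D.Dart) :
    ((agr s u : ℤ) : ℚ) * ((dartSign g u : ℤ) : ℚ) = ((g (rt s u) : ℤ) : ℚ) := by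
  rw [hg.dartSign_eq u]
  push_cast
  rw [← mul_assoc, unit_mul_self, one_mul, rt]

theorem eq_ones_of_label {t : EnhancedState D}
    (h : ∀ a ∈ Roots t.1, label t (a, true) = false) : t = ones t.1 := by
  refine EnhancedState.ext_cyc rfl fun u => ?_
  change label t u = label (ones t.1) u
  rw [label_ones, ← h _ (rt_mem_Roots t.1 u)]
  exact label_congr rfl (cyc_rt t.1 u).symm

/-- Labels `X` are removed one at a time, each at the first arc of its cycle, where the global
orientation agrees with the arc and the factor is just `g`. -/
theorem IsEigen.eq_gchar_mul {g : D.Arc → ℤˣ} {f : EnhancedState D → ℚ} (hf : IsEigen g f)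
    (t : EnhancedState D) : f t = gchar g t * f (ones t.1) := by
  induction hn : ((Roots t.1).filter fun a => label t (a, true) = true).card using
    Nat.strong_induction_on generalizing t with
  | _ k ih =>
    subst hn
    by_cases h : ∀ a ∈ Roots t.1, label t (a, true) = false
    · have ht := eq_ones_of_label h
      have h1 : gchar g t = 1 := by rw [ht]; exact gchar_ones g _
      rw [h1, one_mul]
      exact congrArg f ht
    · push Not at h
      obtain ⟨a, ha, hl⟩ := h
      replace hl : label t (a, true) = true := by simpa using hl
      have hrt : rt t.1 (a, true) = a := mem_Roots.mp ha
      have h1 := ih _ ?_ (toggle (a, true) t) rfl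
      · rw [hf, gchar_toggle, hrt, toggle_fst, dartSign_true] at h1
        have hagr : agr t.1 (a, true) = 1 := by
          have := agr_root t.1 (cyc t.1 (a, true))
          rwa [show root t.1 (cyc t.1 (a, true)) = a from hrt] at this
        rw [hagr] at h1
        have h2 := unit_mul_self (g a)
        have h3 : ((g a : ℤ) : ℚ) ≠ 0 := left_ne_zero_of_mul (h2.trans_ne one_ne_zero)
        apply mul_left_cancel₀ h3
        simpa [mul_assoc] using h1
      · apply Finset.card_lt_card
        rw [Finset.ssubset_iff_of_subset]
        · refine ⟨a, Finset.mem_filter.mpr ⟨ha, hl⟩, ?_⟩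
          simp [label_toggle, hl]
        · intro b hb
          obtain ⟨hb1, hb2⟩ := Finset.mem_filter.mp hb
          rw [toggle_fst] at hb1
          refine Finset.mem_filter.mpr ⟨hb1, ?_⟩
          rw [label_toggle] at hb2
          split_ifs at hb2 with hc
          · rw [cyc_eq_iff_of_mem_Roots hb1, hrt] at hc
            subst hc
            exact hl
          · exact hb2

/-- At the state of `t`, multiplication by `X` at `u` and at `next t.1 u` are the same operation; if
their eigenvalues differ, the value must vanish. -/
theorem IsEigen.eq_zero_of_not_compat {g : D.Arc → ℤˣ} {f : EnhancedState D → ℚ}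
    (hf : IsEigen g f) {t : EnhancedState D} (ht : ¬ Compat g t.1) : f t = 0 := by
  unfold Compat at ht
  push Not at ht
  obtain ⟨u, hu⟩ := ht
  have h1 := hf (next t.1 u) t
  rw [toggle_congr (cyc_next t.1 u), hf, agr_next] at h1
  have h2 : ((agr t.1 u : ℤ) : ℚ) ≠ 0 :=
    left_ne_zero_of_mul ((unit_mul_self (agr t.1 u)).trans_ne one_ne_zero)
  have h3 : ((dartSign g (next t.1 u) : ℤ) : ℚ) ≠ ((dartSign g u : ℤ) : ℚ) := by
    intro h
    exact hu (Units.ext (by exact_mod_cast h))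
  have h4 : ((agr t.1 u : ℤ) : ℚ) *
      (((dartSign g (next t.1 u) : ℤ) : ℚ) - ((dartSign g u : ℤ) : ℚ)) * f t = 0 := by
    linear_combination -h1
  rcases mul_eq_zero.mp h4 with h5 | h5
  · exact absurd h5 (mul_ne_zero h2 (sub_ne_zero.mpr h3))
  · exact h5

theorem isEigen_of_forall {g : D.Arc → ℤˣ} (w : D.State → ℚ) :
    IsEigen g fun t => if Compat g t.1 then gchar g t * w t.1 else 0 := by
  intro u t
  beta_reduce
  by_cases h : Compat g t.1
  · have h' : Compat g (toggle u t).1 := h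
    rw [if_pos h', if_pos h, gchar_toggle, h.agr_mul, mul_assoc, toggle_fst]
  · have h' : ¬ Compat g (toggle u t).1 := h
    rw [if_neg h', if_neg h, mul_zero]

theorem IsEigen.ext {g : D.Arc → ℤˣ} {f f' : EnhancedState D → ℚ} (hf : IsEigen g f)
    (hf' : IsEigen g f') (h : ∀ s, Compat g s → f (ones s) = f' (ones s)) : f = f' := by
  funext t
  by_cases ht : Compat g t.1
  · rw [hf.eq_gchar_mul, hf'.eq_gchar_mul, h _ ht]
  · rw [hf.eq_zero_of_not_compat ht, hf'.eq_zero_of_not_compat ht]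

/-! ### The differential on functions -/

/-- The differential on functions on the enhanced states. -/
noncomputable def dmap (σ : SourceSink D.n) :
    (EnhancedState D → ℚ) →ₗ[ℚ] (EnhancedState D → ℚ) where
  toFun f t' := ∑ c, ∑ t, f t * partialCoeff σ c t t'
  map_add' f f' := by
    funext t'
    simp only [Pi.add_apply, add_mul, Finset.sum_add_distrib]
  map_smul' r f := by
    funext t'
    simp only [Pi.smul_apply, smul_eq_mul, RingHom.id_apply, Finset.mul_sum, mul_assoc]

theorem dmap_apply (σ : SourceSink D.n) (f : EnhancedState D → ℚ) (t' : EnhancedState D) :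
    dmap σ f t' = ∑ c, ∑ t, f t * partialCoeff σ c t t' := rfl

/-- Multiplication by `X` at a dart. -/
noncomputable def mulX (u : D.Dart) : (EnhancedState D → ℚ) →ₗ[ℚ] (EnhancedState D → ℚ) where
  toFun f t := ((agr t.1 u : ℤ) : ℚ) * f (toggle u t)
  map_add' f f' := by
    funext t'
    simp only [Pi.add_apply, mul_add]
  map_smul' r f := by
    funext t'
    simp only [Pi.smul_apply, smul_eq_mul, RingHom.id_apply]
    ring

theorem mulX_apply (u : D.Dart) (f : EnhancedState D → ℚ) (t : EnhancedState D) :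
    mulX u f t = ((agr t.1 u : ℤ) : ℚ) * f (toggle u t) := rfl

theorem mulX_mulX_self (u : D.Dart) (f : EnhancedState D → ℚ) : mulX u (mulX u f) = f := by
  funext t
  rw [mulX_apply, mulX_apply, toggle_toggle, toggle_fst, ← mul_assoc, unit_mul_self, one_mul]

theorem toggle_comm (u v : D.Dart) (t : EnhancedState D) :
    toggle u (toggle v t) = toggle v (toggle u t) := by
  refine EnhancedState.ext_cyc rfl fun w => ?_
  change label (toggle u (toggle v t)) w = label (toggle v (toggle u t)) w
  rw [label_toggle, label_toggle, label_toggle, label_toggle]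
  change (if cyc t.1 w = cyc t.1 u then !(if cyc t.1 w = cyc t.1 v then !label t w else label t w)
      else (if cyc t.1 w = cyc t.1 v then !label t w else label t w)) =
    (if cyc t.1 w = cyc t.1 v then !(if cyc t.1 w = cyc t.1 u then !label t w else label t w)
      else (if cyc t.1 w = cyc t.1 u then !label t w else label t w))
  split_ifs <;> rfl

theorem mulX_comm (u v : D.Dart) (f : EnhancedState D → ℚ) :
    mulX u (mulX v f) = mulX v (mulX u f) := by
  funext t
  simp only [mulX_apply, toggle_fst]
  rw [toggle_comm]
  ring

theorem mulX_rev (u : D.Dart) (f : EnhancedState D → ℚ) : mulX (rev u) f = -mulX u f := by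
  funext t
  rw [Pi.neg_apply, mulX_apply, mulX_apply, agr_rev, toggle_congr (cyc_rev t.1 u)]
  push_cast
  ring

theorem partialCoeff_of_not {σ : SourceSink D.n} {c : Fin D.n} {t t' : EnhancedState D}
    (h : ¬ (t.1 c = false ∧ t'.1 = Function.update t.1 c true)) :
    partialCoeff σ c t t' = 0 := dartPartial_of_not h

theorem toggle_partialCoeff (σ : SourceSink D.n) (c : Fin D.n) (u : D.Dart)
    (t t' : EnhancedState D) :
    ((agr t.1 u : ℤ) : ℚ) * partialCoeff σ c (toggle u t) t' =
      ((agr t'.1 u : ℤ) : ℚ) * partialCoeff σ c t (toggle u t') := by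
  by_cases h : t.1 c = false ∧ t'.1 = Function.update t.1 c true
  · obtain ⟨i, j, hsw⟩ := exists_switch_site_true σ h.1 h.2
    exact hsw.toggle_dartPartial c u
  · rw [partialCoeff_of_not (t := toggle u t) h, partialCoeff_of_not (t' := toggle u t') h,
      mul_zero, mul_zero]

theorem toggle_bijective (u : D.Dart) : Function.Bijective (toggle u) :=
  Function.Involutive.bijective (toggle_toggle u)

theorem dmap_mulX (σ : SourceSink D.n) (u : D.Dart) (f : EnhancedState D → ℚ) :
    dmap σ (mulX u f) = mulX u (dmap σ f) := by
  funext t'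
  rw [mulX_apply, dmap_apply, dmap_apply, Finset.mul_sum]
  refine Finset.sum_congr rfl fun c _ => ?_
  rw [← (toggle_bijective u).sum_comp, Finset.mul_sum]
  refine Finset.sum_congr rfl fun t _ => ?_
  rw [mulX_apply, toggle_toggle, toggle_fst]
  linear_combination f t * toggle_partialCoeff σ c u t t'

theorem isEigen_iff {g : D.Arc → ℤˣ} {f : EnhancedState D → ℚ} :
    IsEigen g f ↔ ∀ a : D.Arc, mulX (a, true) f = ((g a : ℤ) : ℚ) • f := by
  constructor
  · intro h a
    funext t
    rw [mulX_apply, h, dartSign_true, Pi.smul_apply, smul_eq_mul, ← mul_assoc, ← mul_assoc,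
      unit_mul_self, one_mul]
  · intro h
    have h1 : ∀ u : D.Dart, mulX u f = ((dartSign g u : ℤ) : ℚ) • f := by
      rintro ⟨a, _ | _⟩
      · have : ((a, false) : D.Dart) = rev (a, true) := rfl
        rw [this, mulX_rev, h, dartSign_rev, dartSign_true]
        push_cast
        rw [neg_smul]
      · rw [h, dartSign_true]
    intro u t
    have h2 := congrFun (h1 u) t
    rw [mulX_apply, Pi.smul_apply, smul_eq_mul] at h2
    have h3 := unit_mul_self (agr t.1 u)
    linear_combination ((agr t.1 u : ℤ) : ℚ) * h2 - f (toggle u t) * h3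

theorem IsEigen.dmap {g : D.Arc → ℤˣ} {f : EnhancedState D → ℚ} (hf : IsEigen g f)
    (σ : SourceSink D.n) : IsEigen g (dmap σ f) := by
  rw [isEigen_iff] at hf ⊢
  intro a
  rw [← dmap_mulX, hf, map_smul]

/-- The coefficient of the differential at `c` on the eigenspace of `g`. -/
noncomputable def crossCoeff (σ : SourceSink D.n) (g : D.Arc → ℤˣ) (s : D.State) (c : Fin D.n) : ℚ :=
  edgeCoeff (site₁ σ c) (site₂ σ c) g s (Function.update s c true)

theorem IsEigen.sum_partialCoeff {g : D.Arc → ℤˣ} {f : EnhancedState D → ℚ} (hf : IsEigen g f)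
    (σ : SourceSink D.n) {s : D.State} {c : Fin D.n} (hc : s c = false) :
    ∑ t, f t * partialCoeff σ c t (ones (Function.update s c true)) =
      crossCoeff σ g s c * f (ones s) :=
  sum_dartPartial hc rfl hf

/-- On an eigenspace the complex is a cube with scalar edge maps; all later homological arguments
use this form. -/
theorem IsEigen.dmap_ones {g : D.Arc → ℤˣ} {f : EnhancedState D → ℚ} (hf : IsEigen g f)
    (σ : SourceSink D.n) (s' : D.State) :
    GaussCode.dmap σ f (ones s') = ∑ c, if s' c = true then
      crossCoeff σ g (Function.update s' c false) c * f (ones (Function.update s' c false))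
      else 0 := by
  rw [dmap_apply]
  refine Finset.sum_congr rfl fun c _ => ?_
  split_ifs with h
  · rw [← hf.sum_partialCoeff σ (Function.update_self c false s')]
    have : Function.update (Function.update s' c false) c true = s' := by
      rw [Function.update_idem, ← h, Function.update_eq_self]
    rw [this]
  · refine Finset.sum_eq_zero fun t _ => ?_
    rw [partialCoeff_of_not, mul_zero]
    rintro ⟨-, h2⟩
    apply h
    rw [ones_fst] at h2
    rw [h2, Function.update_self]

/-- The eigenfunction of `g` supported on the state `s`. -/
noncomputable def stateChain (g : D.Arc → ℤˣ) (s : D.State) (t : EnhancedState D) : ℚ :=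
  if t.1 = s then gchar g t else 0

theorem isEigen_stateChain {g : D.Arc → ℤˣ} {s : D.State} (hg : Compat g s) :
    IsEigen g (stateChain g s) := by
  intro u t
  unfold stateChain
  by_cases h : t.1 = s
  · have h' : (toggle u t).1 = s := h
    rw [if_pos h', if_pos h, gchar_toggle, Compat.agr_mul (h ▸ hg)]
  · have h' : ¬ (toggle u t).1 = s := h
    rw [if_neg h', if_neg h, mul_zero]

theorem stateChain_ones (g : D.Arc → ℤˣ) (s s' : D.State) :
    stateChain g s (ones s') = if s' = s then 1 else 0 := by
  unfold stateChain
  rw [ones_fst, gchar_ones]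

/-! ### Anticommutation -/

/-- The four ends at `c` carry the same sign with respect to the source-sink orientation. -/
def Mono (g : D.Arc → ℤˣ) (c : Fin D.n) : Prop :=
  dartSign g ((D.word.symm (c, true)).succ, true) =
    dartSign g ((D.word.symm (c, true)).castSucc, false)

/-- Either smoothing joins the ends of one strand to the ends of the other, so the common sign is
carried across. Hence `Mono` can be tested on either strand. -/
theorem Compat.ends_eq {g : D.Arc → ℤˣ} {s : D.State} (hg : Compat g s) {p : Fin (2 * D.n)}
    (h : dartSign g (p.succ, true) = dartSign g (p.castSucc, false)) :
    dartSign g ((D.other p).succ, true) = -dartSign g (p.succ, true) ∧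
      dartSign g ((D.other p).castSucc, false) = -dartSign g (p.succ, true) := by
  have e1 : (((D.other p).succ, true) : D.Dart) = rev ((D.other p).succ, false) := rfl
  have e2 : (((D.other p).castSucc, false) : D.Dart) = rev ((D.other p).castSucc, true) := rfl
  have n1 := next_succ_false s (D.other p)
  have n2 := next_castSucc_true s (D.other p)
  rw [other_other] at n1 n2
  have c1 := hg ((D.other p).succ, false)
  have c2 := hg ((D.other p).castSucc, true)
  rw [n1] at c1
  rw [n2] at c2
  rw [e1, e2, dartSign_rev, dartSign_rev, ← c1, ← c2]
  split_ifs <;> simp [h]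

theorem Compat.mono_iff {g : D.Arc → ℤˣ} {s : D.State} (hg : Compat g s) (p : Fin (2 * D.n)) :
    dartSign g (p.succ, true) = dartSign g (p.castSucc, false) ↔ Mono g (D.word p).1 := by
  unfold Mono
  by_cases hb : (D.word p).2 = true
  · have : D.word.symm ((D.word p).1, true) = p := by
      rw [Equiv.symm_apply_eq, ← hb]
    rw [this]
  · have : D.word.symm ((D.word p).1, true) = D.other p := by
      rw [Equiv.symm_apply_eq, word_other]
      simpa using hb
    rw [this]
    constructor
    · intro h
      rw [(hg.ends_eq h).1, (hg.ends_eq h).2]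
    · intro h
      have := hg.ends_eq h
      rw [other_other] at this
      rw [this.1, this.2]

theorem Compat.site_iff {g : D.Arc → ℤˣ} {s : D.State} (hg : Compat g s) (σ : SourceSink D.n)
    (c : Fin D.n) : dartSign g (site₁ σ c) = dartSign g (site₂ σ c) ↔ Mono g c := by
  have := hg.mono_iff (sourcePassage σ c)
  rw [word_sourcePassage] at this
  rw [← this]
  rcases site_cases σ c with ⟨-, h1, h2⟩ | ⟨-, h1, h2⟩ <;> rw [h1, h2]
  exact eq_comm

/-- Source-sink orientations for which the ends have sign `1` at all crossings with `Mono g`. -/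
noncomputable def positiveSource (g : D.Arc → ℤˣ) : SourceSink D.n where
  source c := decide (g (D.word.symm (c, true)).succ = 1)
  labelAfter _ := true

theorem Compat.dartSign_positiveSource {g : D.Arc → ℤˣ} {s : D.State} (hg : Compat g s) {c : Fin D.n}
    (hc : Mono g c) : dartSign g (site₁ (positiveSource g) c) = 1 ∧
      dartSign g (site₂ (positiveSource g) c) = 1 := by
  have key : dartSign g (site₁ (positiveSource g) c) = 1 := by
    have e := hg.ends_eq hc
    have e' : D.other (D.word.symm (c, true)) = D.word.symm (c, false) := by simp [other]
    rw [e'] at e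
    simp only [site₁, positiveSource]
    by_cases h : g (D.word.symm (c, true)).succ = 1
    · simp [h]
    · have h2 := (Int.units_eq_one_or (g (D.word.symm (c, true)).succ)).resolve_left h
      simp only [h, decide_false, if_true]
      rw [e.1, dartSign_true, h2, neg_neg]
  exact ⟨key, ((hg.site_iff _ c).mpr hc) ▸ key⟩

theorem exists_switch_update (σ : SourceSink D.n) {s : D.State} {c : Fin D.n} (hc : s c = false) :
    ∃ i j, Switch s (Function.update s c true) (site₁ σ c) (site₂ σ c) i j :=
  exists_switch_site_true σ hc rfl

theorem Compat.update {g : D.Arc → ℤˣ} {s : D.State} (hg : Compat g s) {c : Fin D.n}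
    (hm : Mono g c) (b : Bool) : Compat g (Function.update s c b) := by
  obtain ⟨i, j, hsw⟩ := exists_switch_site (positiveSource g) c (s c)
  by_cases hb : b = s c
  · rw [hb, Function.update_eq_self]; exact hg
  · have : b = !s c := by revert hb; cases b <;> cases s c <;> simp
    rw [this]
    exact (hsw s rfl).compat hg ((hg.site_iff _ c).mpr hm)

/-- The signs at the two labelled ends are opposite. On a merge the factor is `1 + (-1)`, and a
split cannot occur, since then both ends would lie on one oriented cycle. -/
theorem crossCoeff_eq_zero {g : D.Arc → ℤˣ} {s : D.State} (hg : Compat g s) {c : Fin D.n}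
    (hc : s c = false) (hm : ¬ Mono g c) (σ : SourceSink D.n) : crossCoeff σ g s c = 0 := by
  rw [← hg.site_iff σ] at hm
  obtain ⟨i, j, hsw⟩ := exists_switch_update σ hc
  unfold crossCoeff edgeCoeff
  by_cases hs : cyc s (site₁ σ c) = cyc s (site₂ σ c)
  · rw [if_neg (not_not.mpr hs), if_neg, mul_zero]
    intro hs'
    exact hm (hg.eq_of_ocyc_eq (hsw.symm.ocyc_eq_of_cyc_ne hs'))
  · have h : dartSign g (site₁ σ c) = -dartSign g (site₂ σ c) := by
      rcases Int.units_eq_one_or (dartSign g (site₁ σ c)) with h1 | h1 <;>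
      rcases Int.units_eq_one_or (dartSign g (site₂ σ c)) with h2 | h2 <;>
      simp_all
    rw [if_pos hs, h]
    push_cast
    have := unit_mul_self (dartSign g (site₂ σ c))
    linear_combination -(edgeSign (site₁ σ c) (site₂ σ c) s (Function.update s c true)) * this

theorem edgeSign_ne_zero (x y : D.Dart) (s s' : D.State) : edgeSign x y s s' ≠ 0 :=
  mul_ne_zero (dartOrderSign_ne_zero x y s) (dartOrderSign_ne_zero x y s')

theorem edgeSign_mul_self (x y : D.Dart) (s s' : D.State) :
    edgeSign x y s s' * edgeSign x y s s' = 1 := by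
  unfold edgeSign
  have h1 := dartOrderSign_mul_self x y s
  have h2 := dartOrderSign_mul_self x y s'
  linear_combination dartOrderSign x y s' * dartOrderSign x y s' * h1 + h2

theorem crossCoeff_ne_zero {g : D.Arc → ℤˣ} {s : D.State} (hg : Compat g s) {c : Fin D.n}
    (hc : s c = false) (hm : Mono g c) (σ : SourceSink D.n) : crossCoeff σ g s c ≠ 0 := by
  rw [← hg.site_iff σ] at hm
  obtain ⟨i, j, hsw⟩ := exists_switch_update σ hc
  unfold crossCoeff edgeCoeff
  refine mul_ne_zero (edgeSign_ne_zero _ _ _ _) ?_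
  by_cases hs : cyc s (site₁ σ c) = cyc s (site₂ σ c)
  · rw [if_neg (not_not.mpr hs), if_pos (hsw.cyc_ne_of_dartSign hg hm hs)]
    exact left_ne_zero_of_mul ((unit_mul_self _).trans_ne one_ne_zero)
  · rw [if_pos hs, hm, unit_mul_self]
    norm_num

/-- The factor is 2 on a merge and 1 on a split. The truncated subtraction encodes this: the
exponent is `2 - 1` on a merge and `0 - 1 = 0` on a split. -/
theorem crossCoeff_positive {g : D.Arc → ℤˣ} {s : D.State} (hg : Compat g s) {c : Fin D.n}
    (hc : s c = false) (hm : Mono g c) :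
    crossCoeff (positiveSource g) g s c =
      edgeSign (site₁ (positiveSource g) c) (site₂ (positiveSource g) c) s
        (Function.update s c true) *
      (2 : ℚ) ^ ((Roots s).card + 1 - (Roots (Function.update s c true)).card - 1) := by
  obtain ⟨h1, h2⟩ := hg.dartSign_positiveSource hm
  obtain ⟨i, j, hsw⟩ := exists_switch_update (positiveSource g) hc
  unfold crossCoeff edgeCoeff
  congr 1
  rw [h1, h2]
  by_cases hs : cyc s (site₁ (positiveSource g) c) = cyc s (site₂ (positiveSource g) c)
  · have hs' := hsw.cyc_ne_of_dartSign hg (h1.trans h2.symm) hs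
    have := hsw.symm.card_Roots hs'
    rw [if_neg (not_not.mpr hs), if_pos hs',
      show (Roots s).card + 1 - (Roots (Function.update s c true)).card - 1 = 0 by omega]
    norm_num
  · have := hsw.card_Roots hs
    rw [if_pos hs,
      show (Roots s).card + 1 - (Roots (Function.update s c true)).card - 1 = 1 by omega]
    norm_num

/-- With source-sink orientations adapted to `g`, the edge signs anticommute by
`Square.prodSign_eq`, and the powers of 2 agree along the two paths. -/
theorem crossCoeff_positive_anticomm {g : D.Arc → ℤˣ} {s : D.State} (hg : Compat g s)
    {c d : Fin D.n} (hcd : c ≠ d) (hc : s c = false) (hd : s d = false) (hmc : Mono g c)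
    (hmd : Mono g d) :
    crossCoeff (positiveSource g) g s c * crossCoeff (positiveSource g) g (Function.update s c true) d =
      -(crossCoeff (positiveSource g) g s d *
        crossCoeff (positiveSource g) g (Function.update s d true) c) := by
  have hgc := hg.update hmc true
  have hgd := hg.update hmd true
  have hdc : Function.update s c true d = false := by rw [Function.update_of_ne hcd.symm, hd]
  have hcd' : Function.update s d true c = false := by rw [Function.update_of_ne hcd, hc]
  have hcomm : Function.update (Function.update s d true) c true =
      Function.update (Function.update s c true) d true := Function.update_comm hcd.symm _ _ _
  obtain ⟨hx, hy⟩ := hg.dartSign_positiveSource hmc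
  obtain ⟨hx', hy'⟩ := hg.dartSign_positiveSource hmd
  obtain ⟨i, j, hsw⟩ := exists_switch_site (positiveSource g) c false
  obtain ⟨i', j', hsw'⟩ := exists_switch_site (positiveSource g) d false
  have q : Square s (Function.update s c true) (Function.update s d true)
      (Function.update (Function.update s c true) d true)
      (site₁ (positiveSource g) c) (site₂ (positiveSource g) c) i j
      (site₁ (positiveSource g) d) (site₂ (positiveSource g) d) i' j' := by
    refine ⟨?_, ?_, ?_, ?_⟩
    · have := hsw s hc
      rwa [update_not_of_false hc] at this
    · have := hsw (Function.update s d true) hcd'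
      rwa [update_not_of_false hcd', hcomm] at this
    · have := hsw' s hd
      rwa [update_not_of_false hd] at this
    · have := hsw' (Function.update s c true) hdc
      rwa [update_not_of_false hdc] at this
  have hp := q.prodSign_eq hg hx hy hx' hy'
  unfold Square.prodSign at hp
  rw [crossCoeff_positive hg hc hmc, crossCoeff_positive hgc hdc hmd, crossCoeff_positive hg hd hmd,
    crossCoeff_positive hgd hcd' hmc, hcomm]
  have card_lem : ∀ {w w' : D.State} {x y i j : D.Dart}, Switch w w' x y i j → Compat g w →
      dartSign g x = dartSign g y →
      (Roots w).card = (Roots w').card + 1 ∨ (Roots w').card = (Roots w).card + 1 := by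
    intro w w' x y i j h hw hxy
    by_cases hs : cyc w x = cyc w y
    · exact Or.inr (h.symm.card_Roots (h.cyc_ne_of_dartSign hw hxy hs)).symm
    · exact Or.inl (h.card_Roots hs).symm
  have c1 := card_lem q.left hg (hx.trans hy.symm)
  have c2 := card_lem q.top hgc (hx'.trans hy'.symm)
  have c3 := card_lem q.bot hg (hx'.trans hy'.symm)
  have c4 := card_lem q.right hgd (hx.trans hy.symm)
  -- The number of merges on a path of two edges is determined by the change in the number of cycles
  -- between its ends.
  have hpow : ((Roots s).card + 1 - (Roots (Function.update s c true)).card - 1) +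
      ((Roots (Function.update s c true)).card + 1 -
        (Roots (Function.update (Function.update s c true) d true)).card - 1) =
      ((Roots s).card + 1 - (Roots (Function.update s d true)).card - 1) +
      ((Roots (Function.update s d true)).card + 1 -
        (Roots (Function.update (Function.update s c true) d true)).card - 1) := by
    omega
  have e3 := edgeSign_mul_self (site₁ (positiveSource g) d) (site₂ (positiveSource g) d) s
    (Function.update s d true)
  have e4 := edgeSign_mul_self (site₁ (positiveSource g) c) (site₂ (positiveSource g) c)
    (Function.update s d true) (Function.update (Function.update s c true) d true)
  have hpow2 := congrArg (fun k => (2 : ℚ) ^ k) hpow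
  simp only [pow_add] at hpow2
  generalize edgeSign (site₁ (positiveSource g) c) (site₂ (positiveSource g) c) s
    (Function.update s c true) = E1 at *
  generalize edgeSign (site₁ (positiveSource g) d) (site₂ (positiveSource g) d)
    (Function.update s c true) (Function.update (Function.update s c true) d true) = E2 at *
  generalize edgeSign (site₁ (positiveSource g) d) (site₂ (positiveSource g) d) s
    (Function.update s d true) = E3 at *
  generalize edgeSign (site₁ (positiveSource g) c) (site₂ (positiveSource g) c)
    (Function.update s d true) (Function.update (Function.update s c true) d true) = E4 at *
  have hE : E1 * E2 = -(E3 * E4) := by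
    linear_combination (E3 * E4) * hp - E1 * E2 * (E4 * E4) * e3 - E1 * E2 * e4
  linear_combination (E1 * E2) * hpow2 + ((2 : ℚ) ^ ((Roots s).card + 1 -
    (Roots (Function.update s d true)).card - 1) * (2 : ℚ) ^ ((Roots (Function.update s d true)).card + 1 -
        (Roots (Function.update (Function.update s c true) d true)).card - 1)) * hE

/-- The scalar is read off from the partial differential of `stateChain`, so the independence of
`partialCoeff` from the choices carries over. This allows the choice to be adapted to each `g`. -/
theorem exists_crossCoeff_eq (σ τ : SourceSink D.n) : ∃ r : Fin D.n → ℤˣ,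
    ∀ (g : D.Arc → ℤˣ) (s : D.State) (c : Fin D.n), Compat g s → s c = false →
      crossCoeff σ g s c = ((r c : ℤ) : ℚ) * crossCoeff τ g s c := by
  obtain ⟨r, hr⟩ := exists_partialCoeff_eq σ τ
  refine ⟨r, fun g s c hg hc => ?_⟩
  have hf := isEigen_stateChain hg
  have h1 := hf.sum_partialCoeff σ hc
  have h2 := hf.sum_partialCoeff τ hc
  rw [stateChain_ones, if_pos rfl, mul_one] at h1 h2
  rw [← h1, ← h2, Finset.mul_sum]
  refine Finset.sum_congr rfl fun t _ => ?_
  rw [hr]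
  ring

/-- The faces of the cube anticommute. -/
theorem crossCoeff_anticomm (σ : SourceSink D.n) {g : D.Arc → ℤˣ} {s : D.State} (hg : Compat g s)
    {c d : Fin D.n} (hcd : c ≠ d) (hc : s c = false) (hd : s d = false) :
    crossCoeff σ g s c * crossCoeff σ g (Function.update s c true) d =
      -(crossCoeff σ g s d * crossCoeff σ g (Function.update s d true) c) := by
  have hdc : Function.update s c true d = false := by rw [Function.update_of_ne hcd.symm, hd]
  have hcd' : Function.update s d true c = false := by rw [Function.update_of_ne hcd, hc]
  by_cases hmc : Mono g c
  · by_cases hmd : Mono g d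
    · obtain ⟨r, hr⟩ := exists_crossCoeff_eq σ (positiveSource g)
      rw [hr g s c hg hc, hr g s d hg hd, hr _ _ _ (hg.update hmc true) hdc,
        hr _ _ _ (hg.update hmd true) hcd']
      linear_combination ((r c : ℤ) : ℚ) * ((r d : ℤ) : ℚ) *
        crossCoeff_positive_anticomm hg hcd hc hd hmc hmd
    · rw [crossCoeff_eq_zero hg hd hmd, crossCoeff_eq_zero (hg.update hmc true) hdc hmd]
      ring
  · rw [crossCoeff_eq_zero hg hc hmc]
    by_cases hmd : Mono g d
    · rw [crossCoeff_eq_zero (hg.update hmd true) hcd' hmc]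
      ring
    · rw [crossCoeff_eq_zero hg hd hmd]
      ring

/-! ### Homology -/

/-- A submodule that is stable under the operators `mulX` is contained in every submodule that
contains its eigenfunctions. -/
theorem le_of_forall_isEigen {V W : Submodule ℚ (EnhancedState D → ℚ)}
    (hV : ∀ u, ∀ f ∈ V, mulX u f ∈ V) (h : ∀ g, ∀ f ∈ V, IsEigen g f → f ∈ W) : V ≤ W := by
  have key : ∀ (k : ℕ) (S : Finset D.Arc) (f : EnhancedState D → ℚ), Sᶜ.card = k → f ∈ V →
      (∀ a ∈ S, ∃ e : ℤˣ, mulX (a, true) f = ((e : ℤ) : ℚ) • f) → f ∈ W := by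
    intro k
    induction k with
    | zero =>
      intro S f hS hf hs
      rw [Finset.card_eq_zero, Finset.compl_eq_empty_iff] at hS
      subst hS
      choose g hg using fun a => hs a (Finset.mem_univ a)
      exact h g f hf (isEigen_iff.mpr hg)
    | succ k ih =>
      intro S f hS hf hs
      obtain ⟨a, ha⟩ : Sᶜ.Nonempty := by
        rw [← Finset.card_pos, hS]
        exact Nat.succ_pos k
      have hcard : (insert a S)ᶜ.card = k := by
        rw [Finset.compl_insert, Finset.card_erase_of_mem ha, hS, Nat.add_sub_cancel]
      -- Up to the factor 1/2 these are the projections to the two eigenspaces of one more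
      -- involution; the old eigenvalues survive because the operators commute.
      have step : ∀ e : ℤˣ, f + ((e : ℤ) : ℚ) • mulX (a, true) f ∈ W := by
        intro e
        refine ih (insert a S) _ hcard (V.add_mem hf (V.smul_mem _ (hV _ _ hf))) ?_
        intro b hb
        rcases Finset.mem_insert.mp hb with rfl | hb
        · refine ⟨e, ?_⟩
          rw [map_add, map_smul, mulX_mulX_self, smul_add, smul_smul, unit_mul_self, one_smul,
            add_comm]
        · obtain ⟨e', he'⟩ := hs b hb
          refine ⟨e', ?_⟩
          rw [map_add, map_smul, mulX_comm, he', map_smul, smul_add, smul_comm]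
      have h2 : f = (1 / 2 : ℚ) • ((f + (((1 : ℤˣ) : ℤ) : ℚ) • mulX (a, true) f) +
          (f + (((-1 : ℤˣ) : ℤ) : ℚ) • mulX (a, true) f)) := by
        funext t
        simp
        ring
      rw [h2]
      exact W.smul_mem _ (W.add_mem (step 1) (step (-1)))
  exact fun f hf => key _ ∅ f rfl hf (by simp)

theorem IsEigen.eq_zero {g : D.Arc → ℤˣ} {f : EnhancedState D → ℚ} (hf : IsEigen g f)
    (h : ∀ s, Compat g s → f (ones s) = 0) : f = 0 :=
  hf.ext (f' := 0) (fun u t => by simp) h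

/-- It suffices to treat eigenfunctions evaluated at the labellings by `1`. There the terms for the
ordered pairs `(c, d)` and `(d, c)` cancel by anticommutation. -/
theorem dmap_dmap (σ : SourceSink D.n) (f : EnhancedState D → ℚ) : dmap σ (dmap σ f) = 0 := by
  have h : (⊤ : Submodule ℚ (EnhancedState D → ℚ)) ≤ LinearMap.ker (dmap σ ∘ₗ dmap σ) := by
    refine le_of_forall_isEigen (fun _ _ _ => trivial) fun g f _ hf => ?_
    rw [LinearMap.mem_ker, LinearMap.comp_apply]
    refine (hf.dmap σ |>.dmap σ).eq_zero fun s _ => ?_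
    rw [(hf.dmap σ).dmap_ones]
    simp_rw [hf.dmap_ones, Finset.mul_sum]
    have e : ∀ c, (if s c = true then ∑ d, crossCoeff σ g (Function.update s c false) c *
        (if Function.update s c false d = true then
          crossCoeff σ g (Function.update (Function.update s c false) d false) d *
            f (ones (Function.update (Function.update s c false) d false)) else 0) else 0) =
        ∑ d, if c ≠ d ∧ s c = true ∧ s d = true then crossCoeff σ g (Function.update s c false) c *
          (crossCoeff σ g (Function.update (Function.update s c false) d false) d *
            f (ones (Function.update (Function.update s c false) d false))) else 0 := by
      intro c
      by_cases hc : s c = true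
      · rw [if_pos hc]
        refine Finset.sum_congr rfl fun d _ => ?_
        by_cases hd : d = c
        · subst hd
          simp
        · rw [Function.update_of_ne hd]
          by_cases hd' : s d = true <;> simp [hd', hc, Ne.symm hd]
      · rw [if_neg hc]
        simp [hc]
    rw [Finset.sum_congr rfl fun c _ => e c, ← Finset.sum_product']
    refine Finset.sum_involution (fun q _ => (q.2, q.1)) ?_ ?_ ?_ ?_
    · rintro ⟨c, d⟩ -
      simp only
      by_cases hh : c ≠ d ∧ s c = true ∧ s d = true
      · obtain ⟨hcd, hc, hd⟩ := hh
        rw [if_pos ⟨hcd, hc, hd⟩, if_pos ⟨hcd.symm, hd, hc⟩]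
        have hcomm : Function.update (Function.update s d false) c false =
            Function.update (Function.update s c false) d false :=
          Function.update_comm hcd.symm _ _ _
        rw [hcomm]
        set r := Function.update (Function.update s c false) d false with hr
        by_cases hcomp : Compat g r
        · have rc : r c = false := by simp [hr, hcd]
          have rd : r d = false := by simp [hr]
          have := crossCoeff_anticomm σ hcomp hcd rc rd
          have e1 : Function.update r c true = Function.update s d false := by
            rw [← hcomm, Function.update_idem, Function.update_eq_self_iff,
              Function.update_of_ne hcd, hc]
          have e2 : Function.update r d true = Function.update s c false := by
            rw [hr, Function.update_idem, Function.update_eq_self_iff,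
              Function.update_of_ne hcd.symm, hd]
          rw [e1, e2] at this
          linear_combination f (ones r) * this
        · rw [hf.eq_zero_of_not_compat (t := ones r) hcomp]
          ring
      · rw [if_neg hh, if_neg, add_zero]
        exact fun h => hh ⟨h.1.symm, h.2.2, h.2.1⟩
    · rintro ⟨c, d⟩ - hne heq
      apply hne
      obtain rfl : d = c := congrArg Prod.fst heq
      simp
    · simp
    · simp
  exact h (Submodule.mem_top : f ∈ ⊤)

/-- The edges in direction `c` are isomorphisms and preserve compatibility, so the cube is the cone
of an isomorphism. The primitive `w` lives on the face with an `A`-smoothing at `c` and inverts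
these edges. -/
theorem IsEigen.exists_dmap_eq {g : D.Arc → ℤˣ} {f : EnhancedState D → ℚ} (hf : IsEigen g f)
    {σ : SourceSink D.n} (h0 : GaussCode.dmap σ f = 0) {c : Fin D.n} (hm : Mono g c) :
    ∃ w, GaussCode.dmap σ w = f := by
  have hw := isEigen_of_forall (g := g) fun s =>
    if s c = false then (crossCoeff σ g s c)⁻¹ * f (ones (Function.update s c true)) else 0
  set w : EnhancedState D → ℚ := _ with hw_def
  replace hw : IsEigen g w := hw
  have hw1 : ∀ s, Compat g s → s c = false →
      w (ones s) = (crossCoeff σ g s c)⁻¹ * f (ones (Function.update s c true)) := by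
    intro s hs hc
    have h1 : Compat g (ones s).1 := hs
    have h2 : (ones s).1 c = false := hc
    change (if Compat g (ones s).1 then _ else _) = _
    rw [if_pos h1, if_pos h2, gchar_ones, one_mul, ones_fst]
  have hw2 : ∀ s, s c = true → w (ones s) = 0 := by
    intro s hc
    have h2 : ¬ (ones s).1 c = false := by simp [hc]
    change (if Compat g (ones s).1 then _ else _) = _
    rw [if_neg h2, mul_zero, ite_self]
  clear_value w
  refine ⟨w, (hw.dmap σ).ext hf fun s' hs' => ?_⟩
  rw [hw.dmap_ones]
  rcases Bool.eq_false_or_eq_true (s' c) with hc | hc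
  · rw [Finset.sum_eq_single c]
    · have hs := hs'.update hm false
      have hc0 : Function.update s' c false c = false := Function.update_self ..
      rw [if_pos hc, hw1 _ hs hc0, mul_inv_cancel_left₀ (crossCoeff_ne_zero hs hc0 hm σ),
        Function.update_idem, ← hc, Function.update_eq_self]
    · intro d _ hd
      rw [hw2, mul_zero, ite_self]
      rw [Function.update_of_ne hd.symm, hc]
    · simp
  -- On the face with an `A`-smoothing at `c`, the equation follows from the cycle condition one
  -- step further in direction `c`, with anticommutation moving the inverted edge past the others.
  · have h1 := congrFun h0 (ones (Function.update s' c true))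
    rw [hf.dmap_ones, Pi.zero_apply, ← Finset.add_sum_erase _ _ (Finset.mem_univ c),
      Function.update_self, if_pos rfl, Function.update_idem,
      show Function.update s' c false = s' by rw [← hc, Function.update_eq_self]] at h1
    rw [← Finset.add_sum_erase _ _ (Finset.mem_univ c), hc, if_neg Bool.false_ne_true, zero_add]
    apply mul_left_cancel₀ (crossCoeff_ne_zero hs' hc hm σ)
    rw [eq_neg_of_add_eq_zero_left h1, Finset.mul_sum, ← Finset.sum_neg_distrib]
    refine Finset.sum_congr rfl fun d hd => ?_
    replace hd : d ≠ c := Finset.ne_of_mem_erase hd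
    rw [Function.update_of_ne hd]
    by_cases hd' : s' d = true
    · rw [if_pos hd', if_pos hd', Function.update_comm hd.symm]
      set r := Function.update s' d false with hr
      have rc : r c = false := by rw [hr, Function.update_of_ne hd.symm, hc]
      have rd : r d = false := Function.update_self ..
      have e2 : Function.update r d true = s' := by
        rw [hr, Function.update_idem, ← hd', Function.update_eq_self]
      by_cases hcomp : Compat g r
      · have h2 := crossCoeff_anticomm σ hcomp hd.symm rc rd
        rw [e2] at h2
        rw [hw1 r hcomp rc]
        have h3 := inv_mul_cancel₀ (crossCoeff_ne_zero hcomp rc hm σ)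
        linear_combination ((crossCoeff σ g r c)⁻¹ * f (ones (Function.update r c true))) * h2 -
          (crossCoeff σ g (Function.update r c true) d * f (ones (Function.update r c true))) * h3
      · have h2 : ¬ Compat g (Function.update r c true) := by
          intro h
          apply hcomp
          have := h.update hm false
          rwa [Function.update_idem, ← rc, Function.update_eq_self] at this
        rw [hw.eq_zero_of_not_compat (t := ones r) hcomp,
          hf.eq_zero_of_not_compat (t := ones (Function.update r c true)) h2]
        ring
    · rw [if_neg hd', if_neg hd']
      ring

/-! ### The canonical generators as a basis of the homology -/

/-- The oriented smoothing. -/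
noncomputable def orientedState (D : GaussCode) : D.State := fun c => decide (D.sign c ≠ 1)

theorem oriented_orientedState (c : Fin D.n) : D.Oriented (orientedState D) c := by
  unfold Oriented orientedState
  simp

theorem compat_const (e : ℤˣ) : Compat (fun _ => e) (orientedState D) := by
  intro x
  rcases dart_cases x with ⟨p, rfl⟩ | ⟨p, rfl⟩ | rfl | rfl
  · rw [next_castSucc_true, if_pos (oriented_orientedState _)]; rfl
  · rw [next_succ_false, if_pos (oriented_orientedState _)]; rfl
  · rw [next_last_true]; rfl
  · rw [next_zero_false]; rfl

theorem dartSign_const_true (e : ℤˣ) (a : D.Arc) : dartSign (fun _ => e) (a, true) = e := rfl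

theorem dartSign_const_false (e : ℤˣ) (a : D.Arc) : dartSign (fun _ => e) (a, false) = -e := rfl

theorem unit_ne_neg (e : ℤˣ) : e ≠ -e := by
  rcases Int.units_eq_one_or e with rfl | rfl <;> decide

/-- A smoothing that does not respect the knot reverses the direction of travel, which a constant
sign forbids. -/
theorem eq_orientedState_of_compat {e : ℤˣ} {s : D.State} (h : Compat (fun _ => e) s) :
    s = orientedState D := by
  funext c
  have h1 := h ((D.word.symm (c, true)).castSucc, true)
  rw [next_castSucc_true, Equiv.apply_symm_apply] at h1
  have h2 : D.Oriented s c := by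
    by_contra h2
    rw [if_neg h2, dartSign_const_false, dartSign_const_true] at h1
    exact unit_ne_neg e h1.symm
  unfold Oriented at h2
  unfold orientedState
  by_cases h3 : D.sign c = 1
  · simp [h3, h2.mpr h3]
  · have : s c ≠ false := fun h => h3 (h2.mp h)
    simp [h3, this]

theorem not_mono_const (e : ℤˣ) (c : Fin D.n) : ¬ Mono (D := D) (fun _ => e) c :=
  unit_ne_neg e

theorem eq_const_of_forall {g : D.Arc → ℤˣ} (h : ∀ p : Fin (2 * D.n), g p.castSucc = g p.succ) :
    g = fun _ => g 0 := by
  funext a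
  induction a using Fin.induction with
  | zero => rfl
  | succ p ih => rw [← h, ih]

/-- If two consecutive arcs carry different signs, the passage between them belongs to a `Mono`
crossing. -/
theorem eq_const_or_exists_mono (g : D.Arc → ℤˣ) {s : D.State} (hs : Compat g s) :
    (∃ e, g = fun _ => e) ∨ ∃ c, Mono g c := by
  by_cases h : ∀ p : Fin (2 * D.n), g p.castSucc = g p.succ
  · exact Or.inl ⟨g 0, eq_const_of_forall h⟩
  · push Not at h
    obtain ⟨p, hp⟩ := h
    refine Or.inr ⟨(D.word p).1, (hs.mono_iff p).mp ?_⟩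
    have h1 : dartSign g (p.castSucc, false) = -g p.castSucc := rfl
    rw [dartSign_true, h1]
    exact Int.units_ne_iff_eq_neg.mp hp.symm

/-- The canonical generators. -/
noncomputable def canonical (D : GaussCode) (e : ℤˣ) : EnhancedState D → ℚ :=
  stateChain (fun _ => e) (orientedState D)

theorem isEigen_canonical (e : ℤˣ) : IsEigen (fun _ => e) (canonical D e) :=
  isEigen_stateChain (compat_const e)

theorem IsEigen.dmap_ones_const {e : ℤˣ} {f : EnhancedState D → ℚ}
    (hf : IsEigen (fun _ => e) f) (σ : SourceSink D.n) (s : D.State) : GaussCode.dmap σ f (ones s) = 0 := by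
  rw [hf.dmap_ones]
  refine Finset.sum_eq_zero fun c _ => ?_
  split_ifs
  · by_cases h : Compat (fun _ => e) (Function.update s c false)
    · rw [crossCoeff_eq_zero h (Function.update_self ..) (not_mono_const e c), zero_mul]
    · rw [hf.eq_zero_of_not_compat (t := ones (Function.update s c false)) h, mul_zero]
  · rfl

theorem IsEigen.dmap_const {e : ℤˣ} {f : EnhancedState D → ℚ}
    (hf : IsEigen (fun _ => e) f) (σ : SourceSink D.n) : GaussCode.dmap σ f = 0 :=
  (hf.dmap σ).eq_zero fun s _ => hf.dmap_ones_const σ s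

theorem IsEigen.eq_smul_canonical {e : ℤˣ} {f : EnhancedState D → ℚ}
    (hf : IsEigen (fun _ => e) f) : f = f (ones (orientedState D)) • canonical D e := by
  refine hf.ext (isEigen_iff.mpr fun a => ?_) fun s hs => ?_
  · rw [map_smul, isEigen_iff.mp (isEigen_canonical e), smul_comm]
  · rw [eq_orientedState_of_compat hs, Pi.smul_apply, canonical, stateChain_ones, if_pos rfl,
      smul_eq_mul, mul_one]

/-- Every cycle is homologous to a combination of the canonical generators. -/
theorem exists_eq_canonical_add (σ : SourceSink D.n) {f : EnhancedState D → ℚ}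
    (hf : dmap σ f = 0) :
    ∃ (a b : ℚ) (w : EnhancedState D → ℚ), f = a • canonical D 1 + b • canonical D (-1) + dmap σ w := by
  have h : LinearMap.ker (dmap σ) ≤
      Submodule.span ℚ {canonical D 1, canonical D (-1)} ⊔ LinearMap.range (dmap σ) := by
    refine le_of_forall_isEigen (fun u f hf => ?_) fun g f hf hg => ?_
    · rw [LinearMap.mem_ker] at hf ⊢
      rw [dmap_mulX, hf, map_zero]
    · by_cases hs : ∃ s, Compat g s
      · obtain ⟨s, hs⟩ := hs
        rcases eq_const_or_exists_mono g hs with ⟨e, rfl⟩ | ⟨c, hc⟩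
        · refine Submodule.mem_sup_left ?_
          rw [hg.eq_smul_canonical]
          refine Submodule.smul_mem _ _ (Submodule.subset_span ?_)
          rcases Int.units_eq_one_or e with rfl | rfl <;> simp
        · exact Submodule.mem_sup_right (hg.exists_dmap_eq (LinearMap.mem_ker.mp hf) hc)
      · have : f = 0 := hg.eq_zero fun s h => absurd ⟨s, h⟩ hs
        rw [this]
        exact Submodule.zero_mem _
  obtain ⟨y, hy, z, ⟨w, rfl⟩, rfl⟩ := Submodule.mem_sup.mp (h (LinearMap.mem_ker.mpr hf))
  obtain ⟨a, b, rfl⟩ := Submodule.mem_span_pair.mp hy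
  exact ⟨a, b, w, rfl⟩

theorem dmap_canonical (σ : SourceSink D.n) (e : ℤˣ) : dmap σ (canonical D e) = 0 :=
  (isEigen_canonical e).dmap_const σ

theorem sum_mulX_mul (u : D.Dart) (f f' : EnhancedState D → ℚ) :
    ∑ t, mulX u f t * f' t = ∑ t, f t * mulX u f' t := by
  rw [← (toggle_bijective u).sum_comp]
  refine Finset.sum_congr rfl fun t _ => ?_
  rw [mulX_apply, mulX_apply, toggle_toggle, toggle_fst]
  ring

theorem IsEigen.sum_mul_eq_zero {g g' : D.Arc → ℤˣ} {f f' : EnhancedState D → ℚ}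
    (hf : IsEigen g f) (hf' : IsEigen g' f') (h : g ≠ g') : ∑ t, f t * f' t = 0 := by
  obtain ⟨a, ha⟩ := Function.ne_iff.mp h
  have h1 := sum_mulX_mul (a, true) f f'
  rw [isEigen_iff.mp hf, isEigen_iff.mp hf'] at h1
  simp only [Pi.smul_apply, smul_eq_mul] at h1
  simp_rw [mul_assoc, mul_left_comm (f _)] at h1
  rw [← Finset.mul_sum, ← Finset.mul_sum, Int.units_ne_iff_eq_neg.mp ha] at h1
  push_cast at h1
  have h2 : ((g' a : ℤ) : ℚ) ≠ 0 := left_ne_zero_of_mul ((unit_mul_self (g' a)).trans_ne one_ne_zero)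
  apply mul_left_cancel₀ h2
  linarith

/-- The operators `mulX` are self-adjoint, so eigenspaces of different `g` are orthogonal, and the
differential vanishes on the eigenspace of a constant sign. Boundaries are thus orthogonal to the
canonical generators, which gives their independence in homology. -/
theorem sum_dmap_mul_canonical (σ : SourceSink D.n) (f : EnhancedState D → ℚ) (e : ℤˣ) :
    ∑ t, dmap σ f t * canonical D e t = 0 := by
  let φ : (EnhancedState D → ℚ) →ₗ[ℚ] ℚ :=
    Fintype.linearCombination ℚ (canonical D e) ∘ₗ dmap σ
  have h : (⊤ : Submodule ℚ (EnhancedState D → ℚ)) ≤ LinearMap.ker φ := by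
    refine le_of_forall_isEigen (fun _ _ _ => trivial) fun g f _ hf => ?_
    change ∑ t, dmap σ f t * canonical D e t = 0
    by_cases hg : g = fun _ => e
    · subst hg
      rw [hf.dmap_const σ]
      simp
    · exact (hf.dmap σ).sum_mul_eq_zero (isEigen_canonical e) hg
  exact h (Submodule.mem_top : f ∈ ⊤)

theorem sum_canonical_mul_self (e : ℤˣ) : ∑ t, canonical D e t * canonical D e t ≠ 0 := by
  refine ne_of_gt (Finset.sum_pos' (fun t _ => mul_self_nonneg _)
    ⟨ones (orientedState D), Finset.mem_univ _, ?_⟩)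
  rw [canonical, stateChain_ones, if_pos rfl]
  norm_num

theorem eq_zero_of_smul_canonical_add_eq {σ : SourceSink D.n} {a b : ℚ} {w : EnhancedState D → ℚ}
    (h : a • canonical D 1 + b • canonical D (-1) = dmap σ w) : a = 0 ∧ b = 0 := by
  have hne : (fun _ => (1 : ℤˣ) : D.Arc → ℤˣ) ≠ fun _ => -1 := fun h =>
    absurd (congrFun h 0) (by decide)
  have key : ∀ e, a * ∑ t, canonical D 1 t * canonical D e t +
      b * ∑ t, canonical D (-1) t * canonical D e t = 0 := by
    intro e
    have := sum_dmap_mul_canonical σ w e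
    rw [← h] at this
    simp only [Pi.add_apply, Pi.smul_apply, smul_eq_mul, add_mul, Finset.sum_add_distrib,
      mul_assoc, ← Finset.mul_sum] at this
    exact this
  have k1 := key 1
  have k2 := key (-1)
  rw [(isEigen_canonical (-1)).sum_mul_eq_zero (isEigen_canonical 1) hne.symm, mul_zero,
    add_zero] at k1
  rw [(isEigen_canonical 1).sum_mul_eq_zero (isEigen_canonical (-1)) hne, mul_zero,
    zero_add] at k2
  exact ⟨(mul_eq_zero.mp k1).resolve_right (sum_canonical_mul_self 1),
    (mul_eq_zero.mp k2).resolve_right (sum_canonical_mul_self (-1))⟩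

/-! ### The quantum degree -/

/-- The contribution of a label to the quantum degree. -/
def labelWeight (b : Bool) : ℤ := if b = true then -1 else 1

/-- The number of labels `1` minus the number of labels `X`. -/
noncomputable def weight (t : EnhancedState D) : ℤ :=
  ∑ a ∈ Roots t.1, labelWeight (label t (a, true))

theorem qDegree_eq (t : EnhancedState D) :
    qDegree t = ((Finset.univ.filter fun c => t.1 c = true).card : ℤ) + weight t +
      (D.nPos : ℤ) - 2 * (D.nNeg : ℤ) := by
  have h := sum_cycle_eq_sum_Roots t.1 fun z => labelWeight (t.2 z)
  unfold weight label
  rw [← h]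
  have h2 : ∑ z, labelWeight (t.2 z) = ((Finset.univ.filter fun z => t.2 z = false).card : ℤ)
      - ((Finset.univ.filter fun z => t.2 z = true).card : ℤ) := by
    unfold labelWeight
    rw [Finset.sum_ite]
    simp
    ring
  rw [h2]
  unfold qDegree
  ring

theorem Switch.weight_eq {t t' : EnhancedState D} {x y i j : D.Dart}
    (h : Switch t.1 t'.1 x y i j) (hs : cyc t.1 x ≠ cyc t.1 y)
    (hl : ∀ u, ¬ Touch t.1 t'.1 x y u → label t' u = label t u) :
    weight t - labelWeight (label t x) - labelWeight (label t y) =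
      weight t' - labelWeight (label t' x) := by
  have hne : rt t.1 x ≠ rt t.1 y := fun e => hs (rt_eq_iff.mp e)
  have hmin : rt t'.1 x = min (rt t.1 x) (rt t.1 y) := h.rt_of_touch hs (touch_left _ _ _ _)
  have hset : (Roots t'.1).erase (rt t'.1 x) = ((Roots t.1).erase (rt t.1 x)).erase (rt t.1 y) := by
    rw [h.Roots_eq hs, hmin]
    rcases le_total (rt t.1 x) (rt t.1 y) with hle | hle
    · rw [max_eq_right hle, min_eq_left hle, Finset.erase_right_comm]
    · rw [max_eq_left hle, min_eq_right hle]
  have h1 : weight t = labelWeight (label t x) + (labelWeight (label t y) +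
      ∑ a ∈ ((Roots t.1).erase (rt t.1 x)).erase (rt t.1 y), labelWeight (label t (a, true))) := by
    unfold weight
    rw [← Finset.add_sum_erase _ _ (rt_mem_Roots t.1 x), ← Finset.add_sum_erase _ _
      (Finset.mem_erase.mpr ⟨hne.symm, rt_mem_Roots t.1 y⟩),
      label_congr rfl (cyc_rt t.1 x), label_congr rfl (cyc_rt t.1 y)]
  have h2 : weight t' = labelWeight (label t' x) +
      ∑ a ∈ (Roots t'.1).erase (rt t'.1 x), labelWeight (label t' (a, true)) := by
    unfold weight
    rw [← Finset.add_sum_erase _ _ (rt_mem_Roots t'.1 x), label_congr rfl (cyc_rt t'.1 x)]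
  rw [h1, h2, hset]
  have h3 : ∀ a ∈ ((Roots t.1).erase (rt t.1 x)).erase (rt t.1 y),
      labelWeight (label t' (a, true)) = labelWeight (label t (a, true)) := by
    intro a ha
    rw [Finset.mem_erase, Finset.mem_erase] at ha
    rw [hl]
    rw [h.touch_iff, cyc_eq_iff_of_mem_Roots ha.2.2, cyc_eq_iff_of_mem_Roots ha.2.2]
    exact not_or.mpr ⟨ha.2.1, ha.1⟩
  rw [Finset.sum_congr rfl h3]
  ring

theorem card_update_true {s : D.State} {c : Fin D.n} (hc : s c = false) :
    (Finset.univ.filter fun d => Function.update s c true d = true).card =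
      (Finset.univ.filter fun d => s d = true).card + 1 := by
  have : (Finset.univ.filter fun d => Function.update s c true d = true) =
      insert c (Finset.univ.filter fun d => s d = true) := by
    ext d
    by_cases hd : d = c <;> simp [hd]
  rw [this, Finset.card_insert_of_notMem]
  simp [hc]

/-- The differential preserves the quantum degree modulo 4. -/
theorem four_dvd_of_partialCoeff_ne_zero {σ : SourceSink D.n} {c : Fin D.n}
    {t t' : EnhancedState D} (h : partialCoeff σ c t t' ≠ 0) :
    (4 : ℤ) ∣ qDegree t' - qDegree t := by
  rw [partialCoeff_eq] at h
  unfold dartPartial at h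
  by_cases hadj : DartAdjacent (site₁ σ c) (site₂ σ c) c t t'
  swap
  · rw [if_neg hadj] at h
    exact absurd rfl h
  rw [if_pos hadj] at h
  obtain ⟨h1, h2, h3⟩ := hadj
  have hl := right_ne_zero_of_mul h
  rw [dartLocalCoeff_eq] at hl
  unfold localForm at hl
  obtain ⟨i, j, hsw⟩ := exists_switch_site_true σ h1 h2
  have hlab : ∀ u, ¬ Touch t.1 t'.1 (site₁ σ c) (site₂ σ c) u → label t' u = label t u := by
    intro u hu
    rw [hsw.touch_iff, not_or] at hu
    exact h3 u hu.1 hu.2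
  rw [qDegree_eq, qDegree_eq]
  have hcard : (Finset.univ.filter fun d => t'.1 d = true).card =
      (Finset.univ.filter fun d => t.1 d = true).card + 1 := by
    rw [h2, card_update_true h1]
  rw [hcard]
  push_cast
  -- The new `B`-smoothing contributes 1. The label weight falls by 1, except for `X · X = 1` and
  -- the term `1 ⊗ 1` of `Δ(X)`, where it rises by 3; the total is 0 or 4.
  by_cases hs : cyc t.1 (site₁ σ c) = cyc t.1 (site₂ σ c)
  · rw [if_neg (not_not.mpr hs)] at hl
    by_cases hs' : cyc t'.1 (site₁ σ c) = cyc t'.1 (site₂ σ c)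
    · rw [if_neg (not_not.mpr hs')] at hl
      exact absurd rfl hl
    rw [if_pos hs'] at hl
    have hw := hsw.symm.weight_eq hs' fun u hu => (hlab u fun h => hu h.symm).symm
    have hc := right_ne_zero_of_mul hl
    generalize label t (site₁ σ c) = a at *
    generalize label t' (site₁ σ c) = b at *
    generalize label t' (site₂ σ c) = d at *
    cases a <;> cases b <;> cases d <;> simp [comulCoeff, labelWeight] at hc hw <;> omega
  · rw [if_pos hs] at hl
    have hw := hsw.weight_eq hs hlab
    have hc := right_ne_zero_of_mul hl
    generalize label t (site₁ σ c) = a at *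
    generalize label t (site₂ σ c) = b at *
    generalize label t' (site₁ σ c) = d at *
    cases a <;> cases b <;> cases d <;> simp [mulCoeff, labelWeight] at hc hw <;> omega

theorem weight_toggle (u : D.Dart) (t : EnhancedState D) :
    weight (toggle u t) = weight t - 2 * labelWeight (label t u) := by
  unfold weight
  rw [toggle_fst, ← Finset.add_sum_erase _ _ (rt_mem_Roots t.1 u),
    ← Finset.add_sum_erase _ _ (rt_mem_Roots t.1 u)]
  have h1 : label (toggle u t) (rt t.1 u, true) = !label t u := by
    rw [label_toggle, if_pos (cyc_rt _ _), label_congr rfl (cyc_rt t.1 u)]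
  have h2 : ∀ a ∈ (Roots t.1).erase (rt t.1 u),
      labelWeight (label (toggle u t) (a, true)) = labelWeight (label t (a, true)) := by
    intro a ha
    rw [Finset.mem_erase] at ha
    have h3 : ¬ cyc t.1 (a, true) = cyc t.1 u := by
      rw [cyc_eq_iff_of_mem_Roots ha.2]
      exact ha.1
    rw [label_toggle, if_neg h3]
  rw [h1, Finset.sum_congr rfl h2, label_congr rfl (cyc_rt t.1 u)]
  cases label t u <;> simp [labelWeight] <;> ring

theorem qDegree_toggle_le (u : D.Dart) (t : EnhancedState D) :
    qDegree (toggle u t) ≤ qDegree t + 2 := by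
  rw [qDegree_eq, qDegree_eq, weight_toggle, toggle_fst]
  cases label t u <;> norm_num [labelWeight] <;> omega

/-! ### The filtration -/

/-- The functions supported in quantum degree at least `j`. -/
def degreeGE (D : GaussCode) (j : ℤ) : Submodule ℚ (EnhancedState D → ℚ) where
  carrier := {f | ∀ t, f t ≠ 0 → j ≤ qDegree t}
  add_mem' {f f'} hf hf' t ht := by
    by_cases h : f t = 0
    · refine hf' t fun h' => ht ?_
      rw [Pi.add_apply, h, h', add_zero]
    · exact hf t h
  zero_mem' t ht := absurd rfl ht
  smul_mem' r f hf t ht := hf t (right_ne_zero_of_mul ht)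

theorem mem_degreeGE {j : ℤ} {f : EnhancedState D → ℚ} :
    f ∈ degreeGE D j ↔ ∀ t, f t ≠ 0 → j ≤ qDegree t := Iff.rfl

theorem degreeGE_anti {j k : ℤ} (h : j ≤ k) : degreeGE D k ≤ degreeGE D j :=
  fun _ hf t ht => h.trans (hf t ht)

/-- The functions that are homologous to a function in quantum degree at least `j`. -/
noncomputable def homologousGE (σ : SourceSink D.n) (j : ℤ) : Submodule ℚ (EnhancedState D → ℚ) :=
  degreeGE D j ⊔ LinearMap.range (dmap σ)

theorem mem_homologousGE {σ : SourceSink D.n} {j : ℤ} {f : EnhancedState D → ℚ} :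
    f ∈ homologousGE σ j ↔ ∃ f' ∈ degreeGE D j, ∃ w, f = f' + dmap σ w := by
  unfold homologousGE
  rw [Submodule.mem_sup]
  constructor
  · rintro ⟨y, hy, z, ⟨w, rfl⟩, rfl⟩
    exact ⟨y, hy, w, rfl⟩
  · rintro ⟨y, hy, w, rfl⟩
    exact ⟨y, hy, _, ⟨w, rfl⟩, rfl⟩

theorem homologousGE_anti (σ : SourceSink D.n) {j k : ℤ} (h : j ≤ k) :
    homologousGE σ k ≤ homologousGE σ j :=
  sup_le_sup_right (degreeGE_anti h) _

theorem differential_apply (σ : SourceSink D.n) (x : Chain D) :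
    ⇑(D.differential σ x) = dmap σ ⇑x := by
  funext t'
  unfold differential
  rw [Finsupp.linearCombination_apply, Finsupp.sum_fintype _ _ (fun t => by simp),
    Finsupp.finsetSum_apply, dmap_apply, Finset.sum_comm]
  refine Finset.sum_congr rfl fun t _ => ?_
  rw [Finsupp.smul_apply, Finsupp.equivFunOnFinite_symm_apply_apply, smul_eq_mul, Finset.mul_sum]

theorem mem_filtration {j : ℤ} {x : Chain D} : x ∈ filtration D j ↔ ⇑x ∈ degreeGE D j := by
  unfold filtration
  rw [Finsupp.mem_supported, mem_degreeGE]
  constructor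
  · intro h t ht
    exact h (Finsupp.mem_support_iff.mpr ht)
  · intro h t ht
    exact h t (Finsupp.mem_support_iff.mp ht)

theorem mkQ_mem_homologyFiltration (σ : SourceSink D.n) (j : ℤ)
    (x : LinearMap.ker (D.differential σ)) :
    (Submodule.mkQ _ x : D.Homology σ) ∈ D.homologyFiltration σ j ↔
      ⇑(x : Chain D) ∈ homologousGE σ j := by
  unfold homologyFiltration
  rw [mem_homologousGE, Submodule.mem_map]
  constructor
  · rintro ⟨y, hy, hxy⟩
    rw [Submodule.mkQ_apply, Submodule.mkQ_apply, Submodule.Quotient.eq] at hxy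
    obtain ⟨w, hw⟩ : (y - x : Chain D) ∈ LinearMap.range (D.differential σ) := hxy
    refine ⟨⇑(y : Chain D), mem_filtration.mp hy, -⇑w, ?_⟩
    rw [map_neg, ← differential_apply, hw]
    funext t
    simp
  · rintro ⟨f, hf, w, hw⟩
    let F : Chain D := Finsupp.equivFunOnFinite.symm f
    let W : Chain D := Finsupp.equivFunOnFinite.symm w
    have hx : (x : Chain D) = F + D.differential σ W := by
      apply DFunLike.coe_injective
      rw [Finsupp.coe_add, differential_apply]
      exact hw
    -- Since the differential squares to zero, a representative modulo boundaries is automatically a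
    -- cycle, although `homologousGE` does not ask for it.
    have hF : F ∈ LinearMap.ker (D.differential σ) := by
      have h1 : F = x - D.differential σ W := by rw [hx, add_sub_cancel_right]
      rw [LinearMap.mem_ker, h1, map_sub, LinearMap.mem_ker.mp x.2, zero_sub, neg_eq_zero]
      apply DFunLike.coe_injective
      rw [differential_apply, differential_apply, dmap_dmap]
      rfl
    refine ⟨⟨F, hF⟩, mem_filtration.mpr hf, ?_⟩
    rw [Submodule.mkQ_apply, Submodule.mkQ_apply, Submodule.Quotient.eq]
    change F - x ∈ LinearMap.range (D.differential σ)
    refine ⟨-W, ?_⟩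
    rw [map_neg, hx]
    abel

theorem mem_levels {σ : SourceSink D.n} {j : ℤ} : j ∈ D.levels σ ↔
    ∃ f, dmap σ f = 0 ∧ f ∈ homologousGE σ j ∧ f ∉ homologousGE σ (j + 1) := by
  constructor
  · rintro ⟨z, h1, h2⟩
    obtain ⟨x, rfl⟩ := Submodule.mkQ_surjective _ z
    rw [mkQ_mem_homologyFiltration] at h1 h2
    refine ⟨_, ?_, h1, h2⟩
    rw [← differential_apply, LinearMap.mem_ker.mp x.2]
    rfl
  · rintro ⟨f, h0, h1, h2⟩
    have hx : (Finsupp.equivFunOnFinite.symm f : Chain D) ∈ LinearMap.ker (D.differential σ) := by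
      rw [LinearMap.mem_ker]
      apply DFunLike.coe_injective
      rw [differential_apply]
      exact h0
    exact ⟨Submodule.mkQ _ ⟨_, hx⟩, (mkQ_mem_homologyFiltration σ j ⟨_, hx⟩).mpr h1,
      fun h => h2 ((mkQ_mem_homologyFiltration σ _ ⟨_, hx⟩).mp h)⟩

/-! ### Filtration levels -/

/-- The part of a function in the quantum degrees congruent to `r` modulo 4. -/
noncomputable def residuePart (r : ℤ) :
    (EnhancedState D → ℚ) →ₗ[ℚ] (EnhancedState D → ℚ) where
  toFun f t := if (4 : ℤ) ∣ qDegree t - r then f t else 0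
  map_add' f f' := by
    funext t
    simp only [Pi.add_apply]
    split_ifs <;> simp
  map_smul' a f := by
    funext t
    simp only [Pi.smul_apply, RingHom.id_apply]
    split_ifs <;> simp

theorem residuePart_apply (r : ℤ) (f : EnhancedState D → ℚ) (t : EnhancedState D) :
    residuePart r f t = if (4 : ℤ) ∣ qDegree t - r then f t else 0 := rfl

theorem dmap_residuePart (σ : SourceSink D.n) (r : ℤ) (f : EnhancedState D → ℚ) :
    dmap σ (residuePart r f) = residuePart r (dmap σ f) := by
  funext t'
  rw [residuePart_apply, dmap_apply, dmap_apply]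
  rw [← mul_boole, Finset.sum_mul]
  refine Finset.sum_congr rfl fun c _ => ?_
  rw [Finset.sum_mul]
  refine Finset.sum_congr rfl fun t _ => ?_
  by_cases h : partialCoeff σ c t t' = 0
  · rw [h, mul_zero, mul_zero, zero_mul]
  · have h4 := four_dvd_of_partialCoeff_ne_zero h
    have h5 : (4 : ℤ) ∣ qDegree t - r ↔ (4 : ℤ) ∣ qDegree t' - r := by omega
    rw [residuePart_apply]
    by_cases h6 : (4 : ℤ) ∣ qDegree t - r
    · rw [if_pos h6, if_pos (h5.mp h6), mul_one]
    · rw [if_neg h6, if_neg fun h => h6 (h5.mpr h), zero_mul, mul_zero]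

theorem residuePart_mem_degreeGE (r : ℤ) {j : ℤ} {f : EnhancedState D → ℚ}
    (hf : f ∈ degreeGE D j) : residuePart r f ∈ degreeGE D j := by
  intro t ht
  refine hf t fun h => ht ?_
  rw [residuePart_apply, h, ite_self]

theorem residuePart_mem_homologousGE (r : ℤ) {σ : SourceSink D.n} {j : ℤ}
    {f : EnhancedState D → ℚ} (hf : f ∈ homologousGE σ j) :
    residuePart r f ∈ homologousGE σ j := by
  obtain ⟨f', hf', w, rfl⟩ := mem_homologousGE.mp hf
  exact mem_homologousGE.mpr ⟨residuePart r f', residuePart_mem_degreeGE r hf', residuePart r w, by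
    rw [map_add, dmap_residuePart]⟩

theorem mulX_mem_homologousGE (u : D.Dart) {σ : SourceSink D.n} {j : ℤ}
    {f : EnhancedState D → ℚ} (hf : f ∈ homologousGE σ j) :
    mulX u f ∈ homologousGE σ (j - 2) := by
  obtain ⟨f', hf', w, rfl⟩ := mem_homologousGE.mp hf
  refine mem_homologousGE.mpr ⟨mulX u f', fun t ht => ?_, mulX u w, by rw [map_add, dmap_mulX]⟩
  have h1 := hf' _ (right_ne_zero_of_mul ht)
  have h2 := qDegree_toggle_le u t
  omega

/-- Only finitely many degrees occur; beyond the highest one `homologousGE` consists of the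
boundaries alone. -/
theorem exists_level {σ : SourceSink D.n} {f : EnhancedState D → ℚ}
    (hf : f ∉ LinearMap.range (dmap σ)) : ∃ ℓ, ∀ j, f ∈ homologousGE σ j ↔ j ≤ ℓ := by
  have hfin : (Set.range (qDegree : EnhancedState D → ℤ)).Finite := Set.finite_range _
  obtain ⟨a, ha⟩ := hfin.bddBelow
  obtain ⟨b, hb⟩ := hfin.bddAbove
  obtain ⟨ℓ, h1, h2⟩ := Int.exists_greatest_of_bdd (P := fun j => f ∈ homologousGE σ j)
    ⟨b, fun j hj => by
      by_contra hlt
      obtain ⟨f', hf', w, rfl⟩ := mem_homologousGE.mp hj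
      have : f' = 0 := by
        funext t
        by_contra ht
        have h3 := hf' t ht
        have h4 := hb (Set.mem_range_self t)
        omega
      rw [this, zero_add] at hf
      exact hf ⟨w, rfl⟩⟩
    ⟨a, mem_homologousGE.mpr ⟨f, fun t _ => ha (Set.mem_range_self t), 0, by simp⟩⟩
  exact ⟨ℓ, fun j => ⟨h2 j, fun h => homologousGE_anti σ h h1⟩⟩

/-- Project a representative in degree at least `ℓ` to the residue class `r`. If `ℓ` is not in this
class, the projection already lies in degree at least `ℓ + 1`. -/
theorem four_dvd_level {σ : SourceSink D.n} {f : EnhancedState D → ℚ} {r ℓ : ℤ}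
    (hr : residuePart r f = f) (hℓ : ∀ j, f ∈ homologousGE σ j ↔ j ≤ ℓ) : (4 : ℤ) ∣ ℓ - r := by
  by_contra h
  have h1 := (hℓ ℓ).mpr le_rfl
  obtain ⟨f', hf', w, hw⟩ := mem_homologousGE.mp h1
  have h2 : f ∈ homologousGE σ (ℓ + 1) := by
    refine mem_homologousGE.mpr ⟨residuePart r f', fun t ht => ?_, residuePart r w, ?_⟩
    · rw [residuePart_apply] at ht
      split_ifs at ht with h4
      · have := hf' t ht
        have : qDegree t ≠ ℓ := fun e => h (e ▸ h4)
        omega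
      · exact absurd rfl ht
    · rw [dmap_residuePart, ← map_add, ← hw, hr]
  have := (hℓ (ℓ + 1)).mp h2
  omega

/-- The sum or the difference of the canonical generators. -/
noncomputable def parityChain (D : GaussCode) (e : ℤˣ) : EnhancedState D → ℚ :=
  canonical D 1 + ((e : ℤ) : ℚ) • canonical D (-1)

theorem gchar_const (e : ℤˣ) (t : EnhancedState D) : gchar (fun _ => e) t =
    ((e : ℤ) : ℚ) ^ ((Roots t.1).filter fun a => label t (a, true) = true).card := by
  unfold gchar
  rw [Finset.prod_ite, Finset.prod_const, Finset.prod_const_one, mul_one]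

theorem weight_add (t : EnhancedState D) : weight t +
    2 * (((Roots t.1).filter fun a => label t (a, true) = true).card : ℤ) =
      weight (ones t.1) := by
  unfold weight
  rw [Finset.card_filter, Nat.cast_sum, Finset.mul_sum, ← Finset.sum_add_distrib, ones_fst]
  refine Finset.sum_congr rfl fun a _ => ?_
  rw [label_ones]
  cases label t (a, true) <;> simp [labelWeight]

/-- The residue modulo 4 of the quantum degrees in the support of `parityChain`. -/
noncomputable def parityResidue (D : GaussCode) (e : ℤˣ) : ℤ :=
  qDegree (ones (orientedState D)) + (e - 1)

/-- On a labelling with `m` labels `X` the value is `1 + e * (-1) ^ m`, while the quantum degree has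
dropped by `2 * m`; the parity of `m` fixes the residue. -/
theorem residuePart_parityChain (e : ℤˣ) :
    residuePart (parityResidue D e) (parityChain D e) = parityChain D e := by
  funext t
  rw [residuePart_apply, ite_eq_left_iff]
  intro h
  symm
  unfold parityChain canonical stateChain
  rw [Pi.add_apply, Pi.smul_apply, smul_eq_mul]
  by_cases hs : t.1 = orientedState D
  swap
  · rw [if_neg hs, if_neg hs, mul_zero, add_zero]
  rw [if_pos hs, if_pos hs, gchar_const, gchar_const]
  have hw := weight_add t
  set m := ((Roots t.1).filter fun a => label t (a, true) = true).card
  have hq : qDegree t = qDegree (ones (orientedState D)) - 2 * m := by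
    rw [← hs, qDegree_eq, qDegree_eq, ← hw, ones_fst]
    ring
  unfold parityResidue at h
  rw [hq] at h
  rcases Nat.even_or_odd m with hm | hm
  · rcases Int.units_eq_one_or e with rfl | rfl
    · exact absurd (by obtain ⟨k, hk⟩ := hm; push_cast; omega) h
    · simp [hm.neg_one_pow]
  · rcases Int.units_eq_one_or e with rfl | rfl
    · simp [hm.neg_one_pow]
    · exact absurd (by obtain ⟨k, hk⟩ := hm; push_cast; omega) h

theorem residuePart_parityChain_neg (e : ℤˣ) :
    residuePart (parityResidue D e) (parityChain D (-e)) = 0 := by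
  rw [← residuePart_parityChain (-e)]
  funext t
  rw [residuePart_apply, residuePart_apply, Pi.zero_apply, ite_eq_right_iff]
  intro h
  rw [if_neg]
  intro h'
  unfold parityResidue at h h'
  rcases Int.units_eq_one_or e with rfl | rfl <;> push_cast at h h' <;> omega

theorem dmap_parityChain (σ : SourceSink D.n) (e : ℤˣ) : dmap σ (parityChain D e) = 0 := by
  unfold parityChain
  rw [map_add, map_smul, dmap_canonical, dmap_canonical, smul_zero, add_zero]

theorem mulX_parityChain (e : ℤˣ) :
    mulX ((0 : D.Arc), true) (parityChain D e) = parityChain D (-e) := by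
  unfold parityChain
  rw [map_add, map_smul, isEigen_iff.mp (isEigen_canonical 1),
    isEigen_iff.mp (isEigen_canonical (-1)), smul_smul]
  push_cast
  simp

theorem parityChain_notMem_range (σ : SourceSink D.n) (e : ℤˣ) :
    parityChain D e ∉ LinearMap.range (dmap σ) := by
  rintro ⟨w, hw⟩
  have h : (1 : ℚ) • canonical D 1 + ((e : ℤ) : ℚ) • canonical D (-1) = dmap σ w := by
    rw [hw, one_smul, parityChain]
  exact one_ne_zero (eq_zero_of_smul_canonical_add_eq h).1

theorem exists_eq_parityChain_add (σ : SourceSink D.n) {f : EnhancedState D → ℚ}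
    (hf : dmap σ f = 0) : ∃ (a : ℤˣ → ℚ) (w : EnhancedState D → ℚ),
      f = a 1 • parityChain D 1 + a (-1) • parityChain D (-1) + dmap σ w := by
  obtain ⟨a, b, w, rfl⟩ := exists_eq_canonical_add σ hf
  refine ⟨fun e => (a + ((e : ℤ) : ℚ) * b) / 2, w, ?_⟩
  congr 1
  unfold parityChain
  funext t
  simp only [Pi.add_apply, Pi.smul_apply, smul_eq_mul]
  push_cast
  ring

theorem range_le_homologousGE (σ : SourceSink D.n) (j : ℤ) :
    LinearMap.range (dmap σ) ≤ homologousGE σ j := le_sup_right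

/-- The projection to a residue class modulo 4 respects boundaries and filtration and isolates one
of the two summands. The level of a combination is therefore the minimum over the summands that
occur. -/
theorem smul_parityChain_mem {σ : SourceSink D.n} {a : ℤˣ → ℚ} {j : ℤ} {w : EnhancedState D → ℚ}
    (h : a 1 • parityChain D 1 + a (-1) • parityChain D (-1) + dmap σ w ∈ homologousGE σ j)
    {e : ℤˣ} (he : a e ≠ 0) : parityChain D e ∈ homologousGE σ j := by
  replace h := (Submodule.add_mem_iff_left _ (range_le_homologousGE σ j ⟨w, rfl⟩)).mp h
  replace h := residuePart_mem_homologousGE (parityResidue D e) h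
  have h1 : residuePart (parityResidue D e)
      (a 1 • parityChain D 1 + a (-1) • parityChain D (-1)) = a e • parityChain D e := by
    rw [map_add, map_smul, map_smul]
    rcases Int.units_eq_one_or e with rfl | rfl
    · rw [residuePart_parityChain, residuePart_parityChain_neg, smul_zero, add_zero]
    · have := residuePart_parityChain_neg (D := D) (-1)
      rw [neg_neg] at this
      rw [residuePart_parityChain, this, smul_zero, zero_add]
  rw [h1] at h
  exact (Submodule.smul_mem_iff _ he).mp h

/-- There are two filtration levels, and their difference is 2. -/
theorem exists_levels_eq (σ : SourceSink D.n) : ∃ m : ℤ, D.levels σ = {m, m + 2} ∧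
    (∀ j, (∀ f, dmap σ f = 0 → f ∈ homologousGE σ j) ↔ j ≤ m) ∧
    ∀ j, (∃ f, dmap σ f = 0 ∧ f ∈ homologousGE σ j ∧ f ∉ LinearMap.range (dmap σ)) ↔
      j ≤ m + 2 := by
  choose ℓ hℓ using fun e => exists_level (parityChain_notMem_range (D := D) σ e)
  have hres := fun e => four_dvd_level (residuePart_parityChain e) (hℓ e)
  -- Multiplication by `X` at the base point exchanges the two classes and lowers the filtration by
  -- at most 2.
  have hdiff : ∀ e, ℓ e - 2 ≤ ℓ (-e) := by
    intro e
    have := mulX_mem_homologousGE ((0 : D.Arc), true) ((hℓ e _).mpr le_rfl)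
    rwa [mulX_parityChain, hℓ] at this
  have hall : ∀ j, (∀ f, dmap σ f = 0 → f ∈ homologousGE σ j) ↔ ∀ e, j ≤ ℓ e := by
    intro j
    constructor
    · intro h e
      exact (hℓ e j).mp (h _ (dmap_parityChain σ e))
    · intro h f hf
      obtain ⟨a, w, rfl⟩ := exists_eq_parityChain_add σ hf
      exact Submodule.add_mem _ (Submodule.add_mem _ (Submodule.smul_mem _ _ ((hℓ _ _).mpr (h _)))
        (Submodule.smul_mem _ _ ((hℓ _ _).mpr (h _)))) (range_le_homologousGE σ j ⟨w, rfl⟩)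
  have hex : ∀ j, (∃ f, dmap σ f = 0 ∧ f ∈ homologousGE σ j ∧ f ∉ LinearMap.range (dmap σ)) ↔
      ∃ e, j ≤ ℓ e := by
    intro j
    constructor
    · rintro ⟨f, hf, hj, hr⟩
      obtain ⟨a, w, rfl⟩ := exists_eq_parityChain_add σ hf
      by_contra hne
      push Not at hne
      have hz : ∀ e, a e = 0 := by
        intro e
        by_contra he
        have := (hℓ e j).mp (smul_parityChain_mem hj he)
        exact absurd this (not_le.mpr (hne e))
      apply hr
      rw [hz, hz, zero_smul, zero_smul, add_zero, zero_add]
      exact ⟨w, rfl⟩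
    · rintro ⟨e, he⟩
      exact ⟨_, dmap_parityChain σ e, (hℓ e j).mpr he, parityChain_notMem_range σ e⟩
  have hlev : ∀ j, j ∈ D.levels σ ↔ ∃ e, j = ℓ e := by
    intro j
    rw [mem_levels]
    constructor
    · rintro ⟨f, hf, hj, hj'⟩
      obtain ⟨a, w, rfl⟩ := exists_eq_parityChain_add σ hf
      by_contra hne
      push Not at hne
      apply hj'
      have hz : ∀ e, a e • parityChain D e ∈ homologousGE σ (j + 1) := by
        intro e
        by_cases he : a e = 0
        · rw [he, zero_smul]
          exact Submodule.zero_mem _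
        · have h1 := (hℓ e j).mp (smul_parityChain_mem hj he)
          exact Submodule.smul_mem _ _ ((hℓ e _).mpr (lt_of_le_of_ne h1 (hne e)))
      exact Submodule.add_mem _ (Submodule.add_mem _ (hz _) (hz _))
        (range_le_homologousGE σ _ ⟨w, rfl⟩)
    · rintro ⟨e, rfl⟩
      refine ⟨_, dmap_parityChain σ e, (hℓ e _).mpr le_rfl, fun h => ?_⟩
      have := (hℓ e _).mp h
      omega
  -- The two levels differ by 2 modulo 4 and by at most 2 in absolute value, hence by exactly 2.
  have h1 := hres 1
  have h2 := hres (-1)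
  have h3 := hdiff 1
  have h4 := hdiff (-1)
  rw [neg_neg] at h4
  unfold parityResidue at h1 h2
  push_cast at h1 h2
  have hforall : ∀ p : ℤˣ → Prop, (∀ e, p e) ↔ p 1 ∧ p (-1) := fun p =>
    ⟨fun h => ⟨h _, h _⟩, fun h e => by
      rcases Int.units_eq_one_or e with rfl | rfl
      exacts [h.1, h.2]⟩
  have hexists : ∀ p : ℤˣ → Prop, (∃ e, p e) ↔ p 1 ∨ p (-1) := fun p =>
    ⟨fun ⟨e, h⟩ => by
      rcases Int.units_eq_one_or e with rfl | rfl
      exacts [Or.inl h, Or.inr h], fun h => h.elim (fun h => ⟨_, h⟩) fun h => ⟨_, h⟩⟩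
  refine ⟨min (ℓ 1) (ℓ (-1)), ?_, fun j => ?_, fun j => ?_⟩
  · ext j
    rw [hlev, hexists, Set.mem_insert_iff, Set.mem_singleton_iff]
    omega
  · rw [hall, hforall]
    omega
  · rw [hex, hexists]
    omega

theorem sMax_eq {σ : SourceSink D.n} {m : ℤ} (h : D.levels σ = {m, m + 2}) :
    IsGreatest (D.levels σ) (m + 2) ∧ D.sMax σ = m + 2 := by
  have : IsGreatest (D.levels σ) (m + 2) := by
    rw [h]
    refine ⟨by simp, ?_⟩
    rintro j (rfl | rfl) <;> omega
  exact ⟨this, this.csSup_eq⟩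

theorem sMin_eq {σ : SourceSink D.n} {m : ℤ} (h : D.levels σ = {m, m + 2}) :
    IsLeast (D.levels σ) m ∧ D.sMin σ = m := by
  have : IsLeast (D.levels σ) m := by
    rw [h]
    refine ⟨by simp, ?_⟩
    rintro j (rfl | rfl) <;> omega
  exact ⟨this, this.csInf_eq⟩

/-! ### A sign for the states -/

/-- The outgoing ends of the source-sink orientation for which the over-strands point away from
the crossings, together with the beginning of the first arc. -/
def outDart (D : GaussCode) : Option (Fin D.n × Bool) → D.Dart
  | none => (0, true)
  | some (c, true) => ((D.word.symm (c, true)).succ, true)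
  | some (c, false) => ((D.word.symm (c, true)).castSucc, false)

theorem other_word_symm (c : Fin D.n) (b : Bool) :
    D.other (D.word.symm (c, b)) = D.word.symm (c, !b) := by
  simp [other]

theorem outDart_injective : Function.Injective (outDart D) := by
  rintro (_ | ⟨c, _ | _⟩) (_ | ⟨d, _ | _⟩) h <;>
    simp [outDart, Prod.ext_iff, Fin.succ_ne_zero, (Fin.succ_ne_zero _).symm] at h ⊢ <;> exact h

/-- Each strand has exactly one end in the range of `outDart`; traversing it from that end leads out
through an incoming end. Strands are cut at the base point too, so there are as many strands as
arcs. -/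
theorem next_rev_outDart_ne (s : D.State) (k l : Option (Fin D.n × Bool)) :
    next s (rev (outDart D k)) ≠ outDart D l := by
  rcases k with _ | ⟨c, _ | _⟩
  · have h : rev (outDart D none) = ((0 : D.Arc), false) := rfl
    rw [h, next_zero_false]
    rcases l with _ | ⟨d, _ | _⟩ <;>
      simp [outDart, Prod.ext_iff, (Fin.castSucc_ne_last _).symm]
  · have h : rev (outDart D (some (c, false))) = ((D.word.symm (c, true)).castSucc, true) := rfl
    rw [h, next_castSucc_true, other_word_symm]
    rcases l with _ | ⟨d, _ | _⟩ <;> split_ifs <;>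
      simp [outDart, Prod.ext_iff, Fin.succ_ne_zero]
  · have h : rev (outDart D (some (c, true))) = ((D.word.symm (c, true)).succ, false) := rfl
    rw [h, next_succ_false, other_word_symm]
    rcases l with _ | ⟨d, _ | _⟩ <;> split_ifs <;>
      simp [outDart, Prod.ext_iff, Fin.succ_ne_zero]

/-- The direction in which a strand of the smoothed diagram is left, for the orientation `g`. -/
noncomputable def strandDart (s : D.State) (g : D.Arc → ℤˣ) (k : Option (Fin D.n × Bool)) :
    D.Dart :=
  if dartSign g (outDart D k) = 1 then outDart D k else next s (rev (outDart D k))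

theorem unit_eq_neg_one {e : ℤˣ} (h : e ≠ 1) : e = -1 := (Int.units_eq_one_or e).resolve_left h

theorem Compat.dartSign_strandDart {g : D.Arc → ℤˣ} {s : D.State} (hg : Compat g s)
    (k : Option (Fin D.n × Bool)) : dartSign g (strandDart s g k) = 1 := by
  unfold strandDart
  split_ifs with h
  · exact h
  · rw [hg, dartSign_rev, unit_eq_neg_one h, neg_neg]

theorem Compat.strandDart_injective {g : D.Arc → ℤˣ} {s : D.State} (hg : Compat g s) :
    Function.Injective fun k => (strandDart s g k).1 := by
  intro k l h
  have h1 := eq_of_arc_eq_of_dartSign_eq h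
    ((hg.dartSign_strandDart k).trans (hg.dartSign_strandDart l).symm)
  unfold strandDart at h1
  split_ifs at h1
  · exact outDart_injective h1
  · exact absurd h1.symm (next_rev_outDart_ne s l k)
  · exact absurd h1 (next_rev_outDart_ne s k l)
  · exact outDart_injective (rev_injective (next_injective s h1))

theorem card_strand (D : GaussCode) :
    Fintype.card (Option (Fin D.n × Bool)) = Fintype.card D.Arc := by
  simp [mul_comm]

/-- The arcs that follow the strands. -/
noncomputable def strandArc {g : D.Arc → ℤˣ} {s : D.State} (hg : Compat g s) :
    Option (Fin D.n × Bool) ≃ D.Arc :=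
  Equiv.ofBijective _
    ((Fintype.bijective_iff_injective_and_card _).mpr ⟨hg.strandDart_injective, card_strand D⟩)

theorem strandArc_apply {g : D.Arc → ℤˣ} {s : D.State} (hg : Compat g s)
    (k : Option (Fin D.n × Bool)) : strandArc hg k = (strandDart s g k).1 := rfl

/-- The sign of an orientation of the smoothed diagram. -/
noncomputable def orientationSign {g : D.Arc → ℤˣ} {s : D.State} (hg : Compat g s) : ℤˣ :=
  Equiv.Perm.sign ((Fintype.equivOfCardEq (card_strand D)).symm.trans (strandArc hg)) * ∏ a, g a

theorem orientationSign_of_perm {g g' : D.Arc → ℤˣ} {s s' : D.State} (hg : Compat g s)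
    (hg' : Compat g' s') (π : Equiv.Perm D.Arc) (h : ∀ k, strandArc hg k = π (strandArc hg' k)) :
    orientationSign hg * ∏ a, g' a = Equiv.Perm.sign π * orientationSign hg' * ∏ a, g a := by
  have h1 : (Fintype.equivOfCardEq (card_strand D)).symm.trans (strandArc hg) =
      π * (Fintype.equivOfCardEq (card_strand D)).symm.trans (strandArc hg') := by
    ext a
    simp [h]
  unfold orientationSign
  rw [h1, Equiv.Perm.sign_mul]
  ac_rfl

/-- If `g` leaves the crossing through the labelled ends, the arcs that follow the strands do not
depend on the smoothing. Otherwise the change of smoothing exchanges the two arcs, a transposition.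
-/
theorem Switch.orientationSign_mul {s s' : D.State} {c : Fin D.n} {i j : D.Dart}
    (h : Switch s s' (outDart D (some (c, true))) (outDart D (some (c, false))) i j)
    {g : D.Arc → ℤˣ} (hg : Compat g s) (hg' : Compat g s')
    (hxy : dartSign g (outDart D (some (c, true))) = dartSign g (outDart D (some (c, false)))) :
    orientationSign hg = dartSign g (outDart D (some (c, true))) * orientationSign hg' := by
  have hoff : ∀ k, k ≠ some (c, true) → k ≠ some (c, false) →
      strandArc hg k = strandArc hg' k := by
    intro k h1 h2
    rw [strandArc_apply, strandArc_apply, strandDart, strandDart, h.off]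
    · rintro rfl
      exact next_rev_outDart_ne s k _ h.next_i
    · rintro rfl
      exact next_rev_outDart_ne s k _ h.next_j
    · exact fun e => h1 (outDart_injective (rev_injective e))
    · exact fun e => h2 (outDart_injective (rev_injective e))
  have hprod : (∏ a, g a) * (∏ a, g a) = 1 := Int.units_mul_self _
  by_cases h1 : dartSign g (outDart D (some (c, true))) = 1
  · have h2 := hxy.symm.trans h1
    have key := orientationSign_of_perm hg hg' 1 fun k => by
      rw [Equiv.Perm.one_apply]
      by_cases hk1 : k = some (c, true)
      · rw [hk1, strandArc_apply, strandArc_apply, strandDart, strandDart, if_pos h1, if_pos h1]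
      · by_cases hk2 : k = some (c, false)
        · rw [hk2, strandArc_apply, strandArc_apply, strandDart, strandDart, if_pos h2, if_pos h2]
        · exact hoff k hk1 hk2
    rw [map_one, one_mul] at key
    rw [h1, one_mul]
    exact mul_right_cancel key
  · have h2 : dartSign g (outDart D (some (c, false))) ≠ 1 := fun e => h1 (hxy.trans e)
    have k1 : strandArc hg (some (c, true)) = (rev i).1 := by
      rw [strandArc_apply, strandDart, if_neg h1, h.next_rev_x]
    have k2 : strandArc hg (some (c, false)) = (rev j).1 := by
      rw [strandArc_apply, strandDart, if_neg h2, h.next_rev_y]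
    have k1' : strandArc hg' (some (c, true)) = (rev j).1 := by
      rw [strandArc_apply, strandDart, if_neg h1, h.next_rev_x']
    have k2' : strandArc hg' (some (c, false)) = (rev i).1 := by
      rw [strandArc_apply, strandDart, if_neg h2, h.next_rev_y']
    have hne : (rev i).1 ≠ (rev j).1 := by
      rw [← k1, ← k2]
      intro e
      exact absurd ((strandArc hg).injective e) (by simp)
    have key := orientationSign_of_perm hg hg' (Equiv.swap (rev i).1 (rev j).1) fun k => by
      by_cases hk1 : k = some (c, true)
      · rw [hk1, k1, k1', Equiv.swap_apply_right]
      · by_cases hk2 : k = some (c, false)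
        · rw [hk2, k2, k2', Equiv.swap_apply_left]
        · rw [hoff k hk1 hk2, Equiv.swap_apply_of_ne_of_ne]
          · rw [← k2']
            exact fun e => hk2 ((strandArc hg').injective e)
          · rw [← k1']
            exact fun e => hk1 ((strandArc hg').injective e)
    rw [Equiv.Perm.sign_swap hne] at key
    rw [unit_eq_neg_one h1]
    exact mul_right_cancel key

/-! ### Reversal of a single cycle and the sign of a merge -/

/-- The positive direction of an arc. -/
noncomputable def posDart (g : D.Arc → ℤˣ) (a : D.Arc) : D.Dart := (a, decide (g a = 1))

theorem dartSign_posDart (g : D.Arc → ℤˣ) (a : D.Arc) : dartSign g (posDart g a) = 1 := by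
  unfold posDart
  by_cases h : g a = 1
  · simp [h, dartSign_true]
  · have h1 : ((a, false) : D.Dart) = rev (a, true) := rfl
    rw [decide_eq_false h, h1, dartSign_rev, dartSign_true, unit_eq_neg_one h, neg_neg]

theorem posDart_eq {g : D.Arc → ℤˣ} {u : D.Dart} (h : dartSign g u = 1) : posDart g u.1 = u :=
  eq_of_arc_eq_of_dartSign_eq rfl ((dartSign_posDart g _).trans h.symm)

theorem cyc_posDart (g : D.Arc → ℤˣ) (s : D.State) (a : D.Arc) :
    cyc s (posDart g a) = cyc s (a, true) := by
  unfold posDart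
  cases decide (g a = 1)
  · exact cyc_rev s (a, true)
  · rfl

theorem cyc_fst (s : D.State) (u : D.Dart) : cyc s (u.1, true) = cyc s u := by
  obtain ⟨a, _ | _⟩ := u
  · exact (cyc_rev s (a, true)).symm
  · rfl

theorem Compat.next_posDart_injective {g : D.Arc → ℤˣ} {s : D.State} (hg : Compat g s) :
    Function.Injective fun a => (next s (posDart g a)).1 := by
  intro a b h
  have h1 := eq_of_arc_eq_of_dartSign_eq (g := g) h (by
    rw [hg, hg, dartSign_posDart, dartSign_posDart])
  exact congrArg Prod.fst (next_injective s h1)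

/-- The successor permutation of the arcs of the oriented smoothed diagram. -/
noncomputable def nextArc {g : D.Arc → ℤˣ} {s : D.State} (hg : Compat g s) : Equiv.Perm D.Arc :=
  Equiv.ofBijective _ (Finite.injective_iff_bijective.mp hg.next_posDart_injective)

theorem nextArc_apply {g : D.Arc → ℤˣ} {s : D.State} (hg : Compat g s) (a : D.Arc) :
    nextArc hg a = (next s (posDart g a)).1 := rfl

theorem nextArc_of_dartSign {g : D.Arc → ℤˣ} {s : D.State} (hg : Compat g s) {u : D.Dart}
    (hu : dartSign g u = 1) : nextArc hg u.1 = (next s u).1 := by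
  rw [nextArc_apply, posDart_eq hu]

theorem sameCycle_nextArc_iff {g : D.Arc → ℤˣ} {s : D.State} (hg : Compat g s) {a b : D.Arc} :
    (nextArc hg).SameCycle a b ↔ cyc s (a, true) = cyc s (b, true) := by
  have hstep : ∀ a, cyc s (nextArc hg a, true) = cyc s (a, true) := by
    intro a
    rw [nextArc_apply, cyc_fst, cyc_next, cyc_posDart]
  constructor
  · intro h
    obtain ⟨k, -, hk⟩ := h.exists_pow_eq'
    rw [← hk]
    clear hk
    induction k with
    | zero => rfl
    | succ k ih => rw [pow_succ', Equiv.Perm.mul_apply, hstep, ih]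
  · intro h
    rw [← cyc_posDart g, ← cyc_posDart g] at h
    have h1 : ocyc s (posDart g a) = ocyc s (posDart g b) := by
      refine (cyc_eq_iff.mp h).resolve_right fun h2 => ?_
      have h3 := hg.eq_of_ocyc_eq h2
      rw [dartSign_rev, dartSign_posDart, dartSign_posDart] at h3
      exact absurd h3 (by decide)
    obtain ⟨k, hk⟩ := exists_iterate_of_ocyc_eq h1
    refine ⟨k, ?_⟩
    rw [zpow_natCast]
    have h4 : ∀ k : ℕ, posDart g ((nextArc hg ^ k) a) = (next s)^[k] (posDart g a) := by
      intro k
      induction k with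
      | zero => rfl
      | succ k ih =>
        rw [pow_succ', Equiv.Perm.mul_apply, nextArc_apply, ih, Function.iterate_succ_apply',
          posDart_eq]
        rw [hg, ← ih, dartSign_posDart]
    have h5 := h4 k
    rw [hk] at h5
    exact congrArg Prod.fst h5

theorem sign_cycleOf {α : Type*} [Fintype α] [DecidableEq α] (f : Equiv.Perm α) (a : α) :
    Equiv.Perm.sign (f.cycleOf a) = -(-1) ^ (Finset.univ.filter fun b => f.SameCycle a b).card := by
  by_cases h : f a = a
  · have h1 : (Finset.univ.filter fun b => f.SameCycle a b) = {a} := by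
      ext b
      simp only [Finset.mem_filter, Finset.mem_univ, true_and, Finset.mem_singleton]
      constructor
      · intro hb
        obtain ⟨k, rfl⟩ := hb
        exact Equiv.Perm.zpow_apply_eq_self_of_apply_eq_self h k
      · rintro rfl
        exact Equiv.Perm.SameCycle.refl _ _
    rw [h1, (Equiv.Perm.cycleOf_eq_one_iff f).mpr h]
    simp
  · rw [(Equiv.Perm.isCycle_cycleOf f h).sign]
    congr 3
    ext b
    rw [Equiv.Perm.mem_support_cycleOf_iff' h]
    simp

/-- Reversing a cycle of length `L` changes the map from strands to arcs by one turn of that cycle,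
of sign `(-1) ^ (L - 1)`, and the product of the arc signs by `(-1) ^ L`. The product is `-1`,
whatever the length; this is why the arc signs enter `orientationSign`. -/
theorem orientationSign_flip {g g' : D.Arc → ℤˣ} {s : D.State} (hg : Compat g s)
    (hg' : Compat g' s) (u : D.Dart) (e : ℤˣ)
    (h : ∀ a, g' a = g a * if cyc s (a, true) = cyc s u then e else 1) :
    orientationSign hg' = e * orientationSign hg := by
  rcases Int.units_eq_one_or e with rfl | rfl
  · obtain rfl : g' = g := funext fun a => by rw [h, ite_self, mul_one]
    rw [one_mul]
  have hd : ∀ v, dartSign g' v = dartSign g v * if cyc s v = cyc s u then -1 else 1 := by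
    rintro ⟨a, _ | _⟩
    · have e1 : ((a, false) : D.Dart) = rev (a, true) := rfl
      rw [e1, dartSign_rev, dartSign_rev, cyc_rev, dartSign_true, dartSign_true, h, neg_mul]
    · rw [dartSign_true, dartSign_true, h]
  have hcycle : ∀ k, cyc s (strandArc hg' k, true) = cyc s (outDart D k) := by
    intro k
    rw [strandArc_apply, cyc_fst, strandDart]
    split_ifs
    · rfl
    · rw [cyc_next, cyc_rev]
  have key := orientationSign_of_perm hg hg' ((nextArc hg).cycleOf u.1) fun k => by
    rw [Equiv.Perm.cycleOf_apply]
    simp only [sameCycle_nextArc_iff]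
    rw [hcycle, cyc_fst]
    by_cases hk : cyc s u = cyc s (outDart D k)
    · rw [if_pos hk, strandArc_apply, strandArc_apply, strandDart, strandDart, hd, if_pos hk.symm]
      by_cases h1 : dartSign g (outDart D k) = 1
      · rw [if_pos h1, h1, if_neg (by decide)]
        have e1 : (next s (rev (outDart D k))).1 = (rev (next s (rev (outDart D k)))).1 := rfl
        rw [e1, nextArc_of_dartSign, next_rev_next, rev_rev]
        rw [dartSign_rev, hg, dartSign_rev, h1, neg_neg]
      · rw [if_neg h1, unit_eq_neg_one h1, if_pos (by decide)]
        have e1 : (outDart D k).1 = (rev (outDart D k)).1 := rfl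
        rw [e1, nextArc_of_dartSign]
        rw [dartSign_rev, unit_eq_neg_one h1, neg_neg]
    · have e1 : (if cyc s (outDart D k) = cyc s u then (-1 : ℤˣ) else 1) = 1 :=
        if_neg fun e => hk e.symm
      rw [if_neg hk, strandArc_apply, strandArc_apply, strandDart, strandDart, hd, e1, mul_one]
  rw [sign_cycleOf] at key
  simp only [sameCycle_nextArc_iff] at key
  have hprod : ∏ a, g' a = (∏ a, g a) *
      (-1) ^ (Finset.univ.filter fun a : D.Arc => cyc s (u.1, true) = cyc s (a, true)).card := by
    simp_rw [h]
    rw [Finset.prod_mul_distrib, Finset.prod_ite, Finset.prod_const, Finset.prod_const_one, mul_one]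
    simp_rw [cyc_fst, eq_comm]
  rw [hprod] at key
  generalize ((-1 : ℤˣ) ^ (Finset.univ.filter fun a : D.Arc =>
    cyc s (u.1, true) = cyc s (a, true)).card) = w at key
  generalize ∏ a, g a = w' at key
  rcases Int.units_eq_one_or w with rfl | rfl <;> rcases Int.units_eq_one_or w' with rfl | rfl <;>
    simp at key <;> rw [neg_one_mul] <;> first | exact key.symm | rw [key, neg_neg]

/-- The sign of a state: the sign of its global orientation. -/
noncomputable def stateSign (s : D.State) : ℤˣ := orientationSign (compat_rootSign s)

/-- The global orientation of `s'` also orients `s`. With `α`, `β`, `γ` the agreement signs at `x`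
and `y` in `s` and at `x` in `s'`, the cycles of `s` are flipped by `α γ` and `β γ`, and the change
of smoothing contributes `γ`; the total is `α β γ`, the sign left by three bar operations under
duality. -/
theorem Switch.stateSign_mul {s s' : D.State} {c : Fin D.n} {i j : D.Dart}
    (h : Switch s s' (outDart D (some (c, true))) (outDart D (some (c, false))) i j)
    (hs : cyc s (outDart D (some (c, true))) ≠ cyc s (outDart D (some (c, false)))) :
    stateSign s * stateSign s' = agr s (outDart D (some (c, true))) *
      agr s (outDart D (some (c, false))) * agr s' (outDart D (some (c, true))) := by
  set x := outDart D (some (c, true)) with hx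
  set y := outDart D (some (c, false)) with hy
  have hγ : agr s' y = agr s' x := (agr_eq_of_ocyc_eq (h.ocyc_eq_of_cyc_ne hs)).symm
  have hxy : dartSign (rootSign s') x = dartSign (rootSign s') y := by
    rw [dartSign_rootSign, dartSign_rootSign, hγ]
  have hc : Compat (rootSign s') s := h.symm.compat (compat_rootSign s') hxy
  -- An intermediate orientation: only the cycle of `x` has been adapted to the global orientation
  -- of `s'`.
  let g₁ : D.Arc → ℤˣ := fun a => rootSign s a *
    if cyc s (a, true) = cyc s x then agr s' x * agr s x else 1
  have hg₁ : Compat g₁ s := by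
    have hd : ∀ v, dartSign g₁ v = dartSign (rootSign s) v *
        if cyc s v = cyc s x then agr s' x * agr s x else 1 := by
      rintro ⟨a, _ | _⟩
      · have e1 : ((a, false) : D.Dart) = rev (a, true) := rfl
        rw [e1, dartSign_rev, dartSign_rev, cyc_rev, dartSign_true, dartSign_true, neg_mul]
      · rw [dartSign_true, dartSign_true]
    intro v
    rw [hd, hd, cyc_next, compat_rootSign s v]
  have h1 := orientationSign_flip (compat_rootSign s) hg₁ x _ fun a => rfl
  have h2 := orientationSign_flip hg₁ hc y (agr s' y * agr s y) fun a => by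
    have hrs : ∀ (r : D.State) (b : D.Arc), rootSign r b = agr r (b, true) := fun r b => by
      rw [← dartSign_rootSign, dartSign_true]
    have hmul : ∀ z, cyc s (a, true) = cyc s z →
        rootSign s' a = rootSign s a * (dartSign (rootSign s') z * agr s z) := by
      intro z hz
      have h3 := hc.mul_agr_eq hz
      rw [dartSign_true] at h3
      rw [← h3, hrs s a]
      calc rootSign s' a = rootSign s' a * (agr s (a, true) * agr s (a, true)) := by
            rw [Int.units_mul_self, mul_one]
        _ = _ := by rw [← mul_assoc, mul_comm]
    change _ = rootSign s a * _ * _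
    by_cases hax : cyc s (a, true) = cyc s x
    · have hay : cyc s (a, true) ≠ cyc s y := fun e => hs (hax.symm.trans e)
      rw [if_pos hax, if_neg hay, mul_one, hmul x hax, dartSign_rootSign]
    · by_cases hay : cyc s (a, true) = cyc s y
      · rw [if_neg hax, if_pos hay, mul_one, hmul y hay, dartSign_rootSign]
      · rw [if_neg hax, if_neg hay, mul_one, mul_one, hrs, hrs]
        refine (h.agr_eq_of_not_touch ?_).2
        rw [h.touch_iff]
        exact not_or.mpr ⟨hax, hay⟩
  have h3 := h.orientationSign_mul hc (compat_rootSign s') hxy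
  rw [h1] at h2
  rw [h2, dartSign_rootSign, hγ] at h3
  change _ = _ * stateSign s' at h3
  change _ * (_ * stateSign s) = _ at h3
  rcases Int.units_eq_one_or (stateSign s) with e1 | e1 <;>
  rcases Int.units_eq_one_or (stateSign s') with e2 | e2 <;>
  rcases Int.units_eq_one_or (agr s x) with e3 | e3 <;>
  rcases Int.units_eq_one_or (agr s y) with e4 | e4 <;>
  rcases Int.units_eq_one_or (agr s' x) with e5 | e5 <;>
  rw [e1, e2, e3, e4, e5] at h3 ⊢ <;> revert h3 <;> decide

/-! ### The mirror image -/

/-- The code with opposite signs and the passages `w`. -/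
abbrev mirrorWith (K : GaussCode) (w : Fin (2 * K.n) ≃ Fin K.n × Bool) : GaussCode where
  n := K.n
  word := w
  sign := fun c => -K.sign c

/-- The opposite state. -/
def compl {K : GaussCode} (w : Fin (2 * K.n) ≃ Fin K.n × Bool) (s : K.State) :
    (mirrorWith K w).State := fun c => !s c

section Mirror

variable {K : GaussCode} {w : Fin (2 * K.n) ≃ Fin K.n × Bool}

theorem mirror_other (hw : ∀ p, (w p).1 = (K.word p).1) (p : Fin (2 * K.n)) :
    (mirrorWith K w).other p = K.other p := by
  have h0 := congrArg Prod.fst (word_other (D := mirrorWith K w) p)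
  have h1 : (w ((mirrorWith K w).other p)).1 = (w p).1 := h0
  rw [hw, hw, word_fst_eq_iff] at h1
  exact h1.resolve_left (other_ne (D := mirrorWith K w) p)

/-- The change of sign and the change of smoothing cancel. Complementary states of the mirror image
thus consist of the same curves, with the same first arcs and orientations. -/
theorem mirror_oriented (s : K.State) (c : Fin K.n) :
    (mirrorWith K w).Oriented (compl w s) c ↔ K.Oriented s c := by
  unfold Oriented compl
  rcases Int.units_eq_one_or (K.sign c) with h | h <;> cases s c <;> simp [h]

theorem mirror_next (hw : ∀ p, (w p).1 = (K.word p).1) (s : K.State) (x : K.Dart) :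
    next (D := mirrorWith K w) (compl w s) x = next s x := by
  rcases dart_cases (D := K) x with ⟨p, rfl⟩ | ⟨p, rfl⟩ | rfl | rfl
  · rw [next_castSucc_true (D := K), next_castSucc_true (D := mirrorWith K w), mirror_other hw]
    change (if (mirrorWith K w).Oriented (compl w s) (w p).1 then _ else _) = _
    rw [hw]
    by_cases h : K.Oriented s (K.word p).1
    · rw [if_pos h, if_pos ((mirror_oriented s _).mpr h)]
    · rw [if_neg h, if_neg fun h' => h ((mirror_oriented s _).mp h')]
  · rw [next_succ_false (D := K), next_succ_false (D := mirrorWith K w), mirror_other hw]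
    change (if (mirrorWith K w).Oriented (compl w s) (w p).1 then _ else _) = _
    rw [hw]
    by_cases h : K.Oriented s (K.word p).1
    · rw [if_pos h, if_pos ((mirror_oriented s _).mpr h)]
    · rw [if_neg h, if_neg fun h' => h ((mirror_oriented s _).mp h')]
  · rw [next_last_true (D := K), next_last_true (D := mirrorWith K w)]
  · rw [next_zero_false (D := K), next_zero_false (D := mirrorWith K w)]

theorem mirror_ocyc (hw : ∀ p, (w p).1 = (K.word p).1) {s : K.State} {x y : K.Dart} :
    ocyc (D := mirrorWith K w) (compl w s) x = ocyc (D := mirrorWith K w) (compl w s) y ↔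
      ocyc s x = ocyc s y := by
  constructor
  · exact eq_of_ocyc_eq (D := mirrorWith K w) (fun u : K.Dart => ocyc s u) fun u => by
      rw [mirror_next hw, ocyc_next]
  · exact eq_of_ocyc_eq (D := K) (fun u : K.Dart => ocyc (D := mirrorWith K w) (compl w s) u)
      fun u => by rw [← mirror_next hw, ocyc_next]

theorem mirror_cyc (hw : ∀ p, (w p).1 = (K.word p).1) {s : K.State} {x y : K.Dart} :
    cyc (D := mirrorWith K w) (compl w s) x = cyc (D := mirrorWith K w) (compl w s) y ↔
      cyc s x = cyc s y := by
  constructor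
  · exact eq_of_cyc_eq (D := mirrorWith K w) (fun u : K.Dart => cyc s u)
      (fun u => by rw [mirror_next hw, cyc_next]) fun u => cyc_rev s u
  · exact eq_of_cyc_eq (D := K) (fun u : K.Dart => cyc (D := mirrorWith K w) (compl w s) u)
      (fun u => by rw [← mirror_next hw, cyc_next])
      fun u => cyc_rev (D := mirrorWith K w) (compl w s) u

theorem mirror_rt (hw : ∀ p, (w p).1 = (K.word p).1) (s : K.State) (u : K.Dart) :
    rt (D := mirrorWith K w) (compl w s) u = rt s u := by
  apply le_antisymm
  · exact rt_le (D := mirrorWith K w) ((mirror_cyc hw).mpr (cyc_rt s u))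
  · exact rt_le (D := K) ((mirror_cyc hw).mp (cyc_rt (D := mirrorWith K w) (compl w s) u))

theorem mirror_agr (hw : ∀ p, (w p).1 = (K.word p).1) (s : K.State) (u : K.Dart) :
    agr (D := mirrorWith K w) (compl w s) u = agr s u := by
  have h : Agrees (D := mirrorWith K w) (compl w s) u ↔ Agrees s u := by
    change ocyc (D := mirrorWith K w) (compl w s) u =
      ocyc (D := mirrorWith K w) (compl w s) (rt (D := mirrorWith K w) (compl w s) u, true) ↔
        ocyc s u = ocyc s (rt s u, true)
    rw [mirror_rt hw]
    exact mirror_ocyc hw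
  unfold agr
  by_cases h' : Agrees s u
  · rw [if_pos h', if_pos (h.mpr h')]
  · rw [if_neg h', if_neg fun e => h' (h.mp e)]

theorem mirror_Roots (hw : ∀ p, (w p).1 = (K.word p).1) (s : K.State) :
    Roots (D := mirrorWith K w) (compl w s) = Roots s := by
  ext a
  rw [mem_Roots (D := K), mem_Roots (D := mirrorWith K w), mirror_rt hw]

theorem mirror_rootsBelow (hw : ∀ p, (w p).1 = (K.word p).1) (s : K.State) (a : K.Arc) :
    rootsBelow (D := mirrorWith K w) (compl w s) a = rootsBelow s a := by
  unfold rootsBelow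
  rw [mirror_Roots hw]

theorem mirror_dartOrderSign (hw : ∀ p, (w p).1 = (K.word p).1) (x y : K.Dart) (s : K.State) :
    dartOrderSign (D := mirrorWith K w) x y (compl w s) = dartOrderSign x y s := by
  by_cases h : cyc s x = cyc s y
  · rw [dartOrderSign_of_eq h, dartOrderSign_of_eq (D := mirrorWith K w) ((mirror_cyc hw).mpr h),
      mirror_rt hw, mirror_rootsBelow hw]
  · rw [dartOrderSign_of_ne h,
      dartOrderSign_of_ne (D := mirrorWith K w) fun e => h ((mirror_cyc hw).mp e),
      mirror_rt hw, mirror_rt hw, mirror_rootsBelow hw, mirror_rootsBelow hw]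

/-- The dual enhanced state of the mirror image. -/
noncomputable def star (w : Fin (2 * K.n) ≃ Fin K.n × Bool) (t : EnhancedState K) :
    EnhancedState (mirrorWith K w) :=
  ⟨compl w t.1, fun z => !label t ((root (D := mirrorWith K w) (compl w t.1) z : K.Arc), true)⟩

theorem star_fst (t : EnhancedState K) : (star w t).1 = compl w t.1 := rfl

theorem label_star (hw : ∀ p, (w p).1 = (K.word p).1) (t : EnhancedState K) (u : K.Dart) :
    label (D := mirrorWith K w) (star w t) u = !label t u := by
  change (!label t ((rt (D := mirrorWith K w) (compl w t.1) u : K.Arc), true)) = _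
  rw [mirror_rt hw, label_congr rfl (cyc_rt t.1 u)]

theorem compl_injective : Function.Injective (compl w) := by
  intro s s' h
  funext c
  exact Bool.not_inj (congrFun h c)

theorem star_bijective (hw : ∀ p, (w p).1 = (K.word p).1) : Function.Bijective (star w) := by
  constructor
  · intro t t' h
    refine EnhancedState.ext_cyc (compl_injective (congrArg Sigma.fst h)) fun u => ?_
    have h1 := label_star hw t u
    rw [h, label_star hw t' u] at h1
    exact (Bool.not_inj h1).symm
  · intro t'
    let s : K.State := fun c => !t'.1 c
    have hs : t'.1 = compl w s := by
      funext c
      simp [compl, s]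
    let t : EnhancedState K := ⟨s, fun z => !label (D := mirrorWith K w) t' (root (D := K) s z, true)⟩
    refine ⟨t, EnhancedState.ext_cyc (D := mirrorWith K w) hs.symm fun u => ?_⟩
    have h1 := label_star hw t u
    have h2 : label t u = !label (D := mirrorWith K w) t' (rt (D := K) s u, true) := rfl
    rw [h2, Bool.not_not, label_congr (D := mirrorWith K w) hs ((mirror_cyc hw).mpr (cyc_rt s u))] at h1
    exact h1

theorem nPos_add_nNeg (D : GaussCode) : D.nPos + D.nNeg = D.n := by
  unfold nPos nNeg
  have h : (Finset.univ.filter fun c => D.sign c = -1) =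
      Finset.univ.filter fun c => ¬ D.sign c = 1 := by
    ext c
    rcases Int.units_eq_one_or (D.sign c) with h | h <;> simp [h]
  rw [h, Finset.card_filter_add_card_filter_not, Finset.card_univ, Fintype.card_fin]

/-- The number of `B`-smoothings `i` becomes `n - i`, the label weight changes sign and `n₊`, `n₋`
are exchanged; `n = n₊ + n₋` absorbs the constants. -/
theorem qDegree_star (hw : ∀ p, (w p).1 = (K.word p).1) (t : EnhancedState K) :
    qDegree (star w t) = -qDegree t := by
  have h1 : weight (star w t) = -weight t := by
    unfold weight
    rw [star_fst, mirror_Roots hw, ← Finset.sum_neg_distrib]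
    refine Finset.sum_congr rfl fun a _ => ?_
    rw [label_star hw]
    cases label t (a, true) <;> simp [labelWeight]
  have h2 : (mirrorWith K w).nPos = K.nNeg := by
    unfold nPos nNeg
    simp only [neg_eq_iff_eq_neg]
  have h3 : (mirrorWith K w).nNeg = K.nPos := by
    unfold nPos nNeg
    simp only [neg_inj]
  have h4 : (Finset.univ.filter fun c => (star w t).1 c = true).card +
      (Finset.univ.filter fun c => t.1 c = true).card = K.n := by
    have h : (Finset.univ.filter fun c => (star w t).1 c = true) =
        Finset.univ.filter fun c => ¬ t.1 c = true := by
      ext c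
      simp [star_fst, compl]
    rw [h, add_comm, Finset.card_filter_add_card_filter_not, Finset.card_univ, Fintype.card_fin]
  have h5 := nPos_add_nNeg K
  rw [qDegree_eq, qDegree_eq, h1, h2, h3]
  omega

theorem barUnit_not (a : Bool) (α : ℤˣ) : barUnit (!a) α = ((α : ℤ) : ℚ) * barUnit a α := by
  have := unit_mul_barUnit_not (!a) α
  rwa [Bool.not_not, eq_comm] at this

/-- Exchanging `1` and `X` passes to the dual basis of the Frobenius algebra, which transposes
multiplication into comultiplication. -/
theorem mulCoeff_not (a b c : Bool) : mulCoeff (!a) (!b) (!c) = comulCoeff c a b := by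
  cases a <;> cases b <;> cases c <;> rfl

theorem comulCoeff_not (a b c : Bool) : comulCoeff (!c) (!a) (!b) = mulCoeff a b c := by
  cases a <;> cases b <;> cases c <;> rfl

theorem mirror_dartAdjacent (hw : ∀ p, (w p).1 = (K.word p).1) {t t' : EnhancedState K}
    {x y i j : K.Dart} {c : Fin K.n} (h : t.1 c = false ∧ t'.1 = Function.update t.1 c true)
    (hsw : Switch t.1 t'.1 x y i j) :
    DartAdjacent (D := mirrorWith K w) x y c (star w t') (star w t) ↔ DartAdjacent x y c t t' := by
  have hl : ∀ u, (cyc t'.1 u ≠ cyc t'.1 x → cyc t'.1 u ≠ cyc t'.1 y → label t u = label t' u) ↔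
      (cyc t.1 u ≠ cyc t.1 x → cyc t.1 u ≠ cyc t.1 y → label t' u = label t u) := by
    intro u
    have h1 := hsw.touch_iff (u := u)
    have h2 := hsw.touch_iff' (u := u)
    rw [h1] at h2
    constructor
    · intro h3 hx hy
      have h4 := not_or.mp (mt h2.mpr (not_or.mpr ⟨hx, hy⟩))
      exact (h3 h4.1 h4.2).symm
    · intro h3 hx hy
      have h4 := not_or.mp (mt h2.mp (not_or.mpr ⟨hx, hy⟩))
      exact (h3 h4.1 h4.2).symm
  have hM : ∀ u : K.Dart, label (D := mirrorWith K w) (star w t) u =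
      label (D := mirrorWith K w) (star w t') u ↔ label t u = label t' u := by
    intro u
    rw [label_star hw, label_star hw, Bool.not_inj_iff]
  have hcy : ∀ (s : K.State) (u v : K.Dart), cyc (D := mirrorWith K w) (compl w s) u ≠
      cyc (D := mirrorWith K w) (compl w s) v ↔ cyc s u ≠ cyc s v := fun s u v =>
    not_congr (mirror_cyc hw)
  constructor
  · rintro ⟨-, -, h3⟩
    refine ⟨h.1, h.2, fun u => (hl u).mp fun hx hy => ?_⟩
    exact (hM u).mp (h3 u ((hcy _ _ _).mpr hx) ((hcy _ _ _).mpr hy))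
  · rintro ⟨-, -, h3⟩
    refine ⟨?_, ?_, fun u hx hy => ?_⟩
    · change (!t'.1 c) = false
      rw [h.2, Function.update_self]
      rfl
    · funext d
      change (!t.1 d) = Function.update (compl w t'.1) c true d
      by_cases hd : d = c
      · rw [hd, Function.update_self, h.1]
        rfl
      · rw [Function.update_of_ne hd]
        change _ = !t'.1 d
        rw [h.2, Function.update_of_ne hd]
    · exact (hM u).mpr ((hl u).mpr (h3 u) ((hcy _ _ _).mp hx) ((hcy _ _ _).mp hy))

/-- Under `star` a merge becomes a split traversed backwards, with the same order signs.
Complementing the three labels multiplies the bar signs by the agreement signs of the three cycles,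
and by `Switch.stateSign_mul` their product comes from the vertices. -/
theorem mirror_dartPartial (hw : ∀ p, (w p).1 = (K.word p).1) (t t' : EnhancedState K)
    (c : Fin K.n) :
    dartPartial (D := mirrorWith K w) (outDart K (some (c, true))) (outDart K (some (c, false))) c
      (star w t') (star w t) = ((stateSign t.1 : ℤ) : ℚ) * ((stateSign t'.1 : ℤ) : ℚ) *
      dartPartial (outDart K (some (c, true))) (outDart K (some (c, false))) c t t' := by
  by_cases h : t.1 c = false ∧ t'.1 = Function.update t.1 c true
  swap
  · rw [dartPartial_of_not h, dartPartial_of_not (D := mirrorWith K w), mul_zero]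
    rintro ⟨h1, h2⟩
    refine h ⟨?_, ?_⟩
    · have h3 := congrFun h2 c
      rw [Function.update_self] at h3
      change (!t.1 c) = true at h3
      simpa using h3
    · change (!t'.1 c) = false at h1
      funext d
      by_cases hd : d = c
      · rw [hd, Function.update_self]
        simpa using h1
      · rw [Function.update_of_ne hd]
        have h3 := congrFun h2 d
        rw [Function.update_of_ne hd] at h3
        exact (Bool.not_inj h3).symm
  obtain ⟨i, j, hsw⟩ : ∃ i j, Switch t.1 t'.1 (outDart K (some (c, true)))
      (outDart K (some (c, false))) i j :=
    exists_switch_site_true ⟨fun _ => true, fun _ => true⟩ h.1 h.2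
  have hadj := mirror_dartAdjacent hw h hsw
  have hneg := fun hs => hsw.not_cyc_ne hs
  have hP := fun hs => congrArg (fun e : ℤˣ => ((e : ℤ) : ℚ)) (hsw.stateSign_mul hs)
  have hP' := fun hs => congrArg (fun e : ℤˣ => ((e : ℤ) : ℚ)) (hsw.symm.stateSign_mul hs)
  generalize outDart K (some (c, true)) = x at *
  generalize outDart K (some (c, false)) = y at *
  unfold dartPartial
  by_cases ha : DartAdjacent x y c t t'
  swap
  · rw [if_neg ha, if_neg fun e => ha (hadj.mp e), mul_zero]
  rw [if_pos ha, if_pos (hadj.mpr ha), edgeSign_comm x y t.1 t'.1]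
  unfold edgeSign
  rw [star_fst, star_fst, mirror_dartOrderSign hw, mirror_dartOrderSign hw, dartLocalCoeff_eq (D := K),
    dartLocalCoeff_eq (D := mirrorWith K w), label_star hw, label_star hw, label_star hw,
    label_star hw]
  unfold localForm
  rw [star_fst, star_fst]
  simp only [mirror_agr hw, ne_eq, mirror_cyc hw]
  by_cases hs : cyc t.1 x = cyc t.1 y
  · by_cases hs' : cyc t'.1 x = cyc t'.1 y
    · rw [if_neg (not_not.mpr hs), if_neg (not_not.mpr hs), if_neg (not_not.mpr hs'),
        if_neg (not_not.mpr hs')]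
      ring
    · rw [if_neg (not_not.mpr hs), if_pos hs', if_neg (not_not.mpr hs), if_pos hs', mulCoeff_not, barUnit_not, barUnit_not,
        barUnit_not]
      have := hP' hs'
      push_cast at this
      rw [mul_comm ((stateSign t.1 : ℤ) : ℚ), this]
      ring
  · rw [if_pos hs, if_neg (not_not.mpr (hneg hs)), if_pos hs, comulCoeff_not, barUnit_not,
      barUnit_not, barUnit_not]
    have := hP hs
    push_cast at this
    rw [this]
    ring

/-- The differential of the mirror image is the transpose of the differential, up to signs. -/
theorem exists_mirror_partialCoeff (hw : ∀ p, (w p).1 = (K.word p).1) (σ : SourceSink K.n)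
    (τ : SourceSink (mirrorWith K w).n) : ∃ ε : K.State → ℚ, (∀ s, ε s * ε s = 1) ∧
    ∀ c t t', partialCoeff (D := mirrorWith K w) τ c (star w t') (star w t) =
      ε t.1 * ε t'.1 * partialCoeff σ c t t' := by
  let σ₀ : SourceSink K.n := ⟨fun _ => true, fun _ => true⟩
  -- The source at each crossing of the mirror image is the strand that is the over-strand in `K`,
  -- so that the labelled ends are the same darts.
  let τ₀ : SourceSink (mirrorWith K w).n :=
    ⟨fun c => (w (K.word.symm (c, true))).2, fun _ => true⟩
  obtain ⟨r, hr⟩ := exists_partialCoeff_eq σ₀ σ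
  obtain ⟨r', hr'⟩ := exists_partialCoeff_eq (D := mirrorWith K w) τ τ₀
  have hword : ∀ c, w.symm (c, (w (K.word.symm (c, true))).2) = K.word.symm (c, true) := by
    intro c
    rw [Equiv.symm_apply_eq, Prod.ext_iff]
    exact ⟨by rw [hw, Equiv.apply_symm_apply], rfl⟩
  have h1 : ∀ c, site₁ (D := mirrorWith K w) τ₀ c = outDart K (some (c, true)) := by
    intro c
    change ((w.symm (c, (w (K.word.symm (c, true))).2)).succ, true) = _
    rw [hword]
    rfl
  have h2 : ∀ c, site₂ (D := mirrorWith K w) τ₀ c = outDart K (some (c, false)) := by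
    intro c
    change ((w.symm (c, (w (K.word.symm (c, true))).2)).castSucc, false) = _
    rw [hword]
    rfl
  -- The signs `r c` and `r' c` of the normalisations are constant on all edges in direction `c`.
  -- Taking the product over the `B`-smoothed crossings turns them into vertex signs.
  refine ⟨fun s => ((stateSign s : ℤ) : ℚ) * ∏ c, if s c = true then ((r c : ℤ) : ℚ) * ((r' c : ℤ) : ℚ)
    else 1, fun s => ?_, fun c t t' => ?_⟩
  · have h3 : (∏ c, if s c = true then ((r c : ℤ) : ℚ) * ((r' c : ℤ) : ℚ) else 1) *
        (∏ c, if s c = true then ((r c : ℤ) : ℚ) * ((r' c : ℤ) : ℚ) else 1) = 1 := by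
      rw [← Finset.prod_mul_distrib]
      refine Finset.prod_eq_one fun c _ => ?_
      split_ifs
      · linear_combination ((r' c : ℤ) : ℚ) * ((r' c : ℤ) : ℚ) * unit_mul_self (r c) +
          unit_mul_self (r' c)
      · norm_num
    rw [mul_mul_mul_comm, h3, unit_mul_self, one_mul]
  · have h4 : partialCoeff (D := mirrorWith K w) τ₀ c (star w t') (star w t) =
        ((stateSign t.1 : ℤ) : ℚ) * ((stateSign t'.1 : ℤ) : ℚ) * partialCoeff σ₀ c t t' := by
      rw [partialCoeff_eq (D := mirrorWith K w), h1, h2]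
      exact mirror_dartPartial hw t t' c
    rw [hr', h4, hr]
    by_cases h : t.1 c = false ∧ t'.1 = Function.update t.1 c true
    swap
    · rw [partialCoeff_of_not h]
      ring
    have h5 : (∏ d, if t'.1 d = true then ((r d : ℤ) : ℚ) * ((r' d : ℤ) : ℚ) else 1) =
        ((r c : ℤ) : ℚ) * ((r' c : ℤ) : ℚ) *
          ∏ d, if t.1 d = true then ((r d : ℤ) : ℚ) * ((r' d : ℤ) : ℚ) else 1 := by
      rw [← Finset.mul_prod_erase _ _ (Finset.mem_univ c),
        ← Finset.mul_prod_erase _ _ (Finset.mem_univ c), h.2, Function.update_self, h.1,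
        if_pos rfl, if_neg Bool.false_ne_true, one_mul]
      congr 1
      refine Finset.prod_congr rfl fun d hd => ?_
      rw [Function.update_of_ne (Finset.ne_of_mem_erase hd)]
    have h6 : (∏ d, if t.1 d = true then ((r d : ℤ) : ℚ) * ((r' d : ℤ) : ℚ) else 1) *
        (∏ d, if t.1 d = true then ((r d : ℤ) : ℚ) * ((r' d : ℤ) : ℚ) else 1) = 1 := by
      rw [← Finset.prod_mul_distrib]
      refine Finset.prod_eq_one fun c _ => ?_
      split_ifs
      · linear_combination ((r' c : ℤ) : ℚ) * ((r' c : ℤ) : ℚ) * unit_mul_self (r c) +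
          unit_mul_self (r' c)
      · norm_num
    beta_reduce
    rw [h5]
    linear_combination -(((r c : ℤ) : ℚ) * ((r' c : ℤ) : ℚ) * ((stateSign t.1 : ℤ) : ℚ) *
      ((stateSign t'.1 : ℤ) : ℚ) * partialCoeff σ c t t') * h6

/-- Filtered duality: the mirror image has a nonzero class in degree at least `j` exactly if not
every class of `K` has a representative in degree at least `1 - j`. -/
theorem mirror_exists_iff (hw : ∀ p, (w p).1 = (K.word p).1) (σ : SourceSink K.n)
    (τ : SourceSink (mirrorWith K w).n) (j : ℤ) :
    (∃ f, dmap (D := mirrorWith K w) τ f = 0 ∧ f ∈ homologousGE (D := mirrorWith K w) τ j ∧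
      f ∉ LinearMap.range (dmap (D := mirrorWith K w) τ)) ↔
    ¬ ∀ f, dmap σ f = 0 → f ∈ homologousGE σ (1 - j) := by
  obtain ⟨ε, hε, hcoeff⟩ := exists_mirror_partialCoeff hw σ τ
  have hstar := star_bijective (w := w) hw
  let e : EnhancedState K ≃ EnhancedState (mirrorWith K w) := Equiv.ofBijective _ hstar
  -- the identification of functions on the mirror image with linear forms
  let φ : (EnhancedState (mirrorWith K w) → ℚ) → Module.Dual ℚ (EnhancedState K → ℚ) := fun h =>
    Fintype.linearCombination ℚ fun t => ε t.1 * h (star w t)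
  have hφ : ∀ h f, φ h f = ∑ t, f t * (ε t.1 * h (star w t)) := fun h f => rfl
  have hφ_single : ∀ h (t : EnhancedState K) [DecidableEq (EnhancedState K)],
      φ h (Pi.single t 1) = ε t.1 * h (star w t) := by
    intro h t _
    rw [hφ, Finset.sum_eq_single t]
    · rw [Pi.single_eq_same, one_mul]
    · intro u _ hu
      rw [Pi.single_eq_of_ne hu, zero_mul]
    · exact fun h => absurd (Finset.mem_univ _) h
  have hφ_inj : Function.Injective φ := by
    intro h h' e
    funext u
    obtain ⟨t, rfl⟩ := hstar.2 u
    have h1 := hφ_single h t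
    rw [e, hφ_single] at h1
    exact (mul_left_cancel₀ (left_ne_zero_of_mul ((hε t.1).trans_ne one_ne_zero)) h1).symm
  have hφ_surj : Function.Surjective φ := by
    intro ψ
    refine ⟨fun u => ε (e.symm u).1 * ψ (Pi.single (e.symm u) 1), ?_⟩
    refine (Pi.basisFun ℚ (EnhancedState K)).ext fun t => ?_
    rw [Pi.basisFun_apply]
    convert (@hφ_single (fun u => ε (e.symm u).1 * ψ (Pi.single (e.symm u) 1)) t _).trans ?_ using 1
    have : e.symm (star w t) = t := e.symm_apply_apply t
    rw [this, ← mul_assoc, hε, one_mul]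
  have hφ_d : ∀ h, φ (dmap (D := mirrorWith K w) τ h) = φ h ∘ₗ dmap σ := by
    intro h
    refine LinearMap.ext fun f => ?_
    rw [LinearMap.comp_apply, hφ, hφ]
    have h1 : ∀ t : EnhancedState K, f t * (ε t.1 * dmap (D := mirrorWith K w) τ h (star w t)) =
        ∑ t', ∑ c, f t * (ε t'.1 * h (star w t') * partialCoeff σ c t t') := by
      intro t
      rw [dmap_apply, Finset.sum_comm, ← hstar.sum_comp, Finset.mul_sum, Finset.mul_sum]
      refine Finset.sum_congr rfl fun t' _ => ?_
      rw [Finset.mul_sum, Finset.mul_sum]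
      refine Finset.sum_congr rfl fun c _ => ?_
      rw [hcoeff]
      linear_combination f t * ε t'.1 * h (star w t') * partialCoeff σ c t t' * hε t.1
    rw [Finset.sum_congr rfl fun t _ => h1 t, Finset.sum_comm]
    refine Finset.sum_congr rfl fun t' _ => ?_
    rw [dmap_apply, Finset.sum_mul, Finset.sum_comm]
    refine Finset.sum_congr rfl fun c _ => ?_
    rw [Finset.sum_mul]
    refine Finset.sum_congr rfl fun t _ => ?_
    ring
  have hφ_range : ∀ h, h ∈ LinearMap.range (dmap (D := mirrorWith K w) τ) ↔
      ∀ f, dmap σ f = 0 → φ h f = 0 := by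
    intro h
    constructor
    · rintro ⟨h', rfl⟩ f hf
      rw [hφ_d, LinearMap.comp_apply, hf, map_zero]
    · intro h1
      -- Over a field the image of the transposed map is the annihilator of the kernel.
      have h2 : φ h ∈ LinearMap.range (dmap σ).dualMap := by
        rw [LinearMap.range_dualMap_eq_dualAnnihilator_ker, Submodule.mem_dualAnnihilator]
        exact fun f hf => h1 f (LinearMap.mem_ker.mp hf)
      obtain ⟨ψ, hψ⟩ := h2
      obtain ⟨h', rfl⟩ := hφ_surj ψ
      exact ⟨h', hφ_inj ((hφ_d h').trans hψ)⟩
  have hq : ∀ t : EnhancedState K, qDegree (star w t) = -qDegree t := qDegree_star hw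
  constructor
  · rintro ⟨f, hf, hj, hr⟩ hall
    apply hr
    obtain ⟨f', hf', v, rfl⟩ := mem_homologousGE.mp hj
    -- A cycle of the mirror image in degree at least `j` sees only degrees at most `-j` of `K`, so
    -- it annihilates any representative in degree at least `1 - j`; boundaries are annihilated as
    -- well. Hence it is a boundary.
    refine Submodule.add_mem _ ((hφ_range f').mpr fun x hx => ?_) ⟨v, rfl⟩
    have hf0 : dmap (D := mirrorWith K w) τ f' = 0 := by
      rwa [map_add, dmap_dmap, add_zero] at hf
    obtain ⟨x', hx', y, rfl⟩ := mem_homologousGE.mp (hall x hx)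
    have h1 : φ f' (dmap σ y) = 0 := by
      have := LinearMap.congr_fun (hφ_d f') y
      rw [hf0, LinearMap.comp_apply] at this
      rw [← this, hφ]
      simp
    rw [map_add, h1, add_zero, hφ]
    refine Finset.sum_eq_zero fun t _ => ?_
    by_cases h2 : x' t = 0
    · rw [h2, zero_mul]
    · have h3 := hx' t h2
      have h4 : f' (star w t) = 0 := by
        by_contra h5
        have := hf' _ h5
        rw [hq] at this
        omega
      rw [h4, mul_zero, mul_zero]
  · intro hne
    push Not at hne
    obtain ⟨f, hf, hf'⟩ := hne
    -- The separating form kills the boundaries, hence gives a cycle of the mirror image; it kills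
    -- the enhanced states of degree at least `1 - j`, hence lies in degree at least `j`; and it is
    -- nonzero on the cycle `f`, hence is not a boundary.
    obtain ⟨ψ, hψf, hψ⟩ := Submodule.exists_dual_map_eq_bot_of_notMem hf' inferInstance
    obtain ⟨h, rfl⟩ := hφ_surj ψ
    have hvanish : ∀ x ∈ homologousGE σ (1 - j), φ h x = 0 := by
      intro x hx
      have : φ h x ∈ (homologousGE σ (1 - j)).map (φ h) := ⟨x, hx, rfl⟩
      rwa [hψ, Submodule.mem_bot] at this
    refine ⟨h, ?_, ?_, fun hr => hψf ((hφ_range h).mp hr f hf)⟩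
    · apply hφ_inj
      rw [hφ_d]
      refine LinearMap.ext fun x => ?_
      rw [LinearMap.comp_apply, hvanish _ (range_le_homologousGE σ _ ⟨x, rfl⟩), hφ]
      simp
    · refine (le_sup_left : degreeGE (mirrorWith K w) j ≤ _) fun u hu => ?_
      obtain ⟨t, rfl⟩ := hstar.2 u
      by_contra hlt
      rw [hq] at hlt
      apply hu
      have h1 := hvanish (Pi.single t 1) ((le_sup_left : degreeGE K (1 - j) ≤ _) fun u hu => by
        by_cases hut : u = t
        · subst hut
          omega
        · exact absurd (Pi.single_eq_of_ne hut _) hu)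
      rw [hφ_single] at h1
      exact (mul_eq_zero.mp h1).resolve_left (left_ne_zero_of_mul ((hε t.1).trans_ne one_ne_zero))

theorem IsMirror.exists_eq_mirrorWith {K M : GaussCode} (h : K.IsMirror M) :
    ∃ w : Fin (2 * K.n) ≃ Fin K.n × Bool, (∀ p, (w p).1 = (K.word p).1) ∧ M = mirrorWith K w := by
  rcases h with rfl | rfl
  · exact ⟨K.word.trans (Equiv.prodCongr (Equiv.refl _) Equiv.boolNot), fun p => rfl, rfl⟩
  · exact ⟨K.word, fun p => rfl, rfl⟩

end Mirror

end GaussCode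

theorem mainTheorem9 (K : GaussCode) (σ : SourceSink K.n) :
    IsGreatest (K.levels σ) (K.sMax σ) ∧
    IsLeast (K.levels σ) (K.sMin σ) ∧
    K.sMax σ = K.sMin σ + 2 ∧
    K.rasmussen σ = (K.sMin σ : ℚ) + 1 ∧
    ∀ M : GaussCode, K.IsMirror M → ∀ τ : SourceSink M.n,
      M.sMax τ = -K.sMin σ ∧
      M.sMin τ = -K.sMax σ ∧
      M.rasmussen τ = -K.rasmussen σ := by
  obtain ⟨m, hm, hall, -⟩ := GaussCode.exists_levels_eq σ
  obtain ⟨hg, hmax⟩ := GaussCode.sMax_eq hm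
  obtain ⟨hl, hmin⟩ := GaussCode.sMin_eq hm
  refine ⟨hmax ▸ hg, hmin ▸ hl, by rw [hmax, hmin], ?_, ?_⟩
  · unfold GaussCode.rasmussen
    rw [hmax, hmin]
    push_cast
    ring
  · rintro M hM τ
    obtain ⟨w, hw, rfl⟩ := hM.exists_eq_mirrorWith
    obtain ⟨m', hm', -, hex⟩ := GaussCode.exists_levels_eq (D := K.mirrorWith w) τ
    have hmax' := (GaussCode.sMax_eq hm').2
    have hmin' := (GaussCode.sMin_eq hm').2
    -- The condition on the right means `j ≤ -m`, so the highest level `m' + 2` of the mirror image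
    -- is `-m`; two values of `j` suffice to see this.
    have key : ∀ j, j ≤ m' + 2 ↔ ¬ (1 - j ≤ m) := fun j => by
      rw [← hex, ← hall, GaussCode.mirror_exists_iff hw σ τ j]
    have h1 := key (m' + 2)
    have h2 := key (m' + 3)
    have hmm : m' = -m - 2 := by omega
    unfold GaussCode.rasmussen
    rw [hmax', hmin', hmax, hmin, hmm]
    refine ⟨by ring, by ring, ?_⟩
    push_cast
    ring
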